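/- **Notation.** For $g\ge 1$ let $\mathfrak h_g$ be the Siegel upper half space of symmetric complex $g\times g$ matrices with positive definite imaginary part, on which $Sp(2g,\mathbb Z)$ acts by $Z\mapsto (AZ+B)(CZ+D)^{-1}$, and let $\mathcal A_g=Sp(2g,\mathbb Z)\backslash\mathfrak h_g$, with the quotient topology and the sheaf of functions whose pull-back to $\mathfrak h_g$ is holomorphic. The embeddings $Z\mapsto \begin{pmatrix} Z&0\\0&i\end{pmatrix}$ of $\mathfrak h_g$ into $\mathfrak h_{g+1}$ and $$\begin{pmatrix}A&B\\C&D\end{pmatrix}\mapsto\begin{pmatrix}\begin{pmatrix}A&0\\0&1\end{pmatrix}&\begin{pmatrix}B&0\\0&0\end{pmatrix}\\ \begin{pmatrix}C&0\\0&0\end{pmatrix}&\begin{pmatrix}D&0\\0&1\end{pmatrix}\end{pmatrix}$$ of $Sp(2g,\mathbb Z)$ into $Sp(2(g+1),\mathbb Z)$ are compatible with the actions. Let $\mathfrak h_\infty=\varinjlim\mathfrak h_g$, with the direct limit topology, let $Sp(\infty,\mathbb Z)=\varinjlim Sp(2g,\mathbb Z)$, and let $\mathcal A_\infty=Sp(\infty,\mathbb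 Z)\backslash\mathfrak h_\infty$, with the quotient topology. A function on an open subset of $\mathfrak h_\infty$ is holomorphic if its restrictions to all $\mathfrak h_g$ are holomorphic; the structure sheaf of $\mathcal A_\infty$ consists of the functions whose pull-back to $\mathfrak h_\infty$ is holomorphic. **Proposition.** 1. *$\mathcal A_\infty$ is an (infinite dimensional) complex space*, namely the direct limit of the finite dimensional complex spaces $\mathcal A_g$: the space $\mathcal A_\infty$ is Hausdorff; every $\mathcal A_g$, $g\ge1$, is a reduced complex space (Hausdorff and locally isomorphic, together with its sheaf of functions, to an analytic subset of an open subset of some $\mathbb C^n$); the maps $\mathcal A_g\to\mathcal A_{g+1}$ induced by the embeddings above are closed embeddings of complex spaces; the induced maps $\mathcal A_g\to\mathcal A_\infty$ are compatible with them and are homeomorphisms onto closed subsets whose union is $\mathcal A_\infty$; a subset of $\mathcal A_\infty$ is open if and only if its preimages in all $\mathcal A_g$ are open; and a function on an open subset of $\mathcal A_\infty$ is a section of the structure sheaf if and only if its restrictions to all $\mathcal A_g$ are. 2. *$\mathcal A_\infty$ has a canonical stratification induced from the canonical stratifications of $\mathcal A_1$ and of the differences $\mathcal A_{g+1}-\mathcal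 A_g$, $g\ge1$.* The canonical stratification of $P_1=\mathcal A_1$, respectively of $P_{g+1}=\mathcal A_{g+1}-\mathcal A_g$, is the one by orbit types: the strata of $P_g$ are the connected components of the sets of all points of $P_g$ whose isotropy groups belong to a given conjugacy class of subgroups of $Sp(2g,\mathbb Z)$. They form a stratification of $P_g$, that is, a locally finite partition into connected, locally closed complex submanifolds such that the closure of a stratum contains every stratum that it meets. The strata of all $P_g$, $g\ge 1$, together form a stratification of $\mathcal A_\infty$: they are a partition of $\mathcal A_\infty$ into connected, locally closed subsets, each of which is a complex submanifold of some $\mathcal A_g$; every $\mathcal A_g$ is a union of strata, and these are a locally finite family in $\mathcal A_g$; and the closure of a stratum in $\mathcal A_\infty$ contains every stratum that it meets. -/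

import Mathlib

open Matrix Topology

noncomputable section
namespace UniversalModuli

/-- The matrix with upper left block `Z` and the scalar matrix `c • 1` as lower right block. -/
def pad {R : Type} [Zero R] {n : ℕ} (m : ℕ) (c : R) (Z : Matrix (Fin n) (Fin n) R) :
    Matrix (Fin m) (Fin m) R :=
  Matrix.of fun i j =>
    if h : (i : ℕ) < n ∧ (j : ℕ) < n then Z ⟨i, h.1⟩ ⟨j, h.2⟩
    else if i = j then c else 0

section pad
variable {R : Type} {n m k : ℕ}

theorem pad_self [Zero R] (c : R) (Z : Matrix (Fin n) (Fin n) R) : pad n c Z = Z := by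
  ext i j
  simp [pad]

theorem pad_pad [Zero R] (hnk : n ≤ k) (c : R) (Z : Matrix (Fin n) (Fin n) R) :
    pad m c (pad k c Z) = pad m c Z := by
  ext i j
  simp only [pad, Matrix.of_apply, Fin.ext_iff]
  split_ifs <;> first | rfl | omega

theorem pad_transpose [Zero R] (c : R) (Z : Matrix (Fin n) (Fin n) R) :
    (pad m c Z)ᵀ = pad m c Zᵀ := by
  ext i j
  simp only [pad, Matrix.of_apply, Matrix.transpose_apply, Fin.ext_iff]
  split_ifs <;> first | rfl | omega

theorem pad_map {S : Type} [Zero R] [Zero S] (f : R → S) (hf : f 0 = 0) (c : R)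
    (Z : Matrix (Fin n) (Fin n) R) : (pad m c Z).map f = pad m (f c) (Z.map f) := by
  ext i j
  simp only [pad, Matrix.of_apply, Matrix.map_apply]
  split_ifs <;> simp [hf]

theorem pad_add [AddZeroClass R] (c d : R) (X Y : Matrix (Fin n) (Fin n) R) :
    pad m c X + pad m d Y = pad m (c + d) (X + Y) := by
  ext i j
  simp only [pad, Matrix.of_apply, Matrix.add_apply]
  split_ifs <;> simp

theorem pad_neg [Ring R] (c : R) (X : Matrix (Fin n) (Fin n) R) :
    -pad m c X = pad m (-c) (-X) := by
  ext i j
  simp only [pad, Matrix.of_apply, Matrix.neg_apply]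
  split_ifs <;> simp

theorem pad_one [Zero R] [One R] : pad m (1 : R) (1 : Matrix (Fin n) (Fin n) R) = 1 := by
  ext i j
  simp only [pad, Matrix.of_apply, Matrix.one_apply, Fin.ext_iff]
  split_ifs <;> simp_all

theorem pad_zero [Zero R] : pad m (0 : R) (0 : Matrix (Fin n) (Fin n) R) = 0 := by
  ext i j
  simp [pad]

theorem pad_mul [Semiring R] (hnm : n ≤ m) (c d : R) (X Y : Matrix (Fin n) (Fin n) R) :
    pad m c X * pad m d Y = pad m (c * d) (X * Y) := by
  obtain ⟨k, rfl⟩ := Nat.exists_eq_add_of_le hnm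
  ext i j
  rw [Matrix.mul_apply, Fin.sum_univ_add]
  by_cases hi : (i : ℕ) < n <;> by_cases hj : (j : ℕ) < n
  · have : ∀ x : Fin k, (Fin.natAdd n x) ≠ j := fun x h => by
      have := congrArg Fin.val h; simp at this; omega
    simp [pad, hi, hj, Matrix.mul_apply, this]
  · have h1 : ∀ x : Fin n, (Fin.castAdd k x) ≠ j := fun x h => by
      have := congrArg Fin.val h; simp at this; omega
    have h2 : ∀ x : Fin k, i ≠ (Fin.natAdd n x) := fun x h => by
      have := congrArg Fin.val h; simp at this; omega
    have h3 : i ≠ j := by rintro rfl; exact hj hi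
    simp [pad, hi, hj, h1, h2, h3]
  · have h1 : ∀ x : Fin n, i ≠ (Fin.castAdd k x) := fun x h => by
      have := congrArg Fin.val h; simp at this; omega
    have h2 : ∀ x : Fin k, (Fin.natAdd n x) ≠ j := fun x h => by
      have := congrArg Fin.val h; simp at this; omega
    have h3 : i ≠ j := by rintro rfl; exact hi hj
    simp [pad, hi, hj, h1, h2, h3]
  · have h1 : ∀ x : Fin n, i ≠ (Fin.castAdd k x) := fun x h => by
      have := congrArg Fin.val h; simp at this; omega
    obtain ⟨i', rfl⟩ : ∃ i', i = Fin.natAdd n i' :=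
      ⟨⟨i - n, by omega⟩, by ext; simp; omega⟩
    obtain ⟨j', rfl⟩ : ∃ j', j = Fin.natAdd n j' :=
      ⟨⟨j - n, by omega⟩, by ext; simp; omega⟩
    simp [pad, h1, ← ite_and]
    by_cases h : i' = j'
    · subst h
      rw [Finset.sum_eq_single i'] <;> simp +contextual
    · rw [if_neg h]
      exact Finset.sum_eq_zero fun x _ => if_neg (by rintro ⟨rfl, rfl⟩; exact h rfl)

theorem pad_injective [Zero R] (hnm : n ≤ m) (c : R) :
    Function.Injective (pad (n := n) m c) := by
  intro X Y h
  ext i j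
  have := congrFun (congrFun h ⟨i, by omega⟩) ⟨j, by omega⟩
  simpa [pad] using this

theorem pad_posDef (hnm : n ≤ m) {Y : Matrix (Fin n) (Fin n) ℝ} (hY : Y.PosDef) :
    (pad m 1 Y).PosDef := by
  obtain ⟨k, rfl⟩ := Nat.exists_eq_add_of_le hnm
  refine Matrix.PosDef.of_dotProduct_mulVec_pos ?_ ?_
  · have := hY.isHermitian
    simp only [Matrix.IsHermitian, Matrix.conjTranspose_eq_transpose_of_trivial] at this ⊢
    rw [pad_transpose, this]
  · intro x hx
    have key : star x ⬝ᵥ (pad (n + k) 1 Y *ᵥ x) =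
        star (fun i => x (Fin.castAdd k i)) ⬝ᵥ (Y *ᵥ fun i => x (Fin.castAdd k i)) +
        ∑ i, x (Fin.natAdd n i) * x (Fin.natAdd n i) := by
      simp only [dotProduct, Matrix.mulVec, Fin.sum_univ_add, star_trivial, Pi.star_apply]
      congr 1
      · refine Finset.sum_congr rfl fun i _ => ?_
        congr 1
        have : ∀ x : Fin k, (Fin.castAdd k i) ≠ (Fin.natAdd n x) := fun x h => by
          have := congrArg Fin.val h; simp at this; omega
        simp [pad, this]
      · refine Finset.sum_congr rfl fun i _ => ?_
        congr 1
        have : ∀ x : Fin n, (Fin.natAdd n i) ≠ (Fin.castAdd k x) := fun x h => by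
          have := congrArg Fin.val h; simp at this; omega
        simp [pad, this]
    rw [key]
    by_cases h : (fun i => x (Fin.castAdd k i)) = 0
    · have : ∃ i, x (Fin.natAdd n i) ≠ 0 := by
        by_contra! hc
        apply hx
        ext i
        refine Fin.addCases (fun i => ?_) (fun i => ?_) i
        · exact congrFun h i
        · exact hc i
      obtain ⟨i, hi⟩ := this
      rw [h]
      simp only [star_zero, zero_dotProduct, zero_add]
      exact Finset.sum_pos' (fun i _ => mul_self_nonneg _) ⟨i, Finset.mem_univ _, mul_self_pos.2 hi⟩
    · exact add_pos_of_pos_of_nonneg (hY.dotProduct_mulVec_pos h)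
        (Finset.sum_nonneg fun i _ => mul_self_nonneg _)

end pad

/-! ### Siegel upper half spaces and the modular groups -/

/-- The Siegel upper half space of symmetric complex `g × g` matrices with positive definite
imaginary part. -/
abbrev SiegelSpace (g : ℕ) : Type :=
  {Z : Matrix (Fin g) (Fin g) ℂ // Zᵀ = Z ∧ (Z.map Complex.im).PosDef}

/-- `Sp(2g, ℤ)`. -/
abbrev Sp (g : ℕ) : Type := Matrix.symplecticGroup (Fin g) ℤ

namespace Sp
variable {g : ℕ}

/-- The upper left block of an element of `Sp(2g, ℤ)`, as a complex matrix. -/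
def A (M : Sp g) : Matrix (Fin g) (Fin g) ℂ := M.1.toBlocks₁₁.map (Int.cast : ℤ → ℂ)
/-- The upper right block. -/
def B (M : Sp g) : Matrix (Fin g) (Fin g) ℂ := M.1.toBlocks₁₂.map (Int.cast : ℤ → ℂ)
/-- The lower left block. -/
def C (M : Sp g) : Matrix (Fin g) (Fin g) ℂ := M.1.toBlocks₂₁.map (Int.cast : ℤ → ℂ)
/-- The lower right block. -/
def D (M : Sp g) : Matrix (Fin g) (Fin g) ℂ := M.1.toBlocks₂₂.map (Int.cast : ℤ → ℂ)

/-- The numerator `A Z + B` of the modular action. -/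
def num (M : Sp g) (Z : Matrix (Fin g) (Fin g) ℂ) : Matrix (Fin g) (Fin g) ℂ := M.A * Z + M.B
/-- The denominator `C Z + D` of the modular action. -/
def den (M : Sp g) (Z : Matrix (Fin g) (Fin g) ℂ) : Matrix (Fin g) (Fin g) ℂ := M.C * Z + M.D

theorem map_eq (M : Sp g) :
    M.1.map (Int.castRingHom ℂ) = fromBlocks M.A M.B M.C M.D := by
  conv_lhs => rw [← fromBlocks_toBlocks M.1]
  rw [fromBlocks_map]; rfl

theorem relations (M : Sp g) :
    M.Aᵀ * M.C = M.Cᵀ * M.A ∧ M.Bᵀ * M.D = M.Dᵀ * M.B ∧ M.Aᵀ * M.D - M.Cᵀ * M.B = 1 := by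
  have h := SymplecticGroup.mem_iff'.1 (SymplecticGroup.map_mem M.2 (Int.castRingHom ℂ))
  rw [map_eq, Matrix.J, fromBlocks_transpose, fromBlocks_multiply, fromBlocks_multiply] at h
  obtain ⟨h1, h2, h3, h4⟩ := fromBlocks_inj.1 h
  simp only [Matrix.mul_zero, Matrix.mul_one, zero_add, add_zero, Matrix.mul_neg,
    Matrix.neg_mul] at h1 h2 h3 h4
  refine ⟨?_, ?_, ?_⟩
  · rw [← sub_eq_zero, ← neg_eq_zero, ← h1]; abel
  · rw [← sub_eq_zero, ← neg_eq_zero, ← h4]; abel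
  · rw [← neg_inj, ← h2]; abel

theorem blocks_one : (1 : Sp g).A = 1 ∧ (1 : Sp g).B = 0 ∧ (1 : Sp g).C = 0 ∧
    (1 : Sp g).D = 1 := by
  have h := map_eq (1 : Sp g)
  rw [show (1 : Sp g).1 = 1 from rfl, Matrix.map_one _ (map_zero _) (map_one _),
    ← fromBlocks_one] at h
  obtain ⟨h1, h2, h3, h4⟩ := fromBlocks_inj.1 h
  exact ⟨h1.symm, h2.symm, h3.symm, h4.symm⟩

theorem blocks_mul (M N : Sp g) :
    (M * N).A = M.A * N.A + M.B * N.C ∧ (M * N).B = M.A * N.B + M.B * N.D ∧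
    (M * N).C = M.C * N.A + M.D * N.C ∧ (M * N).D = M.C * N.B + M.D * N.D := by
  have h := map_eq (M * N)
  rw [show (M * N).1 = M.1 * N.1 from rfl, Matrix.map_mul, map_eq, map_eq,
    fromBlocks_multiply] at h
  obtain ⟨h1, h2, h3, h4⟩ := fromBlocks_inj.1 h
  exact ⟨h1.symm, h2.symm, h3.symm, h4.symm⟩

theorem conj_blocks (M : Sp g) : M.Aᴴ = M.Aᵀ ∧ M.Bᴴ = M.Bᵀ ∧ M.Cᴴ = M.Cᵀ ∧ M.Dᴴ = M.Dᵀ := by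
  refine ⟨?_, ?_, ?_, ?_⟩ <;> ext i j <;>
    simp [A, B, C, D, Matrix.conjTranspose_apply, Matrix.transpose_apply]

theorem num_transpose_mul_den (M : Sp g) {Z : Matrix (Fin g) (Fin g) ℂ} (hZ : Zᵀ = Z) :
    (M.num Z)ᵀ * M.den Z = (M.den Z)ᵀ * M.num Z := by
  obtain ⟨h1, h2, h3⟩ := M.relations
  have h3' : M.Dᵀ * M.A - M.Bᵀ * M.C = 1 := by
    have := congrArg Matrix.transpose h3
    simpa using this
  simp only [num, den, transpose_add, transpose_mul, hZ]
  have e1 : (Z * M.Aᵀ + M.Bᵀ) * (M.C * Z + M.D) =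
      Z * (M.Aᵀ * M.C) * Z + Z * (M.Aᵀ * M.D) + M.Bᵀ * M.C * Z + M.Bᵀ * M.D := by noncomm_ring
  have e2 : (Z * M.Cᵀ + M.Dᵀ) * (M.A * Z + M.B) =
      Z * (M.Cᵀ * M.A) * Z + Z * (M.Cᵀ * M.B) + M.Dᵀ * M.A * Z + M.Dᵀ * M.B := by noncomm_ring
  rw [e1, e2, h1, h2, sub_eq_iff_eq_add.1 h3, sub_eq_iff_eq_add.1 h3']
  noncomm_ring

theorem den_conj_mul_num (M : Sp g) (Z : Matrix (Fin g) (Fin g) ℂ) :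
    (M.den Z)ᴴ * M.num Z - (M.num Z)ᴴ * M.den Z = Z - Zᴴ := by
  obtain ⟨h1, h2, h3⟩ := M.relations
  obtain ⟨c1, c2, c3, c4⟩ := M.conj_blocks
  have h3' : M.Dᵀ * M.A - M.Bᵀ * M.C = 1 := by
    have := congrArg Matrix.transpose h3
    simpa using this
  simp only [num, den, conjTranspose_add, conjTranspose_mul, c1, c2, c3, c4]
  have e1 : (Zᴴ * M.Aᵀ + M.Bᵀ) * (M.C * Z + M.D) =
      Zᴴ * (M.Aᵀ * M.C) * Z + Zᴴ * (M.Aᵀ * M.D) + M.Bᵀ * M.C * Z + M.Bᵀ * M.D := by noncomm_ring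
  have e2 : (Zᴴ * M.Cᵀ + M.Dᵀ) * (M.A * Z + M.B) =
      Zᴴ * (M.Cᵀ * M.A) * Z + Zᴴ * (M.Cᵀ * M.B) + M.Dᵀ * M.A * Z + M.Dᵀ * M.B := by noncomm_ring
  rw [e1, e2, h1, h2, sub_eq_iff_eq_add.1 h3, sub_eq_iff_eq_add.1 h3']
  noncomm_ring

theorem sub_conjTranspose {Z : Matrix (Fin g) (Fin g) ℂ} (hZ : Zᵀ = Z) :
    Z - Zᴴ = (2 * Complex.I) • (Z.map Complex.im).map (Complex.ofReal) := by
  ext i j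
  have : Z j i = Z i j := congrFun (congrFun hZ i) j
  simp only [Matrix.sub_apply, Matrix.conjTranspose_apply, Matrix.smul_apply, Matrix.map_apply,
    this, smul_eq_mul]
  apply Complex.ext <;> simp
  ring

open scoped ComplexOrder in
theorem posDef_ofReal {Y : Matrix (Fin g) (Fin g) ℝ} :
    (Y.map Complex.ofReal).PosDef ↔ Y.PosDef := by
  rw [Matrix.posDef_iff_dotProduct_mulVec, Matrix.posDef_iff_dotProduct_mulVec]
  have hH : (Y.map Complex.ofReal).IsHermitian ↔ Y.IsHermitian := by
    simp only [Matrix.IsHermitian, ← Matrix.ext_iff, Matrix.conjTranspose_apply,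
      Matrix.map_apply, star_trivial, Complex.star_def, Complex.conj_ofReal, Complex.ofReal_inj]
  rw [hH]
  refine and_congr_right fun hY => ⟨fun h x hx => ?_, fun h x hx => ?_⟩
  · have hx' : (fun i => (x i : ℂ)) ≠ 0 := fun h0 => hx (by
      ext i; simpa using congrFun h0 i)
    have := h hx'
    have e : star (fun i => (x i : ℂ)) ⬝ᵥ (Y.map Complex.ofReal) *ᵥ (fun i => (x i : ℂ)) =
        ((star x ⬝ᵥ Y *ᵥ x : ℝ) : ℂ) := by
      simp [dotProduct, Matrix.mulVec]
    rw [e] at this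
    exact_mod_cast this
  · have hs : ∀ i j, Y j i = Y i j := fun i j => by
      have := congrFun (congrFun hY i) j
      simpa [Matrix.conjTranspose_apply] using this
    set a : Fin g → ℝ := fun i => (x i).re with ha
    set b : Fin g → ℝ := fun i => (x i).im with hb
    have e : star x ⬝ᵥ (Y.map Complex.ofReal) *ᵥ x =
        ((star a ⬝ᵥ Y *ᵥ a + star b ⬝ᵥ Y *ᵥ b : ℝ) : ℂ) := by
      simp only [dotProduct, Matrix.mulVec, Finset.mul_sum, Matrix.map_apply, star_trivial,
        Pi.star_apply]
      apply Complex.ext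
      · simp [ha, hb, ← Finset.sum_add_distrib]
      · simp
        have key : (∑ i, ∑ j, ((x i).re * (Y i j * (x j).im) - (x i).im * (Y i j * (x j).re))) = 0 := by
          simp only [Finset.sum_sub_distrib]
          rw [sub_eq_zero, Finset.sum_comm]
          refine Finset.sum_congr rfl fun i _ => Finset.sum_congr rfl fun j _ => ?_
          rw [hs j i]; ring
        rw [← key]
        refine Finset.sum_congr rfl fun i _ => Finset.sum_congr rfl fun j _ => ?_
        ring
    rw [e]
    have hab : a ≠ 0 ∨ b ≠ 0 := by
      by_contra! hc
      exact hx (by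
        ext i
        exact Complex.ext (congrFun hc.1 i) (congrFun hc.2 i))
    have hnn : ∀ v : Fin g → ℝ, 0 ≤ star v ⬝ᵥ Y *ᵥ v := fun v => by
      by_cases hv : v = 0
      · simp [hv]
      · exact (h hv).le
    have : 0 < star a ⬝ᵥ Y *ᵥ a + star b ⬝ᵥ Y *ᵥ b := by
      rcases hab with h0 | h0
      · exact add_pos_of_pos_of_nonneg (h h0) (hnn b)
      · exact add_pos_of_nonneg_of_pos (hnn a) (h h0)
    exact_mod_cast this

open scoped ComplexOrder in
theorem isUnit_den (M : Sp g) (Z : SiegelSpace g) : IsUnit (M.den Z.1) := by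
  rw [← Matrix.mulVec_injective_iff_isUnit]
  suffices h : ∀ v, M.den Z.1 *ᵥ v = 0 → v = 0 by
    intro v w hvw
    rw [← sub_eq_zero]
    apply h
    rw [Matrix.mulVec_sub, sub_eq_zero]
    exact hvw
  intro v hv
  by_contra hv0
  have hpos := (posDef_ofReal.2 Z.2.2).dotProduct_mulVec_pos hv0
  have h := congrArg (fun X => star v ⬝ᵥ X *ᵥ v) (M.den_conj_mul_num Z.1)
  simp only [sub_conjTranspose Z.2.1, Matrix.sub_mulVec, ← Matrix.mulVec_mulVec, hv,
    Matrix.mulVec_zero, sub_zero, Matrix.dotProduct_mulVec, ← Matrix.star_mulVec, star_zero,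
    Matrix.zero_vecMul, zero_dotProduct] at h
  rw [← Matrix.dotProduct_mulVec, Matrix.smul_mulVec, dotProduct_smul, eq_comm, smul_eq_zero] at h
  rcases h with h | h
  · simp at h
  · exact hpos.ne' h

open scoped ComplexOrder in
theorem smul_mem (M : Sp g) (Z : SiegelSpace g) :
    (M.num Z.1 * (M.den Z.1)⁻¹)ᵀ = M.num Z.1 * (M.den Z.1)⁻¹ ∧
    ((M.num Z.1 * (M.den Z.1)⁻¹).map Complex.im).PosDef := by
  have hu := (Matrix.isUnit_iff_isUnit_det _).1 (M.isUnit_den Z)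
  have hut : IsUnit (M.den Z.1)ᵀ.det := by rwa [Matrix.det_transpose]
  have huc : IsUnit (M.den Z.1)ᴴ.det := by
    rw [Matrix.det_conjTranspose]; exact hu.star
  have hsymm : (M.num Z.1 * (M.den Z.1)⁻¹)ᵀ = M.num Z.1 * (M.den Z.1)⁻¹ := by
    rw [Matrix.transpose_mul, Matrix.transpose_nonsing_inv]
    have := congrArg (fun X => (M.den Z.1)ᵀ⁻¹ * X * (M.den Z.1)⁻¹)
      (M.num_transpose_mul_den Z.2.1)
    simp only [← Matrix.mul_assoc, Matrix.nonsing_inv_mul _ hut, Matrix.one_mul] at this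
    rwa [Matrix.mul_assoc, Matrix.mul_nonsing_inv _ hu, Matrix.mul_one] at this
  refine ⟨hsymm, ?_⟩
  have h := congrArg (fun X => ((M.den Z.1)⁻¹)ᴴ * X * (M.den Z.1)⁻¹) (M.den_conj_mul_num Z.1)
  have hinv : ((M.den Z.1)⁻¹)ᴴ * (M.den Z.1)ᴴ = 1 := by
    rw [← Matrix.conjTranspose_mul, Matrix.mul_nonsing_inv _ hu, Matrix.conjTranspose_one]
  have hl : ((M.den Z.1)⁻¹)ᴴ * ((M.den Z.1)ᴴ * M.num Z.1 - (M.num Z.1)ᴴ * M.den Z.1) *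
      (M.den Z.1)⁻¹ = M.num Z.1 * (M.den Z.1)⁻¹ - (M.num Z.1 * (M.den Z.1)⁻¹)ᴴ := by
    rw [Matrix.mul_sub, Matrix.sub_mul, ← Matrix.mul_assoc, hinv, Matrix.one_mul,
      Matrix.conjTranspose_mul, Matrix.mul_assoc _ _ (M.den Z.1)⁻¹,
      Matrix.mul_assoc _ _ (M.den Z.1)⁻¹, Matrix.mul_nonsing_inv _ hu, Matrix.mul_one]
  simp only [hl] at h
  rw [sub_conjTranspose hsymm, sub_conjTranspose Z.2.1, Matrix.mul_smul, Matrix.smul_mul] at h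
  have h2 : (2 * Complex.I) ≠ 0 := by simp
  have h3 := smul_right_injective _ h2 h
  rw [← posDef_ofReal, h3]
  apply (posDef_ofReal.2 Z.2.2).conjTranspose_mul_mul_same
  rw [Matrix.mulVec_injective_iff_isUnit, Matrix.isUnit_nonsing_inv_iff]
  exact M.isUnit_den Z

end Sp

/-- The action `Z ↦ (A Z + B) (C Z + D)⁻¹` of `Sp(2g, ℤ)` on the Siegel upper half space. -/
instance (g : ℕ) : MulAction (Sp g) (SiegelSpace g) where
  smul M Z := ⟨M.num Z.1 * (M.den Z.1)⁻¹, M.smul_mem Z⟩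
  one_smul Z := by
    obtain ⟨h1, h2, h3, h4⟩ := Sp.blocks_one (g := g)
    apply Subtype.ext
    change Sp.num 1 Z.1 * (Sp.den 1 Z.1)⁻¹ = Z.1
    simp [Sp.num, Sp.den, h1, h2, h3, h4]
  mul_smul M N Z := by
    obtain ⟨h1, h2, h3, h4⟩ := Sp.blocks_mul M N
    apply Subtype.ext
    change (M * N).num Z.1 * ((M * N).den Z.1)⁻¹ =
      M.num (N.num Z.1 * (N.den Z.1)⁻¹) * (M.den (N.num Z.1 * (N.den Z.1)⁻¹))⁻¹
    have hu := (Matrix.isUnit_iff_isUnit_det _).1 (N.isUnit_den Z)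
    have hn : (M * N).num Z.1 = M.num (N.num Z.1 * (N.den Z.1)⁻¹) * N.den Z.1 := by
      rw [Sp.num, Sp.num, add_mul, Matrix.mul_assoc, Matrix.mul_assoc,
        Matrix.nonsing_inv_mul _ hu, h1, h2, Sp.num, Sp.den]
      noncomm_ring
    have hd : (M * N).den Z.1 = M.den (N.num Z.1 * (N.den Z.1)⁻¹) * N.den Z.1 := by
      rw [Sp.den, Sp.den, add_mul, Matrix.mul_assoc, Matrix.mul_assoc,
        Matrix.nonsing_inv_mul _ hu, h3, h4, Sp.num, Sp.den]
      noncomm_ring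
    rw [hn, hd, Matrix.mul_inv_rev, Matrix.mul_assoc, ← Matrix.mul_assoc (N.den Z.1),
      Matrix.mul_nonsing_inv _ hu, Matrix.one_mul]

theorem smul_val {g : ℕ} (M : Sp g) (Z : SiegelSpace g) :
    (M • Z).1 = M.num Z.1 * (M.den Z.1)⁻¹ := rfl

/-! ### The embeddings and the direct limits -/

/-- The embedding `X + i Y ↦ diag(X, 0) + i diag(Y, 1)` of Siegel upper half spaces. -/
def SiegelSpace.incl (g h : ℕ) (hgh : g ≤ h) : SiegelSpace g ↪ SiegelSpace h where
  toFun Z := ⟨pad h Complex.I Z.1, by rw [pad_transpose, Z.2.1], by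
    rw [pad_map _ (by simp), Complex.I_im]
    exact pad_posDef hgh Z.2.2⟩
  inj' Z W h := Subtype.ext (pad_injective hgh _ (congrArg Subtype.val h))

instance : DirectedSystem SiegelSpace (fun g h hgh => SiegelSpace.incl g h hgh) where
  map_self _ Z := Subtype.ext (pad_self _ Z.1)
  map_map _ _ _ hij _ Z := Subtype.ext (pad_pad hij _ Z.1)

theorem Sp.pad_mem {g h : ℕ} (hgh : g ≤ h) (M : Sp g) :
    fromBlocks (pad h 1 M.1.toBlocks₁₁) (pad h 0 M.1.toBlocks₁₂)
      (pad h 0 M.1.toBlocks₂₁) (pad h 1 M.1.toBlocks₂₂) ∈ symplecticGroup (Fin h) ℤ := by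
  have key := SymplecticGroup.mem_iff.1 M.2
  rw [← fromBlocks_toBlocks M.1, Matrix.J, fromBlocks_transpose, fromBlocks_multiply,
    fromBlocks_multiply] at key
  obtain ⟨h1, h2, h3, h4⟩ := fromBlocks_inj.1 key
  simp only [Matrix.mul_zero, Matrix.mul_one, zero_add, add_zero, Matrix.mul_neg,
    Matrix.neg_mul] at h1 h2 h3 h4
  rw [SymplecticGroup.mem_iff, Matrix.J, fromBlocks_transpose, fromBlocks_multiply,
    fromBlocks_multiply]
  simp only [Matrix.mul_zero, Matrix.mul_one, zero_add, add_zero, Matrix.mul_neg,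
    Matrix.neg_mul, pad_transpose, pad_mul hgh, pad_neg, pad_add]
  rw [h1, h2, h3, h4]
  simp [pad_zero, pad_one, ← pad_neg]

/-- The embedding `Sp(2g, ℤ) → Sp(2h, ℤ)`, given on blocks by
`(A, B, C, D) ↦ (diag(A, 1), diag(B, 0), diag(C, 0), diag(D, 1))`. -/
def Sp.incl (g h : ℕ) (hgh : g ≤ h) : Sp g →* Sp h :=
  MonoidHom.mk'
    (fun M => ⟨fromBlocks (pad h 1 M.1.toBlocks₁₁) (pad h 0 M.1.toBlocks₁₂)
      (pad h 0 M.1.toBlocks₂₁) (pad h 1 M.1.toBlocks₂₂), Sp.pad_mem hgh M⟩)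
    (fun M N => by
      apply Subtype.ext
      have e : (M * N).1 = M.1 * N.1 := rfl
      rw [← fromBlocks_toBlocks M.1, ← fromBlocks_toBlocks N.1, fromBlocks_multiply] at e
      change fromBlocks _ _ _ _ = fromBlocks _ _ _ _ * fromBlocks _ _ _ _
      rw [e, fromBlocks_multiply]
      simp [pad_mul hgh, pad_add])

instance : DirectedSystem Sp (fun g h hgh => Sp.incl g h hgh) where
  map_self _ M := by
    apply Subtype.ext
    change fromBlocks _ _ _ _ = M.1
    simp [pad_self, fromBlocks_toBlocks]
  map_map _ _ _ hij _ M := by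
    apply Subtype.ext
    change fromBlocks _ _ _ _ = fromBlocks _ _ _ _
    simp [Sp.incl, pad_pad hij]

/-- The modular action is compatible with the embeddings. -/
theorem incl_smul {g h : ℕ} (hgh : g ≤ h) (M : Sp g) (Z : SiegelSpace g) :
    SiegelSpace.incl g h hgh (M • Z) = Sp.incl g h hgh M • SiegelSpace.incl g h hgh Z := by
  have hu := (Matrix.isUnit_iff_isUnit_det _).1 (M.isUnit_den Z)
  have hA : (Sp.incl g h hgh M).A = pad h 1 M.A := by
    simp [Sp.A, Sp.incl, pad_map (Int.cast : ℤ → ℂ) Int.cast_zero]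
  have hB : (Sp.incl g h hgh M).B = pad h 0 M.B := by
    simp [Sp.B, Sp.incl, pad_map (Int.cast : ℤ → ℂ) Int.cast_zero]
  have hC : (Sp.incl g h hgh M).C = pad h 0 M.C := by
    simp [Sp.C, Sp.incl, pad_map (Int.cast : ℤ → ℂ) Int.cast_zero]
  have hD : (Sp.incl g h hgh M).D = pad h 1 M.D := by
    simp [Sp.D, Sp.incl, pad_map (Int.cast : ℤ → ℂ) Int.cast_zero]
  apply Subtype.ext
  change pad h Complex.I (M.num Z.1 * (M.den Z.1)⁻¹) =
    Sp.num _ (pad h Complex.I Z.1) * (Sp.den _ (pad h Complex.I Z.1))⁻¹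
  have hn : Sp.num (Sp.incl g h hgh M) (pad h Complex.I Z.1) = pad h Complex.I (M.num Z.1) := by
    rw [Sp.num, hA, hB, pad_mul hgh, pad_add, one_mul, add_zero, Sp.num]
  have hd : Sp.den (Sp.incl g h hgh M) (pad h Complex.I Z.1) = pad h 1 (M.den Z.1) := by
    rw [Sp.den, hC, hD, pad_mul hgh, pad_add, zero_mul, zero_add, Sp.den]
  have hi : (pad h 1 (M.den Z.1))⁻¹ = pad h 1 (M.den Z.1)⁻¹ := by
    apply Matrix.inv_eq_right_inv
    rw [pad_mul hgh, Matrix.mul_nonsing_inv _ hu, one_mul, pad_one]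
  rw [hn, hd, hi, pad_mul hgh, mul_one]

/-- `𝔥_∞ = lim 𝔥_g`. As a quotient of a disjoint sum it carries the direct limit topology. -/
abbrev SiegelSpaceInf : Type := DirectLimit SiegelSpace SiegelSpace.incl

/-- `Sp(∞, ℤ) = lim Sp(2g, ℤ)`. -/
abbrev SpInf : Type := DirectLimit Sp Sp.incl

/-- The canonical map `𝔥_g → 𝔥_∞`. -/
def SiegelSpace.toInf (g : ℕ) (Z : SiegelSpace g) : SiegelSpaceInf := Quotient.mk _ ⟨g, Z⟩

/-- The canonical map `Sp(2g, ℤ) → Sp(∞, ℤ)`. -/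
def Sp.toInf (g : ℕ) (M : Sp g) : SpInf := Quotient.mk _ ⟨g, M⟩

theorem SiegelSpace.continuous_toInf (g : ℕ) : Continuous (SiegelSpace.toInf g) :=
  continuous_quotient_mk'.comp continuous_sigmaMk

/-- The action of `Sp(∞, ℤ)` on `𝔥_∞` that is induced by the actions of `Sp(2g, ℤ)` on `𝔥_g`. -/
instance : MulAction SpInf SiegelSpaceInf where
  smul := DirectLimit.map₂ Sp.incl SiegelSpace.incl SiegelSpace.incl (fun _ M Z => M • Z)
    (fun _ _ hgh M Z => incl_smul hgh M Z)
  one_smul := DirectLimit.induction _ fun g Z => by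
    change DirectLimit.map₂ _ _ _ _ _ 1 _ = _
    rw [DirectLimit.one_def g, DirectLimit.map₂_def, one_smul]
  mul_smul x y z := by
    obtain ⟨g₁, M, N, rfl, rfl⟩ := DirectLimit.exists_eq_mk₂ Sp.incl x y
    obtain ⟨g₂, Z, rfl⟩ := DirectLimit.exists_eq_mk SiegelSpace.incl z
    rw [← DirectLimit.mk_apply (f := Sp.incl) g₁ (max g₁ g₂) M (le_max_left _ _),
      ← DirectLimit.mk_apply (f := Sp.incl) g₁ (max g₁ g₂) N (le_max_left _ _),
      ← DirectLimit.mk_apply (f := SiegelSpace.incl) g₂ (max g₁ g₂) Z (le_max_right _ _),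
      DirectLimit.mul_def]
    change DirectLimit.map₂ _ _ _ _ _ _ _ =
      DirectLimit.map₂ _ _ _ _ _ _ (DirectLimit.map₂ _ _ _ _ _ _ _)
    simp only [DirectLimit.map₂_def, mul_smul]

theorem toInf_smul (g : ℕ) (M : Sp g) (Z : SiegelSpace g) :
    (M • Z).toInf g = M.toInf g • Z.toInf g :=
  (DirectLimit.map₂_def Sp.incl SiegelSpace.incl SiegelSpace.incl (fun _ M Z => M • Z)
    (fun _ _ hgh M Z => incl_smul hgh M Z) g M Z).symm

theorem toInf_incl {g h : ℕ} (hgh : g ≤ h) (Z : SiegelSpace g) :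
    (SiegelSpace.incl g h hgh Z).toInf h = Z.toInf g :=
  DirectLimit.mk_apply (f := SiegelSpace.incl) g h Z hgh

/-! ### The moduli spaces -/

/-- `𝒜_g = Sp(2g, ℤ) \ 𝔥_g`, with the quotient topology. -/
abbrev AV (g : ℕ) : Type := MulAction.orbitRel.Quotient (Sp g) (SiegelSpace g)

/-- `𝒜_∞ = Sp(∞, ℤ) \ 𝔥_∞`, with the quotient topology. -/
abbrev AVInf : Type := MulAction.orbitRel.Quotient SpInf SiegelSpaceInf

/-- The projection `𝔥_g → 𝒜_g`. -/
def AV.mk (g : ℕ) (Z : SiegelSpace g) : AV g := Quotient.mk _ Z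

/-- The projection `𝔥_∞ → 𝒜_∞`. -/
def AVInf.mk (Z : SiegelSpaceInf) : AVInf := Quotient.mk _ Z

theorem AV.continuous_mk (g : ℕ) : Continuous (AV.mk g) := continuous_quotient_mk'

theorem AVInf.continuous_mk : Continuous AVInf.mk := continuous_quotient_mk'

/-- The canonical map `𝒜_g → 𝒜_{g+1}`. -/
def AV.incl (g : ℕ) : AV g → AV (g + 1) :=
  Quotient.lift (fun Z => AV.mk (g + 1) (SiegelSpace.incl g (g + 1) g.le_succ Z)) (by
    rintro _ Z ⟨M, rfl⟩
    exact Quotient.sound ⟨Sp.incl g (g + 1) g.le_succ M, (incl_smul g.le_succ M Z).symm⟩)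

/-- The canonical map `𝒜_g → 𝒜_∞`. -/
def AV.toInf (g : ℕ) : AV g → AVInf :=
  Quotient.lift (fun Z => AVInf.mk (Z.toInf g)) (by
    rintro _ Z ⟨M, rfl⟩
    exact Quotient.sound ⟨M.toInf g, (toInf_smul g M Z).symm⟩)

/-! ### Reduced complex spaces as spaces with a sheaf of complex valued functions -/

/-- A subsheaf of the sheaf of all complex valued functions on `X`, given by the relation
"the germ of `f` at `x` belongs to the stalk at `x`". The sections over an open set `U` are the
functions `f` on `U` with `HolAt f x` for all `x ∈ U`. -/
structure FunctionSheaf (X : Type) [TopologicalSpace X] where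
  HolAt : (X → ℂ) → X → Prop
  congr : ∀ {f g : X → ℂ} {x : X}, f =ᶠ[𝓝 x] g → HolAt f x → HolAt g x
  eventually : ∀ {f : X → ℂ} {x : X}, HolAt f x → ∀ᶠ y in 𝓝 x, HolAt f y

namespace FunctionSheaf

/-- The holomorphic functions on a complex vector space. -/
def std (E : Type) [NormedAddCommGroup E] [NormedSpace ℂ E] : FunctionSheaf E where
  HolAt f x := AnalyticAt ℂ f x
  congr h hf := hf.congr h
  eventually hf := hf.eventually_analyticAt

/-- The functions on `Y` that locally are pulled back from sections of `𝒪` along `ι : Y → X`. -/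
def induced {X Y : Type} [TopologicalSpace X] [TopologicalSpace Y] (𝒪 : FunctionSheaf X)
    (ι : Y → X) (hι : Continuous ι) : FunctionSheaf Y where
  HolAt f y := ∃ F : X → ℂ, 𝒪.HolAt F (ι y) ∧ f =ᶠ[𝓝 y] F ∘ ι
  congr := by
    rintro f g x h ⟨F, hF, hf⟩
    exact ⟨F, hF, h.symm.trans hf⟩
  eventually := by
    rintro f x ⟨F, hF, hf⟩
    filter_upwards [hι.continuousAt.eventually (𝒪.eventually hF), hf.eventuallyEq_nhds]
      with y h1 h2
    exact ⟨F, h1, h2⟩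

/-- The sheaf whose sections over `U` are the functions `f` on `U` such that `f ∘ π k` is a section
over `π k ⁻¹' U` for every `k`. -/
def coinduced {X : Type} [TopologicalSpace X] {κ : Type} {Y : κ → Type}
    [∀ k, TopologicalSpace (Y k)] (𝒪 : ∀ k, FunctionSheaf (Y k)) (π : ∀ k, Y k → X)
    (hπ : ∀ k, Continuous (π k)) : FunctionSheaf X where
  HolAt f x := ∀ᶠ x' in 𝓝 x, ∀ k y, π k y = x' → (𝒪 k).HolAt (f ∘ π k) y
  congr := by
    intro f g x h hf
    filter_upwards [hf, h.eventuallyEq_nhds] with x' h1 h2 k y hy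
    subst hy
    exact (𝒪 k).congr ((hπ k).continuousAt.eventually h2) (h1 k y rfl)
  eventually hf := hf.eventually_nhds

end FunctionSheaf

section ComplexSpace
variable {X Y : Type} [TopologicalSpace X] [TopologicalSpace Y]

/-- `(X, 𝒪)` is a (reduced, finite dimensional) complex space: `X` is Hausdorff and every point has
an open neighbourhood `U` with a homeomorphism `φ` onto the zero set of finitely many holomorphic
functions on some open `D ⊆ ℂⁿ`, such that the sections of `𝒪` correspond under `φ` to the
functions that locally are restrictions of holomorphic functions on open subsets of `ℂⁿ`. -/
def IsComplexSpace (𝒪 : FunctionSheaf X) : Prop :=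
  T2Space X ∧ ∀ p : X, ∃ (n k : ℕ) (U : Set X) (D : Set (Fin n → ℂ))
    (F : Fin k → (Fin n → ℂ) → ℂ) (φ : X → Fin n → ℂ),
    IsOpen U ∧ p ∈ U ∧ IsOpen D ∧ (∀ j, AnalyticOnNhd ℂ (F j) D) ∧
    IsEmbedding (fun x : U => φ x) ∧ φ '' U = {z ∈ D | ∀ j, F j z = 0} ∧
    ∀ x ∈ U, ∀ f : X → ℂ,
      𝒪.HolAt f x ↔ ∃ h : (Fin n → ℂ) → ℂ, AnalyticAt ℂ h (φ x) ∧ f =ᶠ[𝓝 x] h ∘ φ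

/-- `(X, 𝒪)` is a (finite dimensional) complex manifold: it is Hausdorff and locally isomorphic to
open subsets of `ℂⁿ` with their holomorphic functions. -/
def IsComplexManifold (𝒪 : FunctionSheaf X) : Prop :=
  T2Space X ∧ ∀ p : X, ∃ (n : ℕ) (U : Set X) (φ : X → Fin n → ℂ),
    IsOpen U ∧ p ∈ U ∧ IsEmbedding (fun x : U => φ x) ∧ IsOpen (φ '' U) ∧
    ∀ x ∈ U, ∀ f : X → ℂ,
      𝒪.HolAt f x ↔ ∃ h : (Fin n → ℂ) → ℂ, AnalyticAt ℂ h (φ x) ∧ f =ᶠ[𝓝 x] h ∘ φ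

/-- `j` is a closed embedding of spaces with function sheaves: it is a homeomorphism onto a closed
subset, and the sections on `Y` are the functions that locally extend to sections on `X`. -/
def IsClosedSubspaceEmbedding (𝒪Y : FunctionSheaf Y) (𝒪X : FunctionSheaf X) (j : Y → X) : Prop :=
  IsClosedEmbedding j ∧ ∀ (f : Y → ℂ) (y : Y),
    𝒪Y.HolAt f y ↔ ∃ F : X → ℂ, 𝒪X.HolAt F (j y) ∧ f =ᶠ[𝓝 y] F ∘ j

/-- `(X, 𝒪)` is an (infinite dimensional) complex space, as the direct limit of the sequence
`Y 0 → Y 1 → ⋯` of finite dimensional complex spaces and closed embeddings: it is Hausdorff, it is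
the increasing union of the closed subspaces `Y n`, it has the direct limit topology, and a function
is a section of `𝒪` exactly if its restrictions to all `Y n` are holomorphic. -/
structure IsIndComplexSpace (𝒪 : FunctionSheaf X) {Y : ℕ → Type} [∀ n, TopologicalSpace (Y n)]
    (𝒪Y : ∀ n, FunctionSheaf (Y n)) (j : ∀ n, Y n → Y (n + 1)) (ι : ∀ n, Y n → X) : Prop where
  t2 : T2Space X
  isComplexSpace : ∀ n, IsComplexSpace (𝒪Y n)
  transition : ∀ n, IsClosedSubspaceEmbedding (𝒪Y n) (𝒪Y (n + 1)) (j n)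
  compat : ∀ n y, ι (n + 1) (j n y) = ι n y
  isClosedEmbedding : ∀ n, IsClosedEmbedding (ι n)
  cover : ⋃ n, Set.range (ι n) = Set.univ
  topology : ∀ U : Set X, IsOpen U ↔ ∀ n, IsOpen (ι n ⁻¹' U)
  sheaf : ∀ (U : Set X) (f : X → ℂ), IsOpen U →
    ((∀ x ∈ U, 𝒪.HolAt f x) ↔ ∀ n, ∀ y ∈ ι n ⁻¹' U, (𝒪Y n).HolAt (f ∘ ι n) y)

/-- `𝒮` is a stratification, by connected complex manifolds, of a space `X` that is exhausted by
subspaces `Y k` with function sheaves: `𝒮` is a partition of `X` into nonempty, connected, locally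
closed subsets, each of which lies in some `Y k` and is a complex submanifold of it; every `Y k` is
a union of strata, and these form a locally finite family in `Y k`; and the closure of a stratum
contains every stratum that it meets. -/
structure IsComplexStratification {κ : Type} {Y : κ → Type} [∀ k, TopologicalSpace (Y k)]
    (𝒪Y : ∀ k, FunctionSheaf (Y k)) (ι : ∀ k, Y k → X) (𝒮 : Set (Set X)) : Prop where
  partition : Setoid.IsPartition 𝒮
  isConnected : ∀ S ∈ 𝒮, IsConnected S
  isLocallyClosed : ∀ S ∈ 𝒮, IsLocallyClosed S
  isComplexManifold : ∀ S ∈ 𝒮, ∃ (k : κ) (T : Set (Y k)), ι k '' T = S ∧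
    IsComplexManifold ((𝒪Y k).induced (Subtype.val : T → Y k) continuous_subtype_val)
  saturated : ∀ S ∈ 𝒮, ∀ k, S ⊆ Set.range (ι k) ∨ Disjoint S (Set.range (ι k))
  locallyFinite : ∀ k, LocallyFinite (fun S : 𝒮 => ι k ⁻¹' S.1)
  frontier : ∀ S ∈ 𝒮, ∀ T ∈ 𝒮, (S ∩ closure T).Nonempty → S ⊆ closure T

end ComplexSpace

/-! ### The structure sheaves -/

/-- The holomorphic functions on `𝔥_g`, as a submanifold of the space of complex matrices. -/
def SiegelSpace.hol (g : ℕ) : FunctionSheaf (SiegelSpace g) :=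
  (FunctionSheaf.std (Fin g → Fin g → ℂ)).induced (fun Z i j => Z.1 i j) (by fun_prop)

/-- The holomorphic functions on `𝔥_∞`: their restrictions to all `𝔥_g` are holomorphic. -/
def SiegelSpaceInf.hol : FunctionSheaf SiegelSpaceInf :=
  FunctionSheaf.coinduced SiegelSpace.hol SiegelSpace.toInf SiegelSpace.continuous_toInf

/-- The structure sheaf of `𝒜_g`: functions whose pull-back to `𝔥_g` is holomorphic. -/
def AV.hol (g : ℕ) : FunctionSheaf (AV g) :=
  FunctionSheaf.coinduced (fun _ : Unit => SiegelSpace.hol g) (fun _ => AV.mk g)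
    (fun _ => AV.continuous_mk g)

/-- The structure sheaf of `𝒜_∞`: functions whose pull-back to `𝔥_∞` is holomorphic. -/
def AVInf.hol : FunctionSheaf AVInf :=
  FunctionSheaf.coinduced (fun _ : Unit => SiegelSpaceInf.hol) (fun _ => AVInf.mk)
    (fun _ => AVInf.continuous_mk)

/-! ### The canonical stratification -/

/-- Two points have the same orbit type if their isotropy groups are conjugate. -/
def SameOrbitType (G : Type) {X : Type} [Group G] [MulAction G X] (x y : X) : Prop :=
  ∃ γ : G, MulAction.stabilizer G y =
    (MulAction.stabilizer G x).map (MulAut.conj γ).toMonoidHom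

/-- The subspaces `𝒜_1`, `𝒜_2 - 𝒜_1`, `𝒜_3 - 𝒜_2`, …: the subspace with index `n` is contained in
`𝒜_{n+1}`. -/
def AV.diff : (n : ℕ) → Set (AV (n + 1))
  | 0 => Set.univ
  | n + 1 => (Set.range (AV.incl (n + 1)))ᶜ

/-- The canonical stratification of `AV.diff n`, by orbit types: the strata are the connected
components of the loci of points with isotropy groups in a given conjugacy class of subgroups of
`Sp(2(n+1), ℤ)`. -/
def AV.strata (n : ℕ) : Set (Set (AV.diff n)) :=
  {S | ∃ (Z : SiegelSpace (n + 1)) (hZ : AV.mk (n + 1) Z ∈ AV.diff n),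
    S = connectedComponentIn
      {q | ∃ W : SiegelSpace (n + 1), AV.mk (n + 1) W = q.1 ∧ SameOrbitType (Sp (n + 1)) Z W}
      ⟨AV.mk (n + 1) Z, hZ⟩}

/-- The family of subsets of `𝒜_∞` that consists of the strata of all `AV.diff n`. -/
def AVInf.strata : Set (Set AVInf) :=
  {S | ∃ n, ∃ T ∈ AV.strata n, S = (fun q : AV.diff n => AV.toInf (n + 1) q.1) '' T}

end UniversalModuli
end

open UniversalModuli

noncomputable section
namespace UniversalModuli

open Filter MeasureTheory Metric

/-! ### Division by monic polynomials with parameters -/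

/-! The proof has a local half, valid for actions with finite isotropy groups that are linear in
suitable charts, and an arithmetic half about products with the elliptic curve `E` of period `i`.

Local half. The modular action is properly discontinuous, and a Cayley transform at `Z` makes the
stabilizer of `Z` act linearly (`nonempty_linearChart`). So `𝒜_g` is locally the quotient of a
convex invariant open set by a finite linear group. As in Cartan's theorem, finitely many invariant
polynomials embed this quotient as an analytic set: they separate orbits, they define a closed map,
and integrality makes their image algebraic. The analytic point is that an invariant holomorphic
germ is a holomorphic function of these invariants. It follows from Cauchy's formula once the kernel
is divided by the monic polynomials whose roots are the coordinates of an orbit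
(`exists_division_single`, `exists_invMap_division`). In a linear chart the points with a given
isotropy group form a linear subspace minus finitely many complex subspaces. Such a set is
connected, and it is dense in the part of the subspace inside the chart; this governs the strata.

Arithmetic half. The image of `𝔥_g` in `𝔥_{g+1}` is the fixed locus of `lastRot`, the rotation of
order four of the last factor `E`. If `γ` maps one product with `E` to another, a sum of two
integral squares that is at most one shows that `γ` either respects the last factor or sends it into
the complement (`exists_blocks_dichotomy`). Hence `E` can be cancelled, so `𝒜_g → 𝒜_{g+1}` is
injective; inclusions between isotropy groups survive multiplication by `E` (`stabilizer_incl_le`);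
and the conjugates of `lastRot` by the isotropy group of a product commute. The last fact extends
holomorphic functions from `𝒜_g` to `𝒜_{g+1}`: on a union of fixed spaces with commuting projections
they are extended by inclusion-exclusion, and then averaged (`AV.exists_extension`).

Limit. The limit is Hausdorff by Urysohn's lemma and repeated Tietze extension. A point of `𝒜_{g+1}`
lies in `𝒜_g` exactly if its isotropy group contains a conjugate of `lastRot`, so the strata of the
differences are strata of `𝒜_{g+1}`. For the frontier condition, let `S` meet the closure of a
stratum `T` of the same or a higher level. The intersection is closed in `S`. It is also open: along
`S` the isotropy group is locally constant, so by `stabilizer_incl_le` it does not shrink at the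
level of `T`, and near a point of the closure of `T` the points with no smaller isotropy group stay
in that closure. As `S` is connected, it lies in the closure. -/

theorem torusIntegrable_of_continuousOn {n : ℕ} {f : (Fin n → ℂ) → ℂ} {w : Fin n → ℂ} {r : ℝ}
    (hf : ContinuousOn f (Set.range (torusMap w fun _ => r))) :
    TorusIntegrable f w (fun _ => r) := by
  have hc : Continuous (torusMap w fun _ => r) := by
    unfold torusMap; fun_prop
  refine ContinuousOn.integrableOn_compact isCompact_Icc ?_
  exact (hf.comp_continuous hc fun θ => Set.mem_range_self θ).continuousOn

theorem norm_torusMap_sub {n : ℕ} {w : Fin n → ℂ} {r : ℝ} (hr : 0 < r) (θ : Fin n → ℝ) (i : Fin n) :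
    ‖torusMap w (fun _ => r) θ i - w i‖ = r := by
  simp [torusMap, Complex.norm_exp_ofReal_mul_I, abs_of_pos hr]

/-- The Cauchy integral formula on a polydisc. -/
theorem torusIntegral_mul_prod_sub_inv {r : ℝ} (hr : 0 < r) : ∀ {n : ℕ} (w x : Fin n → ℂ)
    (f : (Fin n → ℂ) → ℂ), AnalyticOnNhd ℂ f (closedBall w r) → (∀ i, ‖x i - w i‖ ≠ r) →
    torusIntegral (fun ζ => f ζ * ∏ i, (ζ i - x i)⁻¹) w (fun _ => r) =
      if ∀ i, ‖x i - w i‖ < r then (2 * Real.pi * Complex.I) ^ n * f x else 0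
  | 0, w, x, f, _, _ => by
    simp [Subsingleton.elim w x]
  | n + 1, w, x, f, hf, hx => by
    have hmem : ∀ θ, torusMap w (fun _ => r) θ ∈ closedBall w r := fun θ => by
      rw [mem_closedBall, dist_pi_le_iff hr.le]
      intro i
      rw [dist_eq_norm, norm_torusMap_sub hr]
    rw [torusIntegral_succ]
    swap
    · apply torusIntegrable_of_continuousOn
      refine ContinuousOn.mul (hf.continuousOn.mono ?_) ?_
      · rintro _ ⟨θ, rfl⟩; exact hmem θ
      · refine continuousOn_finsetProd _ fun i _ => ContinuousOn.inv₀ (by fun_prop) ?_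
        rintro _ ⟨θ, rfl⟩ h0
        apply hx i
        rw [← sub_eq_zero.1 h0, norm_torusMap_sub hr]
    have hcons : ∀ z ∈ closedBall (w 0) r, ∀ y ∈ closedBall (w ∘ Fin.succ) r,
        (Fin.cons z y : Fin (n + 1) → ℂ) ∈ closedBall w r := by
      intro z hz y hy
      rw [mem_closedBall, dist_pi_le_iff hr.le] at hy ⊢
      intro i
      refine Fin.cases ?_ (fun i => ?_) i
      · simpa using hz
      · simpa using hy i
    -- For a fixed first coordinate `z` on its circle, the inner integral is the formula in one
    -- variable less.
    have hinner : ∀ z ∈ sphere (w 0) r,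
        (torusIntegral (fun y => f (Fin.cons z y) *
          ∏ i, ((Fin.cons z y : Fin (n + 1) → ℂ) i - x i)⁻¹) (w ∘ Fin.succ) (fun _ => r)) =
        (z - x 0)⁻¹ * (if ∀ i : Fin n, ‖x i.succ - w i.succ‖ < r then
          (2 * Real.pi * Complex.I) ^ n * f (Fin.cons z (Fin.tail x)) else 0) := by
      intro z hz
      have h := torusIntegral_mul_prod_sub_inv hr (w ∘ Fin.succ) (Fin.tail x)
        (fun y => f (Fin.cons z y)) (fun y hy => by
          have h1 : AnalyticAt ℂ (fun y : Fin n → ℂ => (Fin.cons z y : Fin (n + 1) → ℂ)) y := by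
            rw [analyticAt_pi_iff]
            intro i
            refine Fin.cases ?_ (fun i => ?_) i
            · simpa using analyticAt_const
            · simp only [Fin.cons_succ]
              exact (ContinuousLinearMap.proj (R := ℂ) (φ := fun _ : Fin n => ℂ) i).analyticAt y
          exact (hf _ (hcons z (sphere_subset_closedBall hz) y hy)).comp h1)
        (fun i => hx i.succ)
      refine Eq.trans ?_ ((congrArg ((z - x 0)⁻¹ * ·) h).trans ?_)
      swap
      · congr 1
      rw [← torusIntegral_const_mul]
      congr 1
      ext y
      rw [Fin.prod_univ_succ]
      simp only [Fin.cons_zero, Fin.cons_succ, Fin.tail]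
      ring
    rw [show (fun _ : Fin (n + 1) => r) ∘ Fin.succ = fun _ => r from rfl]
    rw [circleIntegral.integral_congr hr.le hinner]
    by_cases ht : ∀ i : Fin n, ‖x i.succ - w i.succ‖ < r
    swap
    · rw [if_neg fun h => ht fun i => h i.succ]
      simp only [if_neg ht, mul_zero]
      simp [circleIntegral]
    simp only [if_pos ht]
    have htail : Fin.tail x ∈ closedBall (w ∘ Fin.succ) r := by
      rw [mem_closedBall, dist_pi_le_iff hr.le]
      intro i
      rw [dist_eq_norm]
      exact (ht i).le
    have hd : DifferentiableOn ℂ (fun z => (2 * Real.pi * Complex.I) ^ n * f (Fin.cons z (Fin.tail x)))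
        (closedBall (w 0) r) := by
      intro z hz
      have h1 : DifferentiableAt ℂ (fun z : ℂ => (Fin.cons z (Fin.tail x) : Fin (n + 1) → ℂ)) z := by
        rw [differentiableAt_pi]
        intro i
        refine Fin.cases ?_ (fun i => ?_) i
        · simp
        · simp
      exact (((hf _ (hcons z hz _ htail)).differentiableAt.comp z h1).const_mul _).differentiableWithinAt
    by_cases h0 : ‖x 0 - w 0‖ < r
    · rw [if_pos (Fin.cases h0 ht)]
      have := hd.circleIntegral_sub_inv_smul (w := x 0) (by rwa [mem_ball, dist_eq_norm])
      simp only [smul_eq_mul] at this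
      rw [this, show (Fin.cons (x 0) (Fin.tail x) : Fin (n + 1) → ℂ) = x from Fin.cons_self_tail x]
      ring
    · rw [if_neg fun h => h0 (h 0)]
      -- Here `x 0` lies strictly outside the closed disc, so the integrand has no pole and Cauchy's
      -- theorem gives zero.
      have hne : ∀ z ∈ closedBall (w 0) r, z - x 0 ≠ 0 := by
        intro z hz h
        rw [← sub_eq_zero.1 h, ← dist_eq_norm] at h0
        refine hx 0 (le_antisymm ?_ (not_lt.1 ?_))
        · rw [← sub_eq_zero.1 h, ← dist_eq_norm]; exact hz
        · rw [← sub_eq_zero.1 h, ← dist_eq_norm]; exact h0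
      have hd2 : DifferentiableOn ℂ (fun z => (z - x 0)⁻¹ *
          ((2 * Real.pi * Complex.I) ^ n * f (Fin.cons z (Fin.tail x)))) (closedBall (w 0) r) := by
        refine DifferentiableOn.mul ?_ hd
        intro z hz
        have h1 : DifferentiableAt ℂ (fun z => z - x 0) z := by fun_prop
        exact (h1.inv (hne z hz)).differentiableWithinAt
      exact (hd2.mono closure_ball_subset_closedBall).diffContOnCl.circleIntegral_eq_zero hr.le

/-- The monic polynomial `T ^ d + a_{d-1} T ^ (d-1) + ⋯ + a_0`. -/
def monicEval {R : Type} [CommRing R] {d : ℕ} (a : Fin d → R) (T : R) : R :=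
  T ^ d + ∑ j, a j * T ^ (j : ℕ)

/-- The coefficient of `T ^ j` in `(P_a(ζ) - P_a(T)) / (ζ - T)`. -/
def monicQuot {R : Type} [CommRing R] {d : ℕ} (a : Fin d → R) (ζ : R) (j : Fin d) : R :=
  ζ ^ (d - 1 - (j : ℕ)) + ∑ l : Fin d, if (j : ℕ) < l then a l * ζ ^ ((l : ℕ) - 1 - j) else 0

/-- This is the geometric sum for `ζ ^ l - T ^ l`, weighted with the coefficients of the polynomial.
At a root `T` it turns the Cauchy kernel `1 / (ζ - T)` into a polynomial in `T` of degree less than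
`d`, divided by `P_a(ζ)`. -/
theorem sub_mul_sum_monicQuot {R : Type} [CommRing R] {d : ℕ} (a : Fin d → R) (ζ T : R) :
    (ζ - T) * ∑ j : Fin d, T ^ (j : ℕ) * monicQuot a ζ j = monicEval a ζ - monicEval a T := by
  have hg : ∀ l : ℕ, l ≤ d → ∑ j : Fin d, (if (j : ℕ) < l then T ^ (j : ℕ) * ζ ^ (l - 1 - (j : ℕ)) else 0) *
      (ζ - T) = ζ ^ l - T ^ l := by
    intro l hl
    rw [← Finset.sum_mul]
    rw [Fin.sum_univ_eq_sum_range (fun j => if j < l then T ^ j * ζ ^ (l - 1 - j) else 0) d,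
      ← Finset.sum_filter]
    have : (Finset.range d).filter (· < l) = Finset.range l := by ext; simp; omega
    rw [this]
    have := (Commute.all T ζ).geom_sum₂_mul l
    linear_combination -this
  have hd := hg d le_rfl
  simp only [Fin.is_lt, if_true] at hd
  simp only [monicEval, monicQuot, mul_add, Finset.mul_sum, Finset.sum_add_distrib]
  rw [Finset.sum_comm (f := fun (i l : Fin d) => (ζ - T) * (T ^ (i : ℕ) *
    if (i : ℕ) < l then a l * ζ ^ ((l : ℕ) - 1 - i) else 0))]
  have h1 : ∑ i : Fin d, (ζ - T) * (T ^ (i : ℕ) * ζ ^ (d - 1 - (i : ℕ))) = ζ ^ d - T ^ d := by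
    rw [← hd]; exact Finset.sum_congr rfl fun i _ => by ring
  have h2 : ∀ l : Fin d, ∑ i : Fin d, (ζ - T) * (T ^ (i : ℕ) *
      if (i : ℕ) < l then a l * ζ ^ ((l : ℕ) - 1 - i) else 0) = a l * ζ ^ (l : ℕ) - a l * T ^ (l : ℕ) := by
    intro l
    rw [← mul_sub, ← hg l l.2.le, Finset.mul_sum]
    refine Finset.sum_congr rfl fun i _ => ?_
    split_ifs <;> ring
  rw [h1, Finset.sum_congr rfl fun l _ => h2 l, Finset.sum_sub_distrib]
  ring

theorem map_monicEval {R S : Type} [CommRing R] [CommRing S] (φ : R →+* S) {d : ℕ} (a : Fin d → R)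
    (T : R) : φ (monicEval a T) = monicEval (fun j => φ (a j)) (φ T) := by
  simp [monicEval]

theorem map_monicQuot {R S : Type} [CommRing R] [CommRing S] (φ : R →+* S) {d : ℕ} (a : Fin d → R)
    (T : R) (j : Fin d) : φ (monicQuot a T j) = monicQuot (fun j => φ (a j)) (φ T) j := by
  simp [monicQuot, apply_ite φ]

open Polynomial in
theorem finite_setOf_monicEval_eq_zero {d : ℕ} (a : Fin d → ℂ) : {z | monicEval a z = 0}.Finite := by
  set P : ℂ[X] := X ^ d + ∑ j, C (a j) * X ^ (j : ℕ) with hP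
  have hm : P.Monic := by
    refine monic_X_pow_add ?_
    refine (degree_sum_le _ _).trans_lt ?_
    refine (Finset.sup_lt_iff (a := ((d : ℕ) : WithBot ℕ)) (WithBot.bot_lt_coe d)).2 ?_
    intro j _
    exact (degree_C_mul_X_pow_le _ _).trans_lt (by exact_mod_cast j.2)
  refine (P.rootSet ℂ).toFinite.subset fun z hz => ?_
  rw [mem_rootSet]
  refine ⟨hm.ne_zero, ?_⟩
  simpa [hP, monicEval, eval_finsetSum] using hz

/-- In Cauchy's formula for `f` on a small torus around `w`, each kernel `1 / (ζ i - x i)` at a root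
`x i` is replaced by `∑ x i ^ j * Q_j(ζ i) / P(ζ i)`. Expanding the product gives the monomials;
their coefficients are integrals that depend only on `a`, and analytically so as long as no root of
`P` meets the torus. For `x` near another point of `Ω` the same integral vanishes, which permits
adding up the results for several points. -/
theorem exists_division_single {N d : ℕ} (w : Fin N → ℂ) (f : (Fin N → ℂ) → ℂ)
    (hf : AnalyticAt ℂ f w) (a₀ : Fin N → Fin d → ℂ) (Ω : Set (Fin N → ℂ)) (hΩ : Ω.Finite) :
    ∃ c : (Fin N → Fin d) → (Fin N → Fin d → ℂ) → ℂ, (∀ α, AnalyticAt ℂ (c α) a₀) ∧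
      (∀ᶠ p in 𝓝 (a₀, w), (∀ i, monicEval (p.1 i) (p.2 i) = 0) →
        ∑ α, c α p.1 * ∏ i, p.2 i ^ (α i : ℕ) = f p.2) ∧
      ∀ w' ∈ Ω, w' ≠ w → ∀ᶠ p in 𝓝 (a₀, w'), (∀ i, monicEval (p.1 i) (p.2 i) = 0) →
        ∑ α, c α p.1 * ∏ i, p.2 i ^ (α i : ℕ) = 0 := by
  -- The radius is small enough for `f` and for the distances within `Ω`, and it avoids the finitely
  -- many distances from `w i` to roots of the polynomial with coefficients `a₀ i`.
  obtain ⟨r, hr0, hfr, hrΩ, hrP⟩ : ∃ r > 0, AnalyticOnNhd ℂ f (closedBall w r) ∧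
      (∀ w' ∈ Ω, w' ≠ w → r < dist w' w) ∧
      ∀ i z, ‖z - w i‖ = r → monicEval (a₀ i) z ≠ 0 := by
    have h1 : ∀ᶠ r in 𝓝[>] (0 : ℝ), AnalyticOnNhd ℂ f (closedBall w r) := by
      obtain ⟨ε, hε, h⟩ := Metric.eventually_nhds_iff_ball.1 hf.eventually_analyticAt
      filter_upwards [nhdsWithin_le_nhds (Iio_mem_nhds hε)] with r hr x hx
      exact h x (closedBall_subset_ball hr hx)
    have h2 : ∀ᶠ r in 𝓝[>] (0 : ℝ), ∀ w' ∈ Ω, w' ≠ w → r < dist w' w := by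
      rw [eventually_all_finite hΩ]
      intro w' _
      by_cases h : w' = w
      · simp [h]
      · filter_upwards [nhdsWithin_le_nhds (Iio_mem_nhds (dist_pos.2 h))] with r hr _
        exact hr
    have h3 : ∀ᶠ r in 𝓝[>] (0 : ℝ), ∀ i, ∀ z ∈ {z | monicEval (a₀ i) z = 0}, ‖z - w i‖ ≠ r := by
      rw [eventually_all]
      intro i
      rw [eventually_all_finite (finite_setOf_monicEval_eq_zero _)]
      intro z _
      by_cases h : ‖z - w i‖ = 0
      · filter_upwards [self_mem_nhdsWithin] with r hr h'
        exact (ne_of_gt hr) (h' ▸ h)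
      · filter_upwards [nhdsWithin_le_nhds (isOpen_ne.mem_nhds (Ne.symm h))] with r hr
        exact hr.symm
    obtain ⟨r, ⟨⟨h1, h2⟩, h3⟩, h0⟩ := ((h1.and h2).and h3 |>.and self_mem_nhdsWithin).exists
    exact ⟨r, h0, h1, h2, fun i z hz h => h3 i z h hz⟩
  -- Functions on the parameter cube of the torus form the Banach algebra `C(K, ℂ)`. Analytic
  -- dependence on `a` then follows from the analyticity of sums, products and inverses in this
  -- algebra and of the bounded functional `Λ`; no differentiation under the integral is needed.
  let K : Set (Fin N → ℝ) := Set.Icc 0 fun _ => 2 * Real.pi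
  have hKc : CompactSpace K := isCompact_iff_compactSpace.1 isCompact_Icc
  let τ : (Fin N → ℝ) → Fin N → ℂ := torusMap w fun _ => r
  have hτ : Continuous τ := by
    change Continuous (torusMap w fun _ => r)
    unfold torusMap; fun_prop
  have hτm : ∀ θ, τ θ ∈ closedBall w r := fun θ => by
    rw [mem_closedBall, dist_pi_le_iff hr0.le]
    intro i
    rw [dist_eq_norm]
    exact (norm_torusMap_sub hr0 θ i).le
  let z : Fin N → C(K, ℂ) := fun i => ⟨fun θ => τ θ i, by fun_prop⟩
  let fK : C(K, ℂ) := ⟨fun θ => f (τ θ),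
    (hfr.continuousOn.comp_continuous hτ hτm).comp continuous_subtype_val⟩
  let jac : C(K, ℂ) := ⟨fun θ => ∏ i, ((r : ℂ) * Complex.exp (θ.1 i * Complex.I) * Complex.I),
    continuous_finsetProd _ fun i _ => by
      have h1 : Continuous fun θ : K => θ.1 i := (continuous_apply i).comp continuous_subtype_val
      exact (continuous_const.mul (Complex.continuous_exp.comp
        ((Complex.continuous_ofReal.comp h1).mul continuous_const))).mul continuous_const⟩
  let P : (Fin N → Fin d → ℂ) → Fin N → C(K, ℂ) := fun a i =>
    monicEval (fun j => algebraMap ℂ C(K, ℂ) (a i j)) (z i)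
  let Q : (Fin N → Fin d → ℂ) → Fin N → Fin d → C(K, ℂ) := fun a i j =>
    monicQuot (fun j => algebraMap ℂ C(K, ℂ) (a i j)) (z i) j
  have hPev : ∀ a i θ, P a i θ = monicEval (a i) (τ θ i) := fun a i θ =>
    map_monicEval (ContinuousMap.evalAlgHom ℂ ℂ θ).toRingHom _ _
  have hQev : ∀ a i j θ, Q a i j θ = monicQuot (a i) (τ θ i) j := fun a i j θ =>
    map_monicQuot (ContinuousMap.evalAlgHom ℂ ℂ θ).toRingHom _ _ _
  let μ : Measure K := Measure.comap Subtype.val volume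
  have hμ : IsFiniteMeasure μ := ⟨by
    rw [Measure.comap_apply _ Subtype.val_injective
      (fun s hs => (MeasurableEmbedding.subtype_coe measurableSet_Icc).measurableSet_image.2 hs) _
      MeasurableSet.univ]
    rw [Set.image_univ, Subtype.range_coe]
    exact measure_Icc_lt_top⟩
  let Λ : C(K, ℂ) →L[ℂ] ℂ := LinearMap.mkContinuous
    { toFun := fun g => ∫ θ, g θ ∂μ
      map_add' := fun g h => integral_add
        (g.continuous.integrable_of_hasCompactSupport (HasCompactSupport.of_compactSpace _))
        (h.continuous.integrable_of_hasCompactSupport (HasCompactSupport.of_compactSpace _))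
      map_smul' := fun c g => integral_const_mul c _ } (μ.real Set.univ) (fun g => by
        refine (norm_integral_le_of_norm_le_const (C := ‖g‖)
          (ae_of_all _ fun θ => g.norm_coe_le_norm θ)).trans ?_
        rw [mul_comm])
  have hΛ : ∀ g, Λ g = ∫ θ, g θ ∂μ := fun g => rfl
  have hP0 : ∀ i, IsUnit (P a₀ i) := fun i => by
    rw [ContinuousMap.isUnit_iff_forall_ne_zero]
    intro θ
    rw [hPev]
    exact hrP i _ (norm_torusMap_sub hr0 _ i)
  have hcoef : ∀ i j, AnalyticAt ℂ (fun a : Fin N → Fin d → ℂ => algebraMap ℂ C(K, ℂ) (a i j)) a₀ := by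
    intro i j
    have h1 : AnalyticAt ℂ (fun a : Fin N → Fin d → ℂ => a i j) a₀ :=
      ((ContinuousLinearMap.proj (R := ℂ) (φ := fun _ : Fin d => ℂ) j).comp
        (ContinuousLinearMap.proj (R := ℂ) (φ := fun _ : Fin N => Fin d → ℂ) i)).analyticAt a₀
    simp only [Algebra.algebraMap_eq_smul_one]
    exact h1.smul analyticAt_const
  have hPan : ∀ i, AnalyticAt ℂ (fun a => P a i) a₀ := fun i => by
    refine AnalyticAt.add analyticAt_const (Finset.analyticAt_fun_sum _ fun j _ => ?_)
    exact (hcoef i j).mul analyticAt_const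
  have hQan : ∀ i j, AnalyticAt ℂ (fun a => Q a i j) a₀ := fun i j => by
    refine AnalyticAt.add analyticAt_const (Finset.analyticAt_fun_sum _ fun l _ => ?_)
    split_ifs
    · exact (hcoef i l).mul analyticAt_const
    · exact analyticAt_const
  have hPinv : ∀ i, AnalyticAt ℂ (fun a => Ring.inverse (P a i)) a₀ := fun i => by
    obtain ⟨u, hu⟩ := hP0 i
    have := analyticAt_inverse (𝕜 := ℂ) u
    rw [hu] at this
    exact this.comp_of_eq (hPan i) rfl
  have hPu : ∀ᶠ a in 𝓝 a₀, ∀ i, IsUnit (P a i) := by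
    rw [eventually_all]
    exact fun i => (hPan i).continuousAt.eventually (Units.isOpen.mem_nhds (hP0 i))
  set C : ℂ := ((2 * Real.pi * Complex.I) ^ N)⁻¹ with hC
  have hC0 : C * (2 * Real.pi * Complex.I) ^ N = 1 :=
    inv_mul_cancel₀ (pow_ne_zero _ Complex.two_pi_I_ne_zero)
  let c : (Fin N → Fin d) → (Fin N → Fin d → ℂ) → ℂ := fun α a =>
    C * Λ (jac * (fK * ∏ i, (Q a i (α i) * Ring.inverse (P a i))))
  have key : ∀ a, (∀ i, IsUnit (P a i)) → ∀ x : Fin N → ℂ, (∀ i, monicEval (a i) (x i) = 0) →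
      ∑ α, c α a * ∏ i, x i ^ (α i : ℕ) = if ∀ i, ‖x i - w i‖ < r then f x else 0 := by
    intro a ha x hx
    have hne : ∀ (θ : K) i, monicEval (a i) (τ θ i) ≠ 0 := fun θ i => by
      rw [← hPev]
      exact ContinuousMap.isUnit_iff_forall_ne_zero _ |>.1 (ha i) θ
    have hxr : ∀ i, ‖x i - w i‖ ≠ r := by
      intro i hi
      have hi' : x i ∈ sphere (w i) |r| := by rwa [abs_of_pos hr0, mem_sphere, dist_eq_norm]
      rw [← image_circleMap_Ioc] at hi'
      obtain ⟨t, ht, htx⟩ := hi'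
      -- A root on the `i`-th circle would be the `i`-th coordinate of a torus point; taking all
      -- angles equal to `t` gives such a point.
      refine hne ⟨fun _ => t, fun _ => ht.1.le, fun _ => ht.2⟩ i ?_
      rw [show τ (fun _ => t) i = x i from htx]
      exact hx i
    have h1 : ∑ α, c α a * ∏ i, x i ^ (α i : ℕ) =
        C * torusIntegral (fun ζ => f ζ * ∏ i, (ζ i - x i)⁻¹) w (fun _ => r) := by
      have h2 : ∀ α, c α a * ∏ i, x i ^ (α i : ℕ) = C * Λ (jac * (fK *
          ∏ i, (algebraMap ℂ C(K, ℂ) (x i ^ (α i : ℕ)) * Q a i (α i) * Ring.inverse (P a i)))) := by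
        intro α
        rw [mul_assoc, mul_comm (Λ _), ← smul_eq_mul (∏ i, _), ← map_smul, Algebra.smul_def, map_prod]
        simp only [mul_assoc, Finset.prod_mul_distrib]
        congr 2
        ring
      -- The sum over multi-indices is the expansion of a product over `i` of sums over `j`, and
      -- each factor is a kernel.
      have h3 : ∑ α : Fin N → Fin d, ∏ i, (algebraMap ℂ C(K, ℂ) (x i ^ (α i : ℕ)) * Q a i (α i) *
          Ring.inverse (P a i)) = ∏ i, ∑ j : Fin d, (algebraMap ℂ C(K, ℂ) (x i ^ (j : ℕ)) * Q a i j *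
          Ring.inverse (P a i)) := by
        rw [Finset.prod_univ_sum, Fintype.piFinset_univ]
      rw [Finset.sum_congr rfl fun α _ => h2 α, ← Finset.mul_sum, ← map_sum, ← Finset.mul_sum,
        ← Finset.mul_sum, h3, hΛ, torusIntegral, ← integral_subtype_comap measurableSet_Icc]
      congr 1
      refine integral_congr_ae (ae_of_all _ fun θ => ?_)
      rw [ContinuousMap.mul_apply, ContinuousMap.mul_apply]
      change _ = _ * (_ * _)
      congr 2
      rw [ContinuousMap.prod_apply]
      refine Finset.prod_congr rfl fun i _ => ?_
      rw [← Finset.sum_mul, ContinuousMap.mul_apply]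
      have h4 : Ring.inverse (P a i) θ = (monicEval (a i) (τ θ i))⁻¹ := by
        have := congrArg (fun g : C(K, ℂ) => g θ) (Ring.mul_inverse_cancel _ (ha i))
        simp only [ContinuousMap.mul_apply, ContinuousMap.one_apply, hPev] at this
        exact eq_inv_of_mul_eq_one_right this
      have h5 : (∑ j : Fin d, algebraMap ℂ C(K, ℂ) (x i ^ (j : ℕ)) * Q a i j) θ =
          ∑ j : Fin d, x i ^ (j : ℕ) * monicQuot (a i) (τ θ i) j := by
        rw [ContinuousMap.sum_apply]
        refine Finset.sum_congr rfl fun j _ => ?_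
        rw [ContinuousMap.mul_apply, hQev]
        congr 1
      have h6 := sub_mul_sum_monicQuot (a i) (τ θ i) (x i)
      rw [hx i, sub_zero] at h6
      -- At a root the division identity reads `(ζ - x) * ∑ ⋯ = P(ζ)`, and `P` has no zero on the
      -- torus.
      have h7 : τ θ i - x i ≠ 0 := fun h0 => hne θ i (by rw [← h6, h0, zero_mul])
      rw [h4, h5, ← h6, mul_inv, mul_comm, mul_assoc, inv_mul_cancel₀, mul_one]
      intro h0
      exact hne θ i (by rw [← h6, h0, mul_zero])
    rw [h1, torusIntegral_mul_prod_sub_inv hr0 w x f hfr hxr]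
    split_ifs
    · rw [← mul_assoc, hC0, one_mul]
    · rw [mul_zero]
  refine ⟨c, fun α => ?_, ?_, fun w' hw' hne => ?_⟩
  · refine analyticAt_const.mul ((Λ.analyticAt _).comp ?_)
    refine analyticAt_const.mul (analyticAt_const.mul (Finset.analyticAt_fun_prod _ fun i _ => ?_))
    exact (hQan i _).mul (hPinv i)
  · have h2 : ∀ᶠ x in 𝓝 w, ∀ i, ‖x i - w i‖ < r := by
      filter_upwards [ball_mem_nhds w hr0] with x hx i
      rw [← dist_eq_norm]
      exact (dist_le_pi_dist x w i).trans_lt hx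
    filter_upwards [hPu.prod_inl_nhds w, h2.prod_inr_nhds a₀] with p hp1 hp2 hp3
    rw [key _ hp1 _ hp3, if_pos hp2]
  · have h2 : ∀ᶠ x in 𝓝 w', ¬ ∀ i, ‖x i - w i‖ < r := by
      filter_upwards [isClosed_closedBall.isOpen_compl.mem_nhds
        (show w' ∈ (closedBall w r)ᶜ from fun h => (hrΩ w' hw' hne).not_ge h)] with x hx h
      refine hx ?_
      rw [mem_closedBall, dist_pi_le_iff hr0.le]
      intro i
      rw [dist_eq_norm]
      exact (h i).le
    filter_upwards [hPu.prod_inl_nhds w', h2.prod_inr_nhds a₀] with p hp1 hp2 hp3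
    rw [key _ hp1 _ hp3, if_neg hp2]

/-- Functions that are analytic near finitely many points have, on the zeros of the monic
polynomials with coefficients `a`, a representation by monomials with coefficients that depend
analytically on `a`. -/
theorem exists_division {N d : ℕ} (Ω : Set (Fin N → ℂ)) (hΩ : Ω.Finite) (f : (Fin N → ℂ) → ℂ)
    (hf : ∀ w ∈ Ω, AnalyticAt ℂ f w) (a₀ : Fin N → Fin d → ℂ) :
    ∃ c : (Fin N → Fin d) → (Fin N → Fin d → ℂ) → ℂ, (∀ α, AnalyticAt ℂ (c α) a₀) ∧
      ∀ w ∈ Ω, ∀ᶠ p in 𝓝 (a₀, w), (∀ i, monicEval (p.1 i) (p.2 i) = 0) →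
        ∑ α, c α p.1 * ∏ i, p.2 i ^ (α i : ℕ) = f p.2 := by
  have h (w : Ω) := exists_division_single w.1 f (hf w w.2) a₀ Ω hΩ
  choose c hc h1 h2 using h
  have := hΩ.fintype
  refine ⟨fun α a => ∑ w, c w α a, fun α => Finset.analyticAt_fun_sum _ fun w _ => hc w α,
    fun w hw => ?_⟩
  -- Near `w` the representations attached to the other points of `Ω` contribute nothing, so the
  -- coefficients may be added.
  have h3 : ∀ᶠ p in 𝓝 (a₀, w), ∀ w' : Ω, w'.1 ≠ w → (∀ i, monicEval (p.1 i) (p.2 i) = 0) →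
      ∑ α, c w' α p.1 * ∏ i, p.2 i ^ (α i : ℕ) = 0 := by
    rw [eventually_all]
    intro w'
    by_cases hne : w'.1 = w
    · simp [hne]
    · filter_upwards [h2 w' w hw (Ne.symm hne)] with p hp _
      exact hp
  filter_upwards [h1 ⟨w, hw⟩, h3] with p hp1 hp2 hp
  simp only [Finset.sum_mul]
  rw [Finset.sum_comm, Finset.sum_eq_single ⟨w, hw⟩]
  · exact hp1 hp
  · intro w' _ hne
    exact hp2 w' (fun h => hne (Subtype.ext h)) hp
  · simp

end UniversalModuli
end

noncomputable section
namespace UniversalModuli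
open Filter Metric

/-! ### Invariants of finite linear groups -/

section Invariants
variable {N : ℕ} {G : Type} [Group G] (ρ : G →* Module.End ℂ (Fin N → ℂ))

/-- The `i`-th coordinate of `ρ γ v` as a linear form in `v`. -/
def coordForm (γ : G) (i : Fin N) : MvPolynomial (Fin N) ℂ :=
  ∑ k, MvPolynomial.C (ρ γ (Pi.single k 1) i) * MvPolynomial.X k

theorem eval_coordForm (γ : G) (i : Fin N) (v : Fin N → ℂ) :
    MvPolynomial.eval v (coordForm ρ γ i) = ρ γ v i := by
  have h : v = ∑ k, v k • (Pi.single k 1 : Fin N → ℂ) := by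
    ext j; simp [Finset.sum_apply, Pi.single_apply]
  conv_rhs => rw [h, map_sum]
  simp [coordForm, Finset.sum_apply, mul_comm]

theorem continuous_rep (γ : G) : Continuous (ρ γ) := LinearMap.continuous_of_finiteDimensional _

variable [Fintype G]

/-- The index set of the basic invariants. -/
abbrev InvIndex (N : ℕ) (G : Type) [Fintype G] : Type :=
  (Fin N × Fin (Fintype.card G)) ⊕ (Fin N → Fin (Fintype.card G))

/-- The polynomial whose zeros are the `i`-th coordinates of the points of an orbit. -/
def orbitPoly (i : Fin N) : Polynomial (MvPolynomial (Fin N) ℂ) :=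
  ∏ γ, (Polynomial.X - Polynomial.C (coordForm ρ γ i))

/-- The coefficients of the polynomials `orbitPoly ρ i` and the averages of the monomials of low
degree. -/
def basicInv : InvIndex N G → MvPolynomial (Fin N) ℂ
  | Sum.inl q => (orbitPoly ρ q.1).coeff q.2
  | Sum.inr α => MvPolynomial.C (Fintype.card G : ℂ)⁻¹ * ∑ γ, ∏ i, coordForm ρ γ i ^ (α i : ℕ)

/-- The map given by the basic invariants. -/
def invMap (v : Fin N → ℂ) (t : InvIndex N G) : ℂ := MvPolynomial.eval v (basicInv ρ t)

theorem orbitPoly_monic (i : Fin N) : (orbitPoly ρ i).Monic :=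
  Polynomial.monic_prod_of_monic _ _ fun _ _ => Polynomial.monic_X_sub_C _

theorem orbitPoly_natDegree (i : Fin N) : (orbitPoly ρ i).natDegree = Fintype.card G := by
  rw [orbitPoly, Polynomial.natDegree_prod_of_monic _ _ fun _ _ => Polynomial.monic_X_sub_C _]
  simp

theorem monicEval_invMap (v : Fin N → ℂ) (i : Fin N) (T : ℂ) :
    monicEval (fun j => invMap ρ v (Sum.inl (i, j))) T = ∏ γ, (T - ρ γ v i) := by
  have h := (orbitPoly_monic ρ i).as_sum
  rw [orbitPoly_natDegree] at h
  have h2 := congrArg (Polynomial.eval₂ (MvPolynomial.eval v) T) h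
  rw [orbitPoly, Polynomial.eval₂_finsetProd] at h2
  simp only [Polynomial.eval₂_sub, Polynomial.eval₂_X, Polynomial.eval₂_C, eval_coordForm,
    Polynomial.eval₂_add, Polynomial.eval₂_pow, Polynomial.eval₂_finsetSum,
    Polynomial.eval₂_mul] at h2
  rw [h2, monicEval, Finset.sum_range]
  rfl

theorem monicEval_invMap_smul (v : Fin N → ℂ) (i : Fin N) (γ : G) :
    monicEval (fun j => invMap ρ v (Sum.inl (i, j))) (ρ γ v i) = 0 := by
  rw [monicEval_invMap]
  exact Finset.prod_eq_zero (Finset.mem_univ γ) (sub_self _)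

theorem invMap_inr (v : Fin N → ℂ) (α : Fin N → Fin (Fintype.card G)) :
    invMap ρ v (Sum.inr α) = (Fintype.card G : ℂ)⁻¹ * ∑ γ, ∏ i, ρ γ v i ^ (α i : ℕ) := by
  simp [invMap, basicInv, eval_coordForm, map_sum, map_prod]

theorem invMap_smul (δ : G) (v : Fin N → ℂ) : invMap ρ (ρ δ v) = invMap ρ v := by
  have hmul : ∀ γ i, ρ γ (ρ δ v) i = ρ (γ * δ) v i := fun γ i => by rw [map_mul]; rfl
  funext t
  rcases t with ⟨i, j⟩ | α
  · simp only [invMap, basicInv]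
    rw [← Polynomial.coeff_map, ← Polynomial.coeff_map, orbitPoly, Polynomial.map_prod,
      Polynomial.map_prod]
    simp only [Polynomial.map_sub, Polynomial.map_X, Polynomial.map_C, eval_coordForm, hmul]
    congr 1
    exact Fintype.prod_equiv (Equiv.mulRight δ) _ _ fun γ => rfl
  · rw [invMap_inr, invMap_inr]
    congr 1
    simp only [hmul]
    exact Fintype.sum_equiv (Equiv.mulRight δ) _ _ fun γ => rfl

theorem analyticAt_invMap (v : Fin N → ℂ) : AnalyticAt ℂ (invMap ρ) v := by
  rw [analyticAt_pi_iff]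
  intro t
  exact AnalyticOnNhd.eval_mvPolynomial (basicInv ρ t) v (Set.mem_univ _)

theorem continuous_invMap : Continuous (invMap ρ) :=
  continuous_iff_continuousAt.2 fun v => (analyticAt_invMap ρ v).continuousAt

/-- Each coordinate of a point of an orbit is a root of the corresponding orbit polynomial, so
`exists_division` writes `f (γ x)` in monomials of `γ x` with coefficients that are analytic in the
invariants. Averaging over `γ` replaces the monomials by their averages, which are basic invariants
too. Allowing any finite `Ω` makes one `h` serve several orbits at once. -/
theorem exists_invMap_division (Ω : Set (Fin N → ℂ)) (hΩ : Ω.Finite) (f : (Fin N → ℂ) → ℂ)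
    (hf : ∀ w ∈ Ω, AnalyticAt ℂ f w) (a₀ : InvIndex N G → ℂ) :
    ∃ h : (InvIndex N G → ℂ) → ℂ, AnalyticAt ℂ h a₀ ∧
      ∀ v, invMap ρ v = a₀ → (∀ γ, ρ γ v ∈ Ω) → ∀ᶠ x in 𝓝 v,
        (∀ γ, f (ρ γ x) = f x) → h (invMap ρ x) = f x := by
  let π : (InvIndex N G → ℂ) → Fin N → Fin (Fintype.card G) → ℂ := fun a i j => a (Sum.inl (i, j))
  obtain ⟨c, hc, h⟩ := exists_division Ω hΩ f hf (π a₀)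
  have hπ : AnalyticAt ℂ π a₀ := by
    rw [analyticAt_pi_iff]; intro i
    rw [analyticAt_pi_iff]; intro j
    exact (ContinuousLinearMap.proj (R := ℂ) (φ := fun _ : InvIndex N G => ℂ) (Sum.inl (i, j))).analyticAt _
  refine ⟨fun a => ∑ α, c α (π a) * a (Sum.inr α), ?_, ?_⟩
  · refine Finset.analyticAt_fun_sum _ fun α _ => AnalyticAt.mul ?_ ?_
    · exact (hc α).comp hπ
    · exact (ContinuousLinearMap.proj (R := ℂ) (φ := fun _ : InvIndex N G => ℂ) (Sum.inr α)).analyticAt _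
  · rintro v rfl hv
    have h1 : ∀ᶠ x in 𝓝 v, ∀ γ, ∑ α, c α (π (invMap ρ x)) * ∏ i, ρ γ x i ^ (α i : ℕ) = f (ρ γ x) := by
      rw [eventually_all]
      intro γ
      have ht : Tendsto (fun x => (π (invMap ρ x), ρ γ x)) (𝓝 v) (𝓝 (π (invMap ρ v), ρ γ v)) :=
        (ContinuousAt.comp (g := π) hπ.continuousAt (continuous_invMap ρ).continuousAt).prodMk_nhds
          (continuous_rep ρ γ).continuousAt
      filter_upwards [ht.eventually (h _ (hv γ))] with x hx
      exact hx fun i => monicEval_invMap_smul ρ x i γ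
    filter_upwards [h1] with x hx hinv
    have hcard : (Fintype.card G : ℂ) ≠ 0 := by exact_mod_cast Fintype.card_ne_zero
    have h2 : ∑ γ, ∑ α, c α (π (invMap ρ x)) * ∏ i, ρ γ x i ^ (α i : ℕ) = Fintype.card G * f x := by
      rw [Finset.sum_congr rfl fun γ _ => (hx γ).trans (hinv γ)]
      simp
    rw [Finset.sum_comm] at h2
    simp only [← Finset.mul_sum] at h2
    simp only [invMap_inr]
    rw [← mul_right_inj' hcard, ← h2, Finset.mul_sum]
    refine Finset.sum_congr rfl fun α _ => ?_
    field_simp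

/-- Invariant analytic functions are analytic functions of the basic invariants. -/
theorem exists_eq_comp_invMap (F : (Fin N → ℂ) → ℂ) (v : Fin N → ℂ)
    (hF : ∀ γ, AnalyticAt ℂ F (ρ γ v)) (hinv : ∀ γ, ∀ᶠ x in 𝓝 v, F (ρ γ x) = F x) :
    ∃ h : (InvIndex N G → ℂ) → ℂ, AnalyticAt ℂ h (invMap ρ v) ∧ F =ᶠ[𝓝 v] h ∘ invMap ρ := by
  obtain ⟨h, hh, h1⟩ := exists_invMap_division ρ (Set.range fun γ => ρ γ v) (Set.finite_range _) F
    (by rintro _ ⟨γ, rfl⟩; exact hF γ) (invMap ρ v)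
  refine ⟨h, hh, ?_⟩
  filter_upwards [h1 v rfl fun γ => ⟨γ, rfl⟩, eventually_all.2 hinv] with x hx1 hx2
  exact (hx1 hx2).symm

/-- The basic invariants separate orbits. -/
theorem exists_smul_eq_of_invMap_eq {v w : Fin N → ℂ} (h : invMap ρ v = invMap ρ w) :
    ∃ γ, ρ γ v = w := by
  by_contra! hne
  set A : Set (Fin N → ℂ) := Set.range fun γ => ρ γ v
  set B : Set (Fin N → ℂ) := Set.range fun γ => ρ γ w
  have hAB : Disjoint A B := by
    rw [Set.disjoint_left]
    rintro _ ⟨γ, rfl⟩ ⟨δ, hδ⟩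
    refine hne (δ⁻¹ * γ) ?_
    rw [map_mul]
    change ρ δ⁻¹ (ρ γ v) = w
    rw [show ρ γ v = ρ δ w from hδ.symm]
    change (ρ δ⁻¹ * ρ δ) w = w
    rw [← map_mul, inv_mul_cancel, map_one]; rfl
  have hA : A.Finite := Set.finite_range _
  have hB : B.Finite := Set.finite_range _
  obtain ⟨U, V, hU, hV, hAU, hBV, hUV⟩ :=
    SeparatedNhds.of_isCompact_isCompact hA.isCompact hB.isCompact hAB
  classical
  -- A function that is 0 near the orbit of `v` and 1 near that of `w` is analytic and invariant
  -- there. If the invariants agreed, a single value of `k` would have to be both 0 and 1.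
  let F : (Fin N → ℂ) → ℂ := fun x => if x ∈ V then 1 else 0
  have hF1 : ∀ x ∈ V, F =ᶠ[𝓝 x] fun _ => 1 := fun x hx => by
    filter_upwards [hV.mem_nhds hx] with y hy; simp [F, hy]
  have hF0 : ∀ x ∈ U, F =ᶠ[𝓝 x] fun _ => 0 := fun x hx => by
    filter_upwards [hU.mem_nhds hx] with y hy
    simp [F, Set.disjoint_left.1 hUV hy]
  obtain ⟨k, -, hk⟩ := exists_invMap_division ρ (A ∪ B) (hA.union hB) F (by
    rintro x (hx | hx)
    · exact analyticAt_const.congr (hF0 x (hAU hx)).symm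
    · exact analyticAt_const.congr (hF1 x (hBV hx)).symm) (invMap ρ v)
  have hself : ∀ u : Fin N → ℂ, ρ 1 u = u := fun u => by rw [map_one]; rfl
  have e0 := (hk v rfl fun γ => Or.inl ⟨γ, rfl⟩).self_of_nhds (fun γ => by
    rw [(hF0 _ (hAU ⟨γ, rfl⟩)).self_of_nhds, (hF0 v (hAU ⟨1, hself v⟩)).self_of_nhds])
  have e1 := (hk w h.symm fun γ => Or.inr ⟨γ, rfl⟩).self_of_nhds (fun γ => by
    rw [(hF1 _ (hBV ⟨γ, rfl⟩)).self_of_nhds, (hF1 w (hBV ⟨1, hself w⟩)).self_of_nhds])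
  rw [(hF0 v (hAU ⟨1, hself v⟩)).self_of_nhds] at e0
  rw [(hF1 w (hBV ⟨1, hself w⟩)).self_of_nhds, ← h, e0] at e1
  exact zero_ne_one e1

/-! ### Properness of the invariant map and its image -/

/-- Cauchy's bound for roots: if `‖z‖ > 1`, all lower terms are at most `R * ‖z‖ ^ (d - 1)`. -/
theorem norm_le_of_monicEval_eq_zero {d : ℕ} {a : Fin d → ℂ} {z : ℂ} {R : ℝ}
    (ha : ∀ j, ‖a j‖ ≤ R) (hz : monicEval a z = 0) : ‖z‖ ≤ 1 + d * R := by
  have hd : 0 < d := by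
    rcases Nat.eq_zero_or_pos d with rfl | h
    · simp [monicEval] at hz
    · exact h
  have hR : 0 ≤ R := (norm_nonneg _).trans (ha ⟨0, hd⟩)
  by_cases h1 : ‖z‖ ≤ 1
  · nlinarith [mul_nonneg (Nat.cast_nonneg (α := ℝ) d) hR]
  · push Not at h1
    have h2 : ‖z‖ ^ d ≤ d * R * ‖z‖ ^ (d - 1) := by
      have : z ^ d = -∑ j, a j * z ^ (j : ℕ) := eq_neg_of_add_eq_zero_left hz
      rw [← norm_pow, this, norm_neg]
      refine (norm_sum_le _ _).trans ((Finset.sum_le_card_nsmul _ _ (R * ‖z‖ ^ (d - 1)) ?_).trans ?_)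
      · intro j _
        rw [norm_mul, norm_pow]
        exact mul_le_mul (ha j) (pow_le_pow_right₀ h1.le (by omega)) (by positivity) hR
      · simp [mul_assoc]
    have h3 : 0 < ‖z‖ ^ (d - 1) := by positivity
    have h4 : ‖z‖ ^ d = ‖z‖ * ‖z‖ ^ (d - 1) := by rw [← pow_succ']; congr 1; omega
    rw [h4] at h2
    linarith [le_of_mul_le_mul_right h2 h3]

/-- The coordinates of `v` are roots of the orbit polynomials, so they are bounded in terms of the
invariants. The map is therefore proper. -/
theorem isClosedMap_invMap : IsClosedMap (invMap ρ) := by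
  refine (isProperMap_iff_tendsto_cocompact.2 ⟨continuous_invMap ρ, ?_⟩).isClosedMap
  rw [← cobounded_eq_cocompact, ← cobounded_eq_cocompact, ← comap_norm_atTop, ← comap_norm_atTop,
    tendsto_comap_iff, Filter.tendsto_atTop]
  intro R
  have : ∀ᶠ v : Fin N → ℂ in comap norm atTop, 1 + Fintype.card G * |R| < ‖v‖ :=
    tendsto_comap.eventually (eventually_gt_atTop _)
  filter_upwards [this] with v hv
  by_contra! hR
  change ‖invMap ρ v‖ < R at hR
  refine hv.not_ge ?_
  rw [pi_norm_le_iff_of_nonneg (by positivity)]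
  intro i
  refine norm_le_of_monicEval_eq_zero (a := fun j => invMap ρ v (Sum.inl (i, j))) (fun j => ?_) ?_
  · exact (norm_le_pi_norm _ _).trans (hR.le.trans (le_abs_self R))
  · have := monicEval_invMap_smul ρ v i 1
    rwa [map_one] at this

/-- The variable `X i` is a root of `orbitPoly ρ i`, because the linear form for `γ = 1` is `X i`;
this polynomial is monic with invariant coefficients. -/
theorem isIntegral_aeval_basicInv : (MvPolynomial.aeval (R := ℂ) (basicInv ρ)).toRingHom.IsIntegral := by
  set ψ := (MvPolynomial.aeval (R := ℂ) (basicInv ρ)).toRingHom with hψ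
  intro p
  induction p using MvPolynomial.induction_on with
  | C a =>
    have : (MvPolynomial.C a : MvPolynomial (Fin N) ℂ) = ψ (MvPolynomial.C a) := by
      simp [hψ, MvPolynomial.algebraMap_eq]
    rw [this]
    exact ψ.isIntegralElem_map
  | add p q hp hq => exact hp.add ψ hq
  | mul_X p i hp =>
    refine hp.mul ψ ⟨Polynomial.X ^ Fintype.card G +
      ∑ j : Fin (Fintype.card G), Polynomial.C (MvPolynomial.X (Sum.inl (i, j))) * Polynomial.X ^ (j : ℕ), ?_, ?_⟩
    · refine Polynomial.monic_X_pow_add ((Polynomial.degree_sum_le _ _).trans_lt ?_)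
      refine (Finset.sup_lt_iff (a := ((Fintype.card G : ℕ) : WithBot ℕ)) (WithBot.bot_lt_coe _)).2 ?_
      intro j _
      exact (Polynomial.degree_C_mul_X_pow_le _ _).trans_lt (by exact_mod_cast j.2)
    · have h0 : Polynomial.eval (MvPolynomial.X i) (orbitPoly ρ i) = 0 := by
        rw [orbitPoly, Polynomial.eval_prod]
        refine Finset.prod_eq_zero (Finset.mem_univ 1) ?_
        rw [Polynomial.eval_sub, Polynomial.eval_X, Polynomial.eval_C, sub_eq_zero]
        simp [coordForm, Pi.single_apply]
      have h := (orbitPoly_monic ρ i).as_sum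
      rw [orbitPoly_natDegree, Finset.sum_range] at h
      rw [h] at h0
      rw [← h0]
      simp [Polynomial.eval₂_add, Polynomial.eval_add, Polynomial.eval₂_finsetSum, Polynomial.eval_finsetSum, hψ, basicInv]

/-- The image of the basic invariants is an algebraic set. -/
theorem exists_range_invMap : ∃ (k : ℕ) (F : Fin k → MvPolynomial (InvIndex N G) ℂ),
    Set.range (invMap ρ) = {z | ∀ j, MvPolynomial.eval z (F j) = 0} := by
  set ψ := (MvPolynomial.aeval (R := ℂ) (basicInv ρ)).toRingHom with hψ
  -- The equations are finitely many generators of the ideal of relations between the basic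
  -- invariants.
  obtain ⟨S, hS⟩ := (isNoetherianRing_iff_ideal_fg _).1 inferInstance (RingHom.ker ψ)
  refine ⟨S.card, fun j => (S.equivFin.symm j).1, ?_⟩
  have hev : ∀ v, (MvPolynomial.eval v).comp ψ = MvPolynomial.eval (invMap ρ v) := fun v => by
    ext
    · simp [hψ]
    · simp [hψ, invMap]
  ext z
  constructor
  · rintro ⟨v, rfl⟩ j
    have hm : (S.equivFin.symm j).1 ∈ RingHom.ker ψ := by
      rw [← hS]; exact Ideal.subset_span (S.equivFin.symm j).2
    rw [← hev, RingHom.comp_apply, (RingHom.mem_ker).1 hm, map_zero]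
  · intro hz
    have hle : RingHom.ker ψ ≤ RingHom.ker (MvPolynomial.eval z) := by
      rw [← hS, Ideal.span_le]
      intro p hp
      have := hz (S.equivFin ⟨p, hp⟩)
      simpa using this
    have hmax : (RingHom.ker (MvPolynomial.eval z)).IsMaximal :=
      RingHom.ker_isMaximal_of_surjective _ fun c => ⟨MvPolynomial.C c, by simp⟩
    let := ψ.toAlgebra
    have : Algebra.IsIntegral (MvPolynomial (InvIndex N G) ℂ) (MvPolynomial (Fin N) ℂ) :=
      ⟨isIntegral_aeval_basicInv ρ⟩
    -- A zero `z` of all relations is a maximal ideal containing the kernel. By integrality a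
    -- maximal ideal lies over it, and by the Nullstellensatz that ideal is a point `v`.
    obtain ⟨Q, hQ, hQc⟩ := Ideal.exists_ideal_over_maximal_of_isIntegral
      (S := MvPolynomial (Fin N) ℂ) (RingHom.ker (MvPolynomial.eval z)) hle
    obtain ⟨v, rfl⟩ := (MvPolynomial.isMaximal_iff_eq_vanishingIdeal_singleton).1 hQ
    refine ⟨v, funext fun t => ?_⟩
    have h1 : MvPolynomial.X t - MvPolynomial.C (z t) ∈ RingHom.ker (MvPolynomial.eval z) := by
      simp [RingHom.mem_ker]
    rw [← hQc, Ideal.mem_comap, MvPolynomial.mem_vanishingIdeal_singleton_iff] at h1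
    change MvPolynomial.aeval v (ψ _) = 0 at h1
    simp only [hψ, AlgHom.toRingHom_eq_coe, RingHom.coe_coe, map_sub, MvPolynomial.aeval_X,
      MvPolynomial.aeval_C, sub_eq_zero] at h1
    simpa [invMap, MvPolynomial.aeval_def, MvPolynomial.algebraMap_eq] using h1

end Invariants

end UniversalModuli
end

noncomputable section
namespace UniversalModuli
open Filter Metric MulAction

/-! ### Quotients by groups that act linearly in suitable charts -/

/-- Since the map is closed and its fibres are orbits, the complement of the image of `Vᶜ` is the
required open set when `V` is invariant. -/
theorem exists_isOpen_invMap_mem_iff {N : ℕ} {G : Type} [Group G] [Fintype G]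
    (ρ : G →* Module.End ℂ (Fin N → ℂ)) {V : Set (Fin N → ℂ)} (hV : IsOpen V)
    (hGV : ∀ γ, ∀ v ∈ V, ρ γ v ∈ V) : ∃ D, IsOpen D ∧ ∀ v, invMap ρ v ∈ D ↔ v ∈ V := by
  refine ⟨(invMap ρ '' Vᶜ)ᶜ, (isClosedMap_invMap ρ _ hV.isClosed_compl).isOpen_compl, fun v => ?_⟩
  constructor
  · intro h
    by_contra hv
    exact h ⟨v, hv, rfl⟩
  · rintro hv ⟨w, hw, he⟩
    obtain ⟨γ, rfl⟩ := exists_smul_eq_of_invMap_eq ρ he.symm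
    exact hw (hGV γ v hv)

section Quotient
variable {Γ X : Type} [Group Γ] [MulAction Γ X]

/-- The projection to the space of orbits. -/
def orbitMk (Γ : Type) {X : Type} [Group Γ] [MulAction Γ X] (x : X) : orbitRel.Quotient Γ X :=
  Quotient.mk _ x

theorem orbitMk_eq_iff {x y : X} : orbitMk Γ x = orbitMk Γ y ↔ ∃ γ : Γ, γ • y = x :=
  Quotient.eq.trans Iff.rfl

theorem orbitMk_smul (γ : Γ) (x : X) : orbitMk Γ (γ • x) = orbitMk Γ x :=
  orbitMk_eq_iff.2 ⟨γ, rfl⟩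

theorem orbitMk_surjective : Function.Surjective (orbitMk Γ (X := X)) := Quotient.mk_surjective

variable [TopologicalSpace X]

theorem continuous_orbitMk : Continuous (orbitMk Γ (X := X)) := continuous_quotient_mk'

/-- The functions on the space of orbits whose pull-backs are sections of `𝒪`. -/
def orbitSheaf (Γ : Type) {X : Type} [Group Γ] [TopologicalSpace X] [MulAction Γ X]
    (𝒪 : FunctionSheaf X) : FunctionSheaf (orbitRel.Quotient Γ X) :=
  FunctionSheaf.coinduced (fun _ : Unit => 𝒪) (fun _ => orbitMk Γ) (fun _ => continuous_orbitMk)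

/-- The group acts by automorphisms of the function sheaf. -/
def ActsOn (Γ : Type) {X : Type} [Group Γ] [TopologicalSpace X] [MulAction Γ X]
    (𝒪 : FunctionSheaf X) : Prop :=
  ∀ (γ : Γ) (f : X → ℂ) (x : X), 𝒪.HolAt f (γ • x) → 𝒪.HolAt (fun y => f (γ • y)) x

/-- A chart around `z` in which the stabilizer of `z` acts linearly. -/
structure LinearChart (Γ : Type) {X : Type} [Group Γ] [TopologicalSpace X] [MulAction Γ X]
    (𝒪 : FunctionSheaf X) (z : X) where
  dim : ℕ
  e : OpenPartialHomeomorph X (Fin dim → ℂ)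
  ρ : stabilizer Γ z →* Module.End ℂ (Fin dim → ℂ)
  mem_source : z ∈ e.source
  map_base : e z = 0
  convex : Convex ℝ e.target
  mem_stabilizer : ∀ (γ : Γ), ∀ x ∈ e.source, γ • x ∈ e.source → γ ∈ stabilizer Γ z
  smul_mem : ∀ (γ : stabilizer Γ z), ∀ x ∈ e.source, γ • x ∈ e.source
  equivariant : ∀ (γ : stabilizer Γ z), ∀ x ∈ e.source, e (γ • x) = ρ γ (e x)
  holAt_iff : ∀ x ∈ e.source, ∀ f : X → ℂ,
    𝒪.HolAt f x ↔ ∃ h : (Fin dim → ℂ) → ℂ, AnalyticAt ℂ h (e x) ∧ f =ᶠ[𝓝 x] h ∘ e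

variable {𝒪 : FunctionSheaf X}

namespace LinearChart
variable {z : X} (c : LinearChart Γ 𝒪 z)

theorem rep_mem (γ : stabilizer Γ z) {v : Fin c.dim → ℂ} (hv : v ∈ c.e.target) :
    c.ρ γ v ∈ c.e.target := by
  have h := c.e.map_target hv
  have := c.equivariant γ _ h
  rw [c.e.right_inv hv] at this
  rw [← this]
  exact c.e.map_source (c.smul_mem γ _ h)

theorem symm_rep (γ : stabilizer Γ z) {v : Fin c.dim → ℂ} (hv : v ∈ c.e.target) :
    c.e.symm (c.ρ γ v) = γ • c.e.symm v := by
  have h := c.e.map_target hv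
  rw [← c.e.left_inv (c.smul_mem γ _ h), c.equivariant γ _ h, c.e.right_inv hv]

theorem zero_mem : (0 : Fin c.dim → ℂ) ∈ c.e.target := by
  rw [← c.map_base]; exact c.e.map_source c.mem_source

theorem orbitMk_eq_iff {x y : X} (hx : x ∈ c.e.source) (hy : y ∈ c.e.source) :
    orbitMk Γ x = orbitMk Γ y ↔ ∃ γ : stabilizer Γ z, c.ρ γ (c.e y) = c.e x := by
  constructor
  · intro h
    obtain ⟨γ, rfl⟩ := UniversalModuli.orbitMk_eq_iff.1 h
    exact ⟨⟨γ, c.mem_stabilizer γ y hy hx⟩, (c.equivariant _ y hy).symm⟩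
  · rintro ⟨γ, h⟩
    rw [← c.equivariant γ y hy] at h
    rw [← c.e.injOn (c.smul_mem γ y hy) hx h]
    exact orbitMk_smul γ.1 y

/-- Two points of the chart with the same orbit differ by an element of the stabilizer of the
centre. Away from the image of the chart the value is irrelevant and is set to `h 0`. -/
theorem exists_descend {β : Type} (h : (Fin c.dim → ℂ) → β) (hinv : ∀ γ v, h (c.ρ γ v) = h v) :
    ∃ F : orbitRel.Quotient Γ X → β, ∀ x ∈ c.e.source, F (orbitMk Γ x) = h (c.e x) := by
  classical
  refine ⟨fun q => if hq : ∃ x ∈ c.e.source, orbitMk Γ x = q then h (c.e hq.choose) else h 0, ?_⟩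
  intro x hx
  have hq : ∃ y ∈ c.e.source, orbitMk Γ y = orbitMk Γ x := ⟨x, hx, rfl⟩
  simp only [dif_pos hq]
  obtain ⟨γ, hγ⟩ := (c.orbitMk_eq_iff hq.choose_spec.1 hx).1 hq.choose_spec.2
  rw [← hγ, hinv]

end LinearChart

variable [ContinuousConstSMul Γ X]

theorem isOpenQuotientMap_orbitMk : IsOpenQuotientMap (orbitMk Γ (X := X)) :=
  MulAction.isOpenQuotientMap_quotientMk

theorem isOpenMap_orbitMk : IsOpenMap (orbitMk Γ (X := X)) := isOpenQuotientMap_orbitMk.isOpenMap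

/-- The group acts by automorphisms of the sheaf, so one representative of an orbit decides for all
of them; openness of the projection carries the neighbourhood down. -/
theorem orbitSheaf_holAt_iff (h𝒪 : ActsOn Γ 𝒪) (f : orbitRel.Quotient Γ X → ℂ) (x : X) :
    (orbitSheaf Γ 𝒪).HolAt f (orbitMk Γ x) ↔ 𝒪.HolAt (f ∘ orbitMk Γ) x := by
  constructor
  · intro h
    exact h.self_of_nhds () x rfl
  · intro h
    have h1 := (isOpenMap_orbitMk (Γ := Γ) (X := X)).image_mem_nhds (𝒪.eventually h)
    change ∀ᶠ q in 𝓝 (orbitMk Γ x), _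
    filter_upwards [h1]
    rintro _ ⟨y, hy, rfl⟩ - w hw
    obtain ⟨γ, rfl⟩ := orbitMk_eq_iff.1 hw.symm
    have := h𝒪 γ (f ∘ orbitMk Γ) w hy
    have e : (fun y => (f ∘ orbitMk Γ) (γ • y)) = f ∘ orbitMk Γ :=
      funext fun y => congrArg f (orbitMk_smul γ y)
    rw [e] at this
    exact this

namespace LinearChart
variable {z : X} (c : LinearChart Γ 𝒪 z)

theorem isOpen_image : IsOpen (orbitMk Γ '' c.e.source) := isOpenMap_orbitMk _ c.e.open_source

/-- The pull-back of an invariant function to a chart. -/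
theorem holAt_of_comp (h𝒪 : ActsOn Γ 𝒪) {F : orbitRel.Quotient Γ X → ℂ}
    {h : (Fin c.dim → ℂ) → ℂ} (hF : ∀ x ∈ c.e.source, F (orbitMk Γ x) = h (c.e x)) {x : X}
    (hx : x ∈ c.e.source) (hh : AnalyticAt ℂ h (c.e x)) :
    (orbitSheaf Γ 𝒪).HolAt F (orbitMk Γ x) := by
  rw [orbitSheaf_holAt_iff h𝒪, c.holAt_iff x hx]
  refine ⟨h, hh, ?_⟩
  filter_upwards [c.e.open_source.mem_nhds hx] with y hy
  exact hF y hy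

end LinearChart

/-- Quotients by groups that act properly and linearly in suitable charts are complex spaces. -/
theorem isComplexSpace_orbitSheaf [T2Space (orbitRel.Quotient Γ X)] (h𝒪 : ActsOn Γ 𝒪)
    [∀ z : X, Finite (stabilizer Γ z)] (hc : ∀ z : X, Nonempty (LinearChart Γ 𝒪 z)) :
    IsComplexSpace (orbitSheaf Γ 𝒪) := by
  refine ⟨inferInstance, fun p => ?_⟩
  obtain ⟨z, rfl⟩ := orbitMk_surjective p
  obtain ⟨c⟩ := hc z
  have := Fintype.ofFinite (stabilizer Γ z)
  set ι := InvIndex c.dim (stabilizer Γ z)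
  set n := Fintype.card ι
  let E : Fin n ≃ ι := (Fintype.equivFin ι).symm
  let L : (ι → ℂ) ≃L[ℂ] (Fin n → ℂ) := (LinearEquiv.funCongrLeft ℂ ℂ E).toContinuousLinearEquiv
  obtain ⟨k, F, hF⟩ := exists_range_invMap c.ρ
  obtain ⟨D, hD, hDt⟩ := exists_isOpen_invMap_mem_iff c.ρ c.e.open_target fun γ v hv => c.rep_mem γ hv
  -- The local embedding of the quotient consists of the basic invariants of the chart coordinates,
  -- renumbered by `L`.
  obtain ⟨φ, hφ⟩ := c.exists_descend (fun v => L (invMap c.ρ v)) fun γ v => by rw [invMap_smul]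
  have hcont : ContinuousOn φ (orbitMk Γ '' c.e.source) := by
    rintro _ ⟨x, hx, rfl⟩
    refine ContinuousAt.continuousWithinAt ?_
    rw [← isOpenQuotientMap_orbitMk.continuousAt_comp_iff]
    have h1 : ContinuousAt (fun y => L (invMap c.ρ (c.e y))) x :=
      L.continuous.continuousAt.comp
        ((continuous_invMap c.ρ).continuousAt.comp (c.e.continuousAt hx))
    refine h1.congr ?_
    filter_upwards [c.e.open_source.mem_nhds hx] with y hy
    exact (hφ y hy).symm
  refine ⟨n, k, orbitMk Γ '' c.e.source, L.symm ⁻¹' D, fun j w => MvPolynomial.eval (L.symm w) (F j), φ,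
    c.isOpen_image, ⟨z, c.mem_source, rfl⟩, hD.preimage L.symm.continuous, ?_, ⟨?_, ?_⟩, ?_, ?_⟩
  · intro j w _
    exact (AnalyticOnNhd.eval_mvPolynomial (F j) _ (Set.mem_univ _)).comp
      (L.symm.toContinuousLinearMap.analyticAt w)
  · rw [isInducing_iff_nhds]
    rintro ⟨_, x, hx, rfl⟩
    apply le_antisymm
    · exact (continuousOn_iff_continuous_domRestrict.1 hcont).continuousAt.le_comap
    · intro O hO
      obtain ⟨O', hO', hsub⟩ := (mem_nhds_induced _ _ _).1 hO
      obtain ⟨O'', hO''s, hO''o, hxO⟩ := _root_.mem_nhds_iff.1 hO'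
      -- A neighbourhood in the quotient pulls back to an invariant open set of the chart, and such
      -- a set is cut out by an open set of values of the invariants.
      obtain ⟨D', hD', hDt'⟩ := exists_isOpen_invMap_mem_iff c.ρ
        (V := c.e.target ∩ c.e.symm ⁻¹' (orbitMk Γ ⁻¹' O''))
        (c.e.isOpen_inter_preimage_symm (hO''o.preimage continuous_orbitMk)) (by
          rintro γ v ⟨hv, hv2⟩
          refine ⟨c.rep_mem γ hv, ?_⟩
          rw [Set.mem_preimage, c.symm_rep γ hv]
          change orbitMk Γ (γ.1 • c.e.symm v) ∈ O''
          rwa [orbitMk_smul])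
      refine mem_comap.2 ⟨L.symm ⁻¹' D', (hD'.preimage L.symm.continuous).mem_nhds ?_, ?_⟩
      · change L.symm (φ (orbitMk Γ x)) ∈ D'
        rw [hφ x hx, L.symm_apply_apply, hDt']
        refine ⟨c.e.map_source hx, ?_⟩
        rw [Set.mem_preimage, c.e.left_inv hx]
        exact hxO
      · rintro ⟨_, y, hy, rfl⟩ hmem
        change L.symm (φ (orbitMk Γ y)) ∈ D' at hmem
        rw [hφ y hy, L.symm_apply_apply, hDt'] at hmem
        have := hmem.2
        rw [Set.mem_preimage, c.e.left_inv hy] at this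
        exact hsub (hO''s this)
  · rintro ⟨_, x, hx, rfl⟩ ⟨_, y, hy, rfl⟩ h
    apply Subtype.ext
    change φ _ = φ _ at h
    rw [hφ x hx, hφ y hy, L.injective.eq_iff] at h
    exact (c.orbitMk_eq_iff hx hy).2 (exists_smul_eq_of_invMap_eq c.ρ h.symm)
  · ext w
    constructor
    · rintro ⟨_, ⟨x, hx, rfl⟩, rfl⟩
      rw [hφ x hx]
      refine ⟨?_, fun j => ?_⟩
      · rw [Set.mem_preimage, L.symm_apply_apply, hDt]
        exact c.e.map_source hx
      · change MvPolynomial.eval (L.symm (L _)) _ = 0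
        rw [L.symm_apply_apply]
        have := Set.mem_range_self (f := invMap c.ρ) (c.e x)
        rw [hF] at this
        exact this j
    · rintro ⟨hw, hw2⟩
      have : L.symm w ∈ Set.range (invMap c.ρ) := by rw [hF]; exact hw2
      obtain ⟨v, hv⟩ := this
      rw [Set.mem_preimage, ← hv, hDt] at hw
      refine ⟨_, ⟨c.e.symm v, c.e.map_target hw, rfl⟩, ?_⟩
      rw [hφ _ (c.e.map_target hw), c.e.right_inv hw, hv, L.apply_symm_apply]
  · rintro _ ⟨x, hx, rfl⟩ f
    rw [orbitSheaf_holAt_iff h𝒪]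
    constructor
    · intro hf
      have hsymm : ∀ v ∈ c.e.target, ∀ γ, f (orbitMk Γ (c.e.symm (c.ρ γ v))) =
          f (orbitMk Γ (c.e.symm v)) := by
        intro v hv γ
        rw [c.symm_rep γ hv]
        exact congrArg f (orbitMk_smul γ.1 _)
      obtain ⟨h, hh, hfh⟩ := exists_eq_comp_invMap c.ρ (fun v => f (orbitMk Γ (c.e.symm v))) (c.e x)
        (by
          intro γ
          -- Analyticity is needed at every point of the orbit of `c.e x`; it is transported there
          -- from `x` by the group.
          have hγ := h𝒪 γ.1⁻¹ (f ∘ orbitMk Γ) (γ.1 • x) (by rwa [inv_smul_smul])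
          simp only [Function.comp_apply, orbitMk_smul] at hγ
          obtain ⟨h, hh, hfh⟩ := (c.holAt_iff _ (c.smul_mem γ x hx) _).1 hγ
          rw [← c.equivariant γ x hx]
          refine hh.congr ?_
          have hs := (c.e.continuousAt_symm (c.e.map_source (c.smul_mem γ x hx)))
          rw [ContinuousAt, c.e.left_inv (c.smul_mem γ x hx)] at hs
          filter_upwards [hs.eventually hfh,
            c.e.open_target.mem_nhds (c.e.map_source (c.smul_mem γ x hx))] with v hv hvt
          rw [hv, Function.comp_apply, c.e.right_inv hvt])
        (by
          intro γ
          filter_upwards [c.e.open_target.mem_nhds (c.e.map_source hx)] with v hv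
          exact hsymm v hv γ)
      refine ⟨h ∘ L.symm, ?_, ?_⟩
      · rw [hφ x hx]
        refine AnalyticAt.comp ?_ (L.symm.toContinuousLinearMap.analyticAt _)
        change AnalyticAt ℂ h (L.symm (L _))
        rwa [L.symm_apply_apply]
      · have h1 := isOpenMap_orbitMk (Γ := Γ).image_mem_nhds
          (inter_mem ((c.e.continuousAt hx).eventually hfh) (c.e.open_source.mem_nhds hx))
        filter_upwards [h1]
        rintro _ ⟨y, ⟨hy1, hy2⟩, rfl⟩
        change f (orbitMk Γ (c.e.symm (c.e y))) = h (invMap c.ρ (c.e y)) at hy1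
        rw [c.e.left_inv hy2] at hy1
        rw [hy1, Function.comp_apply, Function.comp_apply, hφ y hy2, L.symm_apply_apply]
    · rintro ⟨h, hh, hf⟩
      rw [c.holAt_iff x hx]
      rw [hφ x hx] at hh
      refine ⟨fun v => h (L (invMap c.ρ v)), ?_, ?_⟩
      · have h1 : AnalyticAt ℂ (fun v => L (invMap c.ρ v)) (c.e x) :=
          (L.toContinuousLinearMap.analyticAt _).comp (analyticAt_invMap c.ρ (c.e x))
        exact AnalyticAt.comp (g := h) hh h1
      · filter_upwards [continuous_orbitMk.continuousAt.eventually hf, c.e.open_source.mem_nhds hx]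
          with y hy1 hy2
        rw [Function.comp_apply, hy1, Function.comp_apply, hφ y hy2, Function.comp_apply]

end Quotient

end UniversalModuli
end

noncomputable section
namespace UniversalModuli
open Filter Metric MulAction

/-! ### Complements of complex subspaces -/

section Complement
variable {E : Type} [NormedAddCommGroup E] [NormedSpace ℂ E] {ι : Type} [Finite ι]

/-- The complex line through `v` and `w` meets each `L i` at most once: two common points would put
the direction, and with it `w`, into `L i`. -/
theorem finite_setOf_lineMap_mem (L : ι → Submodule ℂ E) {v w : E} (hw : ∀ i, w ∉ L i) :
    {t : ℂ | ∃ i, v + t • (w - v) ∈ L i}.Finite := by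
  rw [show {t : ℂ | ∃ i, v + t • (w - v) ∈ L i} = ⋃ i, {t : ℂ | v + t • (w - v) ∈ L i} by
    ext; simp]
  refine Set.finite_iUnion fun i => Set.Subsingleton.finite fun t ht s hs => ?_
  by_contra hts
  have h1 := (L i).sub_mem ht hs
  rw [add_sub_add_left_eq_sub, ← sub_smul, (L i).smul_mem_iff (sub_ne_zero.2 hts)] at h1
  apply hw i
  have h2 := (L i).add_mem ht ((L i).smul_mem (1 - t) h1)
  rwa [add_assoc, ← add_smul, add_sub_cancel, one_smul, add_sub_cancel] at h2

/-- The complex line through two points of the set meets the removed subspaces in finitely many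
parameters, and finitely many points do not disconnect the parameter plane. A broken path from 0
through a point near 1/2 to 1 avoids them, and convexity of `T` keeps its image inside `T`. -/
theorem isPreconnected_diff_submodules {T : Set E} (hT : IsOpen T) (hc : Convex ℝ T)
    (K : Submodule ℂ E) (L : ι → Submodule ℂ E) :
    IsPreconnected {v | v ∈ T ∧ v ∈ K ∧ ∀ i, v ∉ L i} := by
  refine isPreconnected_of_forall_pair fun v hv w hw => ?_
  let c : ℝ → ℂ := fun ε => 1 / 2 + ε * Complex.I
  let p : ℂ → E := fun t => v + t • (w - v)
  have hp : Continuous p := by fun_prop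
  have hccont : Continuous c := by fun_prop
  set B : Set ℂ := {t : ℂ | ∃ i, v + t • (w - v) ∈ L i} with hB
  have hBfin : B.Finite := finite_setOf_lineMap_mem L hw.2.2
  have h0 : (0 : ℂ) ∉ B := by rintro ⟨i, hi⟩; simp at hi; exact hv.2.2 i hi
  have h1 : (1 : ℂ) ∉ B := by rintro ⟨i, hi⟩; simp at hi; exact hw.2.2 i hi
  have hmid : p (c 0) ∈ T := by
    have := hc hv.1 hw.1 (by norm_num : (0 : ℝ) ≤ 1 / 2) (by norm_num : (0 : ℝ) ≤ 1 / 2) (by norm_num)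
    convert this using 1
    simp only [p, c]
    rw [show (1 / 2 : ℝ) • v = (1 / 2 : ℂ) • v by rw [← Complex.coe_smul]; norm_num,
      show (1 / 2 : ℝ) • w = (1 / 2 : ℂ) • w by rw [← Complex.coe_smul]; norm_num]
    simp only [Complex.ofReal_zero, zero_mul, add_zero]
    module
  have hev1 : ∀ᶠ ε in 𝓝[>] (0 : ℝ), p (c ε) ∈ T :=
    nhdsWithin_le_nhds ((hp.comp hccont).continuousAt.eventually (hT.mem_nhds hmid))
  have hne : ∀ r : ℝ, ∀ᶠ ε in 𝓝[>] (0 : ℝ), ε ≠ r := fun r => by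
    by_cases h : r = 0
    · filter_upwards [self_mem_nhdsWithin] with ε hε h'
      exact (ne_of_gt hε) (h'.trans h)
    · exact nhdsWithin_le_nhds (isOpen_ne.mem_nhds (Ne.symm h))
  -- A bad parameter `b` lies on the line from 0 through `c ε` for at most one `ε`, namely `b.im /
  -- (2 * b.re)`, and similarly for the line through 1. So finitely many values of `ε` are excluded.
  have hev2 : ∀ᶠ ε in 𝓝[>] (0 : ℝ), ∀ b ∈ B, ∀ s : ℝ, (s : ℂ) * c ε ≠ b ∧ 1 - (s : ℂ) * (1 - c ε) ≠ b := by
    rw [eventually_all_finite hBfin]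
    intro b hb
    filter_upwards [hne (b.im / (2 * b.re)), hne (b.im / (2 * (1 - b.re)))] with ε hε1 hε2 s
    constructor
    · rintro rfl
      have hs : s ≠ 0 := by rintro rfl; simp at hb; exact h0 hb
      refine hε1 ?_
      simp [c]
      field_simp
    · rintro rfl
      have hs : s ≠ 0 := by rintro rfl; simp at hb; exact h1 hb
      refine hε2 ?_
      simp [c]
      field_simp
      ring
  obtain ⟨ε, hε1, hε2⟩ := (hev1.and hev2).exists
  have hKp : ∀ t, p t ∈ K := fun t => K.add_mem hv.2.1 (K.smul_mem _ (K.sub_mem hw.2.1 hv.2.1))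
  refine ⟨segment ℝ v (p (c ε)) ∪ segment ℝ (p (c ε)) w, ?_, Or.inl (left_mem_segment _ _ _),
    Or.inr (right_mem_segment _ _ _), ?_⟩
  · rintro x (hx | hx)
    · have hxT := hc.segment_subset hv.1 hε1 hx
      obtain ⟨a, s, ha, hs, has, rfl⟩ := hx
      have e : a • v + s • p (c ε) = p (s * c ε) := by
        have : a = 1 - s := by linarith
        subst this
        simp only [p, ← Complex.coe_smul]
        push_cast
        module
      rw [e] at hxT ⊢
      exact ⟨hxT, hKp _, fun i hi => (hε2 _ ⟨i, hi⟩ s).1 rfl⟩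
    · have hxT := hc.segment_subset hε1 hw.1 hx
      obtain ⟨s, a, hs, ha, has, rfl⟩ := hx
      have e : s • p (c ε) + a • w = p (1 - s * (1 - c ε)) := by
        have : a = 1 - s := by linarith
        subst this
        simp only [p, ← Complex.coe_smul]
        push_cast
        module
      rw [e] at hxT ⊢
      exact ⟨hxT, hKp _, fun i hi => (hε2 _ ⟨i, hi⟩ s).2 rfl⟩
  · exact (convex_segment _ _).isPreconnected.union (p (c ε)) (right_mem_segment _ _ _)
      (left_mem_segment _ _ _) (convex_segment _ _).isPreconnected

/-- Moving from `v` towards `w` stays in `K`, and along this complex line all but finitely many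
parameters avoid the subspaces `L i`. -/
theorem mem_closure_diff_submodules {T : Set E} (hT : IsOpen T)
    (K : Submodule ℂ E) (L : ι → Submodule ℂ E) {v w : E} (hw : w ∈ K) (hwL : ∀ i, w ∉ L i)
    (hv : v ∈ T) (hvK : v ∈ K) : v ∈ closure {v | v ∈ T ∧ v ∈ K ∧ ∀ i, v ∉ L i} := by
  let p : ℂ → E := fun t => v + t • (w - v)
  have hp : Continuous p := by fun_prop
  have hp0 : p 0 = v := by simp [p]
  have hBfin := finite_setOf_lineMap_mem L (v := v) hwL
  have h1 : ∀ᶠ t in 𝓝[≠] (0 : ℂ), p t ∈ {v | v ∈ T ∧ v ∈ K ∧ ∀ i, v ∉ L i} := by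
    have h2 : ∀ᶠ t in 𝓝[≠] (0 : ℂ), t ∉ {t : ℂ | ∃ i, v + t • (w - v) ∈ L i} := by
      have := (hBfin.subset (Set.sdiff_subset (t := {(0 : ℂ)}))).isClosed.isOpen_compl.mem_nhds
        (show (0 : ℂ) ∈ ({t : ℂ | ∃ i, v + t • (w - v) ∈ L i} \ {0})ᶜ by simp)
      filter_upwards [nhdsWithin_le_nhds this, self_mem_nhdsWithin] with t ht ht0 hB
      exact ht ⟨hB, ht0⟩
    have h3 : ∀ᶠ t in 𝓝[≠] (0 : ℂ), p t ∈ T :=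
      nhdsWithin_le_nhds (hp.continuousAt.eventually (hT.mem_nhds (by rwa [hp0])))
    filter_upwards [h2, h3] with t ht2 ht3
    exact ⟨ht3, K.add_mem hvK (K.smul_mem _ (K.sub_mem hw hvK)), fun i hi => ht2 ⟨i, hi⟩⟩
  have ht : Tendsto p (𝓝[≠] 0) (𝓝 v) := by
    have := (hp.tendsto 0).mono_left (nhdsWithin_le_nhds (s := {0}ᶜ))
    rwa [hp0] at this
  exact mem_closure_of_tendsto ht h1

end Complement

/-! ### The stratification by orbit types -/

section OrbitType
variable {Γ X : Type} [Group Γ] [MulAction Γ X]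

theorem SameOrbitType.refl (x : X) : SameOrbitType Γ x x := ⟨1, by
  ext γ; simp⟩

theorem SameOrbitType.smul (γ : Γ) (x : X) : SameOrbitType Γ x (γ • x) :=
  ⟨γ, stabilizer_smul_eq_stabilizer_map_conj γ x⟩

theorem SameOrbitType.trans {x y z : X} (h : SameOrbitType Γ x y) (h' : SameOrbitType Γ y z) :
    SameOrbitType Γ x z := by
  obtain ⟨γ, hγ⟩ := h
  obtain ⟨δ, hδ⟩ := h'
  refine ⟨δ * γ, ?_⟩
  rw [hδ, hγ, Subgroup.map_map, map_mul]
  rfl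

theorem SameOrbitType.symm {x y : X} (h : SameOrbitType Γ x y) : SameOrbitType Γ y x := by
  obtain ⟨γ, hγ⟩ := h
  refine ⟨γ⁻¹, ?_⟩
  rw [hγ, Subgroup.map_map]
  have : (MulAut.conj γ⁻¹).toMonoidHom.comp (MulAut.conj γ).toMonoidHom = MonoidHom.id Γ := by
    ext δ
    simp [mul_assoc]
  rw [this, Subgroup.map_id]

/-- Conjugate finite groups have the same order, so an inclusion between them is an equality. -/
theorem SameOrbitType.stabilizer_eq {x y : X} [Finite (stabilizer Γ x)] (h : SameOrbitType Γ x y)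
    (hle : stabilizer Γ y ≤ stabilizer Γ x) : stabilizer Γ y = stabilizer Γ x := by
  obtain ⟨γ, hγ⟩ := h
  refine Subgroup.eq_of_le_of_card_ge hle ?_
  rw [hγ]
  exact (Nat.card_congr (Subgroup.equivMapOfInjective _ _ (MulAut.conj γ).injective).toEquiv).le

variable [TopologicalSpace X]

/-- The points of the orbit space that have the orbit type of `x`. -/
def orbitTypeLocus (Γ : Type) {X : Type} [Group Γ] [MulAction Γ X] (x : X) :
    Set (orbitRel.Quotient Γ X) :=
  {q | ∃ y : X, orbitMk Γ y = q ∧ SameOrbitType Γ x y}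

/-- The stratum of `x`. -/
def stratum (Γ : Type) {X : Type} [Group Γ] [MulAction Γ X] [TopologicalSpace X] (x : X) :
    Set (orbitRel.Quotient Γ X) :=
  connectedComponentIn (orbitTypeLocus Γ x) (orbitMk Γ x)

end OrbitType

section OrbitType
variable {Γ X : Type} [Group Γ] [MulAction Γ X]

theorem orbitMk_mem_orbitTypeLocus {x y : X} :
    orbitMk Γ y ∈ orbitTypeLocus Γ x ↔ SameOrbitType Γ x y := by
  constructor
  · rintro ⟨w, hw, h⟩
    obtain ⟨γ, rfl⟩ := orbitMk_eq_iff.1 hw.symm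
    exact h.trans (SameOrbitType.smul γ w)
  · intro h
    exact ⟨y, rfl, h⟩

theorem SameOrbitType.orbitTypeLocus_eq {x y : X} (h : SameOrbitType Γ x y) :
    orbitTypeLocus Γ x = orbitTypeLocus Γ y := by
  ext q
  obtain ⟨z, rfl⟩ := orbitMk_surjective q
  rw [orbitMk_mem_orbitTypeLocus, orbitMk_mem_orbitTypeLocus]
  exact ⟨fun h' => h.symm.trans h', fun h' => h.trans h'⟩

variable [TopologicalSpace X]

theorem mem_stratum (x : X) : orbitMk Γ x ∈ stratum Γ x :=
  mem_connectedComponentIn (orbitMk_mem_orbitTypeLocus.2 (SameOrbitType.refl x))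

theorem isConnected_stratum (x : X) : IsConnected (stratum Γ x) :=
  isConnected_connectedComponentIn_iff.2 (orbitMk_mem_orbitTypeLocus.2 (SameOrbitType.refl x))

theorem stratum_subset (x : X) : stratum Γ x ⊆ orbitTypeLocus Γ x := connectedComponentIn_subset _ _

theorem stratum_eq {x y : X} (h : orbitMk Γ y ∈ stratum Γ x) : stratum Γ y = stratum Γ x := by
  have h1 := orbitMk_mem_orbitTypeLocus.1 (stratum_subset x h)
  rw [stratum, ← h1.orbitTypeLocus_eq]
  exact (connectedComponentIn_eq h).symm

/-! ### Isotropy groups and strata in a linear chart -/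

namespace LinearChart
variable {𝒪 : FunctionSheaf X} {z : X} (c : LinearChart Γ 𝒪 z)

/-- The fixed space of an element of the stabilizer. -/
def fixed (γ : stabilizer Γ z) : Submodule ℂ (Fin c.dim → ℂ) := LinearMap.ker (c.ρ γ - 1)

theorem mem_fixed {γ : stabilizer Γ z} {v : Fin c.dim → ℂ} : v ∈ c.fixed γ ↔ c.ρ γ v = v := by
  rw [fixed, LinearMap.mem_ker, LinearMap.sub_apply, sub_eq_zero]
  rfl

theorem stabilizer_le {x : X} (hx : x ∈ c.e.source) : stabilizer Γ x ≤ stabilizer Γ z :=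
  fun γ hγ => c.mem_stabilizer γ x hx (by rw [mem_stabilizer_iff.1 hγ]; exact hx)

theorem mem_fixed_iff (γ : stabilizer Γ z) {x : X} (hx : x ∈ c.e.source) :
    c.e x ∈ c.fixed γ ↔ γ.1 ∈ stabilizer Γ x := by
  rw [mem_fixed, ← c.equivariant γ x hx, mem_stabilizer_iff]
  exact (c.e.injOn.eq_iff (c.smul_mem γ x hx) hx)

/-- The points of a chart with the same isotropy group as `x`. -/
def piece (x : X) : Set X := {y | y ∈ c.e.source ∧ stabilizer Γ y = stabilizer Γ x}

/-- This form makes the lemmas on complements of complex subspaces applicable: being fixed by `γ` is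
a linear condition, and every isotropy group in the chart is contained in that of the centre. -/
theorem piece_eq {x : X} (hx : x ∈ c.e.source) : c.piece x = c.e.symm '' {v | v ∈ c.e.target ∧
    v ∈ (⨅ γ : {γ : stabilizer Γ z // γ.1 ∈ stabilizer Γ x}, c.fixed γ.1) ∧
    ∀ γ : {γ : stabilizer Γ z // γ.1 ∉ stabilizer Γ x}, v ∉ c.fixed γ.1} := by
  ext y
  constructor
  · rintro ⟨hy, hs⟩
    refine ⟨c.e y, ⟨c.e.map_source hy, ?_, ?_⟩, c.e.left_inv hy⟩
    · rw [Submodule.mem_iInf]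
      rintro ⟨γ, hγ⟩
      rwa [c.mem_fixed_iff γ hy, hs]
    · rintro ⟨γ, hγ⟩
      rwa [c.mem_fixed_iff γ hy, hs]
  · rintro ⟨v, ⟨hv, h1, h2⟩, rfl⟩
    have hy := c.e.map_target hv
    refine ⟨hy, ?_⟩
    rw [Submodule.mem_iInf] at h1
    ext γ
    constructor
    · intro hγ
      by_contra hx'
      refine h2 ⟨⟨γ, c.stabilizer_le hy hγ⟩, hx'⟩ ?_
      have := (c.mem_fixed_iff ⟨γ, c.stabilizer_le hy hγ⟩ hy).2 hγ
      rwa [c.e.right_inv hv] at this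
    · intro hγ
      have := h1 ⟨⟨γ, c.stabilizer_le hx hγ⟩, hγ⟩
      rw [← c.e.right_inv hv, c.mem_fixed_iff _ hy] at this
      exact this

theorem isPreconnected_piece [Finite (stabilizer Γ z)] {x : X} (hx : x ∈ c.e.source) :
    IsPreconnected (c.piece x) := by
  rw [c.piece_eq hx]
  refine (isPreconnected_diff_submodules c.e.open_target c.convex _ _).image _ ?_
  exact c.e.continuousOn_symm.mono fun v hv => hv.1

/-- Since `y` is fixed by the stabilizer of `x`, it lies in the linear space of the piece. The point
`x` is the witness that this space is contained in none of the removed subspaces. -/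
theorem mem_closure_piece [Finite (stabilizer Γ z)] {x y : X} (hx : x ∈ c.e.source)
    (hy : y ∈ c.e.source) (h : stabilizer Γ x ≤ stabilizer Γ y) : y ∈ closure (c.piece x) := by
  rw [c.piece_eq hx]
  have h1 := mem_closure_diff_submodules c.e.open_target
    (⨅ γ : {γ : stabilizer Γ z // γ.1 ∈ stabilizer Γ x}, c.fixed γ.1)
    (fun γ : {γ : stabilizer Γ z // γ.1 ∉ stabilizer Γ x} => c.fixed γ.1) (v := c.e y) (w := c.e x)
    ?_ ?_ (c.e.map_source hy) ?_
  · have h2 := (c.e.continuousAt_symm (c.e.map_source hy)).continuousWithinAt.mem_closure_image h1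
    rwa [c.e.left_inv hy] at h2
  · rw [Submodule.mem_iInf]
    rintro ⟨γ, hγ⟩
    rwa [c.mem_fixed_iff γ hx]
  · rintro ⟨γ, hγ⟩
    rwa [c.mem_fixed_iff γ hx]
  · rw [Submodule.mem_iInf]
    rintro ⟨γ, hγ⟩
    rw [c.mem_fixed_iff γ hy]
    exact h hγ

theorem image_piece_subset [Finite (stabilizer Γ z)] {x : X} (hx : x ∈ c.e.source) :
    orbitMk Γ '' c.piece x ⊆ stratum Γ x := by
  refine ((c.isPreconnected_piece hx).image _ continuous_orbitMk.continuousOn).subset_connectedComponentIn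
    ⟨x, ⟨hx, rfl⟩, rfl⟩ ?_
  rintro _ ⟨y, ⟨_, hy⟩, rfl⟩
  rw [orbitMk_mem_orbitTypeLocus]
  exact ⟨1, by rw [hy]; ext; simp⟩

theorem mem_piece_of_mem_orbitTypeLocus [Finite (stabilizer Γ z)] {x : X} (hx : x ∈ c.e.source)
    (h : orbitMk Γ x ∈ orbitTypeLocus Γ z) : x ∈ c.piece z :=
  ⟨hx, (orbitMk_mem_orbitTypeLocus.1 h).stabilizer_eq (c.stabilizer_le hx)⟩

/-- In the chart all isotropy groups are contained in that of `z`, so having the orbit type of `z`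
means being fixed by the whole stabilizer. The common fixed points form a connected set through `z`,
hence one stratum. -/
theorem orbitMk_mem_stratum_iff [Finite (stabilizer Γ z)] {x : X} (hx : x ∈ c.e.source) :
    orbitMk Γ x ∈ stratum Γ z ↔ ∀ γ, c.e x ∈ c.fixed γ := by
  constructor
  · intro h γ
    rw [c.mem_fixed_iff γ hx, (c.mem_piece_of_mem_orbitTypeLocus hx (stratum_subset z h)).2]
    exact γ.2
  · intro h
    refine c.image_piece_subset c.mem_source ⟨x, ⟨hx, ?_⟩, rfl⟩
    refine le_antisymm (c.stabilizer_le hx) fun γ hγ => ?_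
    exact (c.mem_fixed_iff ⟨γ, hγ⟩ hx).1 (h ⟨γ, hγ⟩)

end LinearChart

end OrbitType

section OrbitType
variable {Γ X : Type} [Group Γ] [MulAction Γ X] [TopologicalSpace X] [ContinuousConstSMul Γ X]
  {𝒪 : FunctionSheaf X} [∀ z : X, Finite (stabilizer Γ z)]

/-- In a chart around one of its points the stratum is the image of the common fixed space. The
points moved by some `γ` are open in the chart, and their open image misses the stratum. -/
theorem isLocallyClosed_stratum (hc : ∀ z : X, Nonempty (LinearChart Γ 𝒪 z))
    (z : X) : IsLocallyClosed (stratum Γ z) := by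
  refine ((isLocallyClosed_tfae (stratum Γ z)).out 0 3).2 fun q hq => ?_
  obtain ⟨w, rfl⟩ := orbitMk_surjective q
  rw [← stratum_eq hq]
  obtain ⟨c⟩ := hc w
  refine ⟨orbitMk Γ '' c.e.source, ⟨w, c.mem_source, rfl⟩, c.isOpen_image, ?_⟩
  rintro _ ⟨⟨x, hx, rfl⟩, hcl⟩
  rw [c.orbitMk_mem_stratum_iff hx]
  intro γ
  rw [LinearChart.mem_fixed]
  by_contra hne
  have ho : IsOpen (c.e.source ∩ c.e ⁻¹' {v | c.ρ γ v ≠ v}) :=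
    c.e.isOpen_inter_preimage (isOpen_ne_fun (continuous_rep c.ρ γ) continuous_id)
  obtain ⟨_, ⟨y, ⟨hy1, hy2⟩, rfl⟩, hy3⟩ := mem_closure_iff.1 hcl _ (isOpenMap_orbitMk (Γ := Γ) _ ho)
    ⟨x, ⟨hx, hne⟩, rfl⟩
  exact hy2 (c.mem_fixed.1 ((c.orbitMk_mem_stratum_iff hy1).1 hy3 γ))

/-- Inside a chart the stratum of a point depends only on its isotropy group, which is one of the
finitely many subgroups of the stabilizer of the centre. -/
theorem finite_strata (hc : ∀ z : X, Nonempty (LinearChart Γ 𝒪 z))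
    (z : X) : ∃ O ∈ 𝓝 (orbitMk Γ z),
    {S | S ∈ Set.range (stratum Γ (X := X)) ∧ (S ∩ O).Nonempty}.Finite := by
  obtain ⟨c⟩ := hc z
  refine ⟨orbitMk Γ '' c.e.source, c.isOpen_image.mem_nhds ⟨z, c.mem_source, rfl⟩, ?_⟩
  have hsub : {S | S ∈ Set.range (stratum Γ (X := X)) ∧ (S ∩ orbitMk Γ '' c.e.source).Nonempty} ⊆
      (fun x => stratum Γ x) '' c.e.source := by
    rintro _ ⟨⟨w, rfl⟩, _, hq, x, hx, rfl⟩
    exact ⟨x, hx, stratum_eq hq⟩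
  refine Set.Finite.subset ?_ hsub
  have hfin : (stabilizer Γ '' c.e.source).Finite := by
    have : Set.Finite {H : Set Γ | H ⊆ stabilizer Γ z} := (Set.toFinite (stabilizer Γ z : Set Γ)).finite_subsets
    refine Set.Finite.of_finite_image (f := fun H : Subgroup Γ => (H : Set Γ)) (this.subset ?_)
      SetLike.coe_injective.injOn
    rintro _ ⟨_, ⟨x, hx, rfl⟩, rfl⟩
    exact c.stabilizer_le hx
  have hfac : ∀ x ∈ c.e.source, ∀ y ∈ c.e.source, stabilizer Γ x = stabilizer Γ y →
      stratum Γ x = stratum Γ y := fun x hx y hy h =>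
    stratum_eq (c.image_piece_subset hy ⟨x, ⟨hx, h⟩, rfl⟩)
  classical
  -- The value `∅` for groups that do not occur as isotropy groups plays no role.
  let g : Subgroup Γ → Set (orbitRel.Quotient Γ X) := fun H =>
    if h : ∃ x ∈ c.e.source, stabilizer Γ x = H then stratum Γ h.choose else ∅
  refine (hfin.image g).subset ?_
  rintro _ ⟨x, hx, rfl⟩
  refine ⟨_, ⟨x, hx, rfl⟩, ?_⟩
  have h : ∃ y ∈ c.e.source, stabilizer Γ y = stabilizer Γ x := ⟨x, hx, rfl⟩
  simp only [g, dif_pos h]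
  exact hfac _ h.choose_spec.1 x hx h.choose_spec.2

/-- Near `z` the stratum of `w` contains the piece of some `x` in the chart, and the stabilizer of
`x` is contained in that of `z`. Every `y` of the chart with isotropy at least that of `z` then lies
in the closure of this piece. -/
theorem exists_nhds_mem_closure_stratum (hc : ∀ z : X, Nonempty (LinearChart Γ 𝒪 z))
    {z w : X} (h : orbitMk Γ z ∈ closure (stratum Γ w)) :
    ∃ O ∈ 𝓝 z, ∀ y ∈ O, stabilizer Γ z ≤ stabilizer Γ y → orbitMk Γ y ∈ closure (stratum Γ w) := by
  obtain ⟨c⟩ := hc z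
  obtain ⟨_, ⟨x, hx, rfl⟩, hxw⟩ := mem_closure_iff.1 h _ c.isOpen_image ⟨z, c.mem_source, rfl⟩
  refine ⟨c.e.source, c.e.open_source.mem_nhds c.mem_source, fun y hy hle => ?_⟩
  rw [← stratum_eq hxw]
  refine closure_mono (c.image_piece_subset hx) ?_
  exact continuous_orbitMk.continuousAt.continuousWithinAt.mem_closure_image
    (c.mem_closure_piece hx hy ((c.stabilizer_le hx).trans hle))

/-- Near one of its points, a stratum consists of the images of points with the same isotropy. -/
theorem exists_nhds_stratum_inter (hc : ∀ z : X, Nonempty (LinearChart Γ 𝒪 z))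
    (z : X) {O : Set X} (hO : O ∈ 𝓝 z) : ∃ V ∈ 𝓝 (orbitMk Γ z),
    ∀ q ∈ stratum Γ z ∩ V, ∃ y ∈ O, orbitMk Γ y = q ∧ stabilizer Γ y = stabilizer Γ z := by
  obtain ⟨c⟩ := hc z
  refine ⟨_, isOpenMap_orbitMk.image_mem_nhds (inter_mem hO (c.e.open_source.mem_nhds c.mem_source)), ?_⟩
  rintro _ ⟨hq, y, ⟨hyO, hy⟩, rfl⟩
  exact ⟨y, hyO, rfl, (c.mem_piece_of_mem_orbitTypeLocus hy (stratum_subset z hq)).2⟩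

/-- A stratum of the orbit space is a complex manifold. -/
theorem isComplexManifold_of_range_eq_stratum [T2Space (orbitRel.Quotient Γ X)]
    (hc : ∀ z : X, Nonempty (LinearChart Γ 𝒪 z)) (h𝒪 : ActsOn Γ 𝒪)
    {T : Type} [TopologicalSpace T] (𝒪T : FunctionSheaf T) (j : T → orbitRel.Quotient Γ X)
    (hj : IsEmbedding j) (z₀ : X) (hr : Set.range j = stratum Γ z₀)
    (hT : ∀ f t, 𝒪T.HolAt f t ↔ ∃ F, (orbitSheaf Γ 𝒪).HolAt F (j t) ∧ f =ᶠ[𝓝 t] F ∘ j) :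
    IsComplexManifold 𝒪T := by
  refine ⟨hj.t2Space, fun t => ?_⟩
  obtain ⟨z, hz⟩ := orbitMk_surjective (j t)
  have hrz : Set.range j = stratum Γ z := by
    rw [hr]; exact (stratum_eq (by rw [← hr, hz]; exact Set.mem_range_self t)).symm
  obtain ⟨c⟩ := hc z
  have := Fintype.ofFinite (stabilizer Γ z)
  set K : Submodule ℂ (Fin c.dim → ℂ) := ⨅ γ, c.fixed γ
  have hK : ∀ v, v ∈ K ↔ ∀ γ, c.ρ γ v = v := fun v => by
    rw [Submodule.mem_iInf]; exact forall_congr' fun γ => c.mem_fixed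
  set m := Module.finrank ℂ K
  let b : K ≃L[ℂ] (Fin m → ℂ) := (Module.finBasis ℂ K).equivFun.toContinuousLinearEquiv
  have hcard : (Fintype.card (stabilizer Γ z) : ℂ) ≠ 0 := by exact_mod_cast Fintype.card_ne_zero
  -- Averaging over the stabilizer is an invariant linear projection onto the common fixed space
  -- `K`. Being invariant, it descends to the quotient, where it provides coordinates on the
  -- stratum.
  let avg : (Fin c.dim → ℂ) →ₗ[ℂ] (Fin c.dim → ℂ) :=
    (Fintype.card (stabilizer Γ z) : ℂ)⁻¹ • ∑ γ, c.ρ γ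
  have havg : ∀ v, avg v = (Fintype.card (stabilizer Γ z) : ℂ)⁻¹ • ∑ γ, c.ρ γ v := fun v => by
    simp [avg]
  have havgK : ∀ v, avg v ∈ K := fun v => by
    rw [hK]
    intro γ
    rw [havg, map_smul, map_sum]
    congr 1
    refine Fintype.sum_equiv (Equiv.mulLeft γ) _ _ fun δ => ?_
    change (c.ρ γ * c.ρ δ) v = c.ρ (γ * δ) v
    rw [map_mul]
  have havgid : ∀ v ∈ K, avg v = v := fun v hv => by
    rw [havg, Finset.sum_congr rfl fun γ _ => (hK v).1 hv γ]
    simp [← Nat.cast_smul_eq_nsmul ℂ, smul_smul]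
  have havginv : ∀ γ v, avg (c.ρ γ v) = avg v := fun γ v => by
    rw [havg, havg]
    congr 1
    refine Fintype.sum_equiv (Equiv.mulRight γ) _ _ fun δ => ?_
    change (c.ρ δ * c.ρ γ) v = c.ρ (δ * γ) v
    rw [map_mul]
  let L : (Fin c.dim → ℂ) →L[ℂ] (Fin m → ℂ) :=
    b.toContinuousLinearMap.comp (avg.codRestrict K havgK).toContinuousLinearMap
  let inc : (Fin m → ℂ) →L[ℂ] (Fin c.dim → ℂ) := K.subtypeL.comp b.symm.toContinuousLinearMap
  have hincK : ∀ u, inc u ∈ K := fun u => (b.symm u).2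
  have hLinc : ∀ u, L (inc u) = u := fun u => by
    change b (avg.codRestrict K havgK (b.symm u)) = u
    have : avg.codRestrict K havgK (b.symm u) = b.symm u := Subtype.ext (havgid _ (b.symm u).2)
    rw [this, b.apply_symm_apply]
  have hincL : ∀ v ∈ K, inc (L v) = v := fun v hv => by
    change ((b.symm (b (avg.codRestrict K havgK v)) : K) : Fin c.dim → ℂ) = v
    rw [b.symm_apply_apply]
    exact havgid v hv
  have hLinv : ∀ γ v, L (c.ρ γ v) = L v := fun γ v => by
    change b (avg.codRestrict K havgK _) = b (avg.codRestrict K havgK _)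
    congr 1
    exact Subtype.ext (havginv γ v)
  obtain ⟨φ, hφ⟩ := c.exists_descend (fun v => L v) hLinv
  have hmem : ∀ x ∈ c.e.source, orbitMk Γ x ∈ Set.range j ↔ c.e x ∈ K := fun x hx => by
    rw [hrz, c.orbitMk_mem_stratum_iff hx, Submodule.mem_iInf]
  set U : Set T := j ⁻¹' (orbitMk Γ '' c.e.source)
  have hU : ∀ s ∈ U, ∃ x ∈ c.e.source, c.e x ∈ K ∧ orbitMk Γ x = j s ∧ inc (φ (j s)) = c.e x := by
    rintro s ⟨x, hx, hxs⟩
    have hxK := (hmem x hx).1 (hxs ▸ Set.mem_range_self s)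
    refine ⟨x, hx, hxK, hxs, ?_⟩
    rw [← hxs, hφ x hx, hincL _ hxK]
  have hback : ∀ s ∈ U, orbitMk Γ (c.e.symm (inc (φ (j s)))) = j s := fun s hs => by
    obtain ⟨x, hx, -, h1, h2⟩ := hU s hs
    rw [h2, c.e.left_inv hx, h1]
  have hφc : ∀ s ∈ U, ContinuousAt φ (j s) := by
    intro s hs
    obtain ⟨x, hx, -, h1, -⟩ := hU s hs
    rw [← h1, ← isOpenQuotientMap_orbitMk.continuousAt_comp_iff]
    refine (L.continuous.continuousAt.comp (c.e.continuousAt hx)).congr ?_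
    filter_upwards [c.e.open_source.mem_nhds hx] with y hy
    exact (hφ y hy).symm
  have himg : (fun s => φ (j s)) '' U = inc ⁻¹' c.e.target := by
    ext u
    constructor
    · rintro ⟨s, hs, rfl⟩
      obtain ⟨x, hx, -, -, h2⟩ := hU s hs
      rw [Set.mem_preimage, h2]
      exact c.e.map_source hx
    · intro hu
      have hx := c.e.map_target hu
      obtain ⟨s, hs⟩ := (hmem _ hx).2 (by rw [c.e.right_inv hu]; exact hincK u)
      refine ⟨s, ⟨_, hx, hs.symm⟩, ?_⟩
      change φ (j s) = u
      rw [hs, hφ _ hx, c.e.right_inv hu, hLinc]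
  refine ⟨m, U, fun s => φ (j s), c.isOpen_image.preimage hj.continuous, ⟨z, c.mem_source, hz⟩,
    ⟨?_, ?_⟩, ?_, ?_⟩
  · rw [isInducing_iff_nhds]
    rintro ⟨s, hs⟩
    apply le_antisymm
    · have : ContinuousAt (fun x : U => φ (j x)) ⟨s, hs⟩ :=
        ContinuousAt.comp (g := φ) (hφc s hs)
          (hj.continuous.continuousAt.comp continuous_subtype_val.continuousAt)
      exact this.le_comap
    · intro O hO
      obtain ⟨O', hO', hsub⟩ := (mem_nhds_induced _ _ _).1 hO
      rw [hj.nhds_eq_comap] at hO'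
      obtain ⟨O'', hO'', hsub'⟩ := hO'
      have hg : ContinuousAt (fun u => orbitMk Γ (c.e.symm (inc u))) (φ (j s)) := by
        refine continuous_orbitMk.continuousAt.comp (ContinuousAt.comp ?_ inc.continuous.continuousAt)
        obtain ⟨x, hx, -, -, h2⟩ := hU s hs
        rw [h2]
        exact c.e.continuousAt_symm (c.e.map_source hx)
      have hg' : (fun u => orbitMk Γ (c.e.symm (inc u))) ⁻¹' O'' ∈ 𝓝 (φ (j s)) := hg (by
        change O'' ∈ 𝓝 (orbitMk Γ (c.e.symm (inc (φ (j s)))))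
        rw [hback s hs]
        exact hO'')
      refine mem_comap.2 ⟨_, hg', ?_⟩
      rintro ⟨s', hs'⟩ h
      refine hsub (hsub' ?_)
      change orbitMk Γ (c.e.symm (inc (φ (j s')))) ∈ O'' at h
      rwa [hback s' hs'] at h
  · rintro ⟨s, hs⟩ ⟨s', hs'⟩ h
    apply Subtype.ext
    apply hj.injective
    change φ (j s) = φ (j s') at h
    rw [← hback s hs, ← hback s' hs', h]
  · rw [himg]
    exact c.e.open_target.preimage inc.continuous
  · intro s hs f
    obtain ⟨x, hx, hxK, h1, h2⟩ := hU s hs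
    rw [hT]
    constructor
    · rintro ⟨F, hF, hf⟩
      rw [← h1, orbitSheaf_holAt_iff h𝒪, c.holAt_iff x hx] at hF
      obtain ⟨h, hh, hFh⟩ := hF
      refine ⟨h ∘ inc, ?_, ?_⟩
      · refine AnalyticAt.comp ?_ (inc.analyticAt _)
        rwa [h2]
      · have hg : Tendsto (fun s' => c.e.symm (inc (φ (j s')))) (𝓝 s) (𝓝 x) := by
          have h3 : ContinuousAt (fun s' => c.e.symm (inc (φ (j s')))) s := by
            refine ContinuousAt.comp (g := c.e.symm) ?_ (inc.continuous.continuousAt.comp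
              ((hφc s hs).comp hj.continuous.continuousAt))
            rw [h2]
            exact c.e.continuousAt_symm (c.e.map_source hx)
          rw [ContinuousAt, h2, c.e.left_inv hx] at h3
          exact h3
        filter_upwards [hf, hg.eventually hFh,
          (c.isOpen_image.preimage hj.continuous).mem_nhds hs] with s' hs1 hs2 hs3
        rw [hs1]
        change F (orbitMk Γ _) = h (c.e _) at hs2
        rw [hback s' hs3] at hs2
        obtain ⟨y, hy, -, -, h4⟩ := hU s' hs3
        change F (j s') = h (inc (φ (j s')))
        rw [hs2, h4, c.e.right_inv (c.e.map_source hy)]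
    · rintro ⟨h, hh, hf⟩
      -- A holomorphic function on the stratum extends to the quotient by composing it with the
      -- invariant projection to `K`.
      obtain ⟨F, hF⟩ := c.exists_descend (fun v => h (L v)) fun γ v => by rw [hLinv]
      have hLx : L (c.e x) = φ (j s) := by rw [← h1, hφ x hx]
      refine ⟨F, ?_, ?_⟩
      · rw [← h1]
        refine c.holAt_of_comp h𝒪 (h := fun v => h (L v)) hF hx ?_
        refine AnalyticAt.comp (g := h) ?_ (L.analyticAt _)
        rwa [hLx]
      · filter_upwards [hf, (c.isOpen_image.preimage hj.continuous).mem_nhds hs] with s' hs1 hs3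
        obtain ⟨y, hy, -, h5, -⟩ := hU s' hs3
        rw [hs1, Function.comp_apply, Function.comp_apply, ← h5, hF y hy, hφ y hy]

end OrbitType

end UniversalModuli
end

noncomputable section
namespace UniversalModuli
open Filter Metric MulAction

/-! ### Analytic families of matrices -/

section AnalyticMatrix
variable {E : Type} [NormedAddCommGroup E] [NormedSpace ℂ E] {n : ℕ}
  {M N : E → Matrix (Fin n) (Fin n) ℂ} {x : E}

/-- A family of matrices whose entries are analytic at `x`. -/
def AnalyticEntriesAt (M : E → Matrix (Fin n) (Fin n) ℂ) (x : E) : Prop :=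
  ∀ i j, AnalyticAt ℂ (fun y => M y i j) x

theorem AnalyticEntriesAt.const (A : Matrix (Fin n) (Fin n) ℂ) :
    AnalyticEntriesAt (fun _ : E => A) x := fun _ _ => analyticAt_const

theorem AnalyticEntriesAt.add (hM : AnalyticEntriesAt M x) (hN : AnalyticEntriesAt N x) :
    AnalyticEntriesAt (fun y => M y + N y) x := fun i j => (hM i j).add (hN i j)

theorem AnalyticEntriesAt.sub (hM : AnalyticEntriesAt M x) (hN : AnalyticEntriesAt N x) :
    AnalyticEntriesAt (fun y => M y - N y) x := fun i j => (hM i j).sub (hN i j)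

theorem AnalyticEntriesAt.mul (hM : AnalyticEntriesAt M x) (hN : AnalyticEntriesAt N x) :
    AnalyticEntriesAt (fun y => M y * N y) x := fun i j => by
  simp only [Matrix.mul_apply]
  exact Finset.analyticAt_fun_sum _ fun k _ => (hM i k).mul (hN k j)

theorem AnalyticEntriesAt.det (hM : AnalyticEntriesAt M x) :
    AnalyticAt ℂ (fun y => (M y).det) x := by
  simp only [Matrix.det_apply]
  refine Finset.analyticAt_fun_sum _ fun σ _ => ?_
  simp only [Units.smul_def, zsmul_eq_mul]
  exact analyticAt_const.mul (Finset.analyticAt_fun_prod _ fun i _ => hM _ _)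

theorem AnalyticEntriesAt.inv (hM : AnalyticEntriesAt M x) (h : IsUnit (M x)) :
    AnalyticEntriesAt (fun y => (M y)⁻¹) x := fun i j => by
  simp only [Matrix.inv_def, Ring.inverse_eq_inv', Matrix.smul_apply, smul_eq_mul,
    Matrix.adjugate_apply]
  refine (hM.det.inv ((Matrix.isUnit_iff_isUnit_det _).1 h).ne_zero).mul
    (AnalyticEntriesAt.det fun k l => ?_)
  by_cases hk : k = j
  · subst hk
    simpa using analyticAt_const
  · simpa [Matrix.updateRow_ne hk] using hM k l

theorem AnalyticEntriesAt.analyticAt (hM : AnalyticEntriesAt M x) :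
    AnalyticAt ℂ (fun y => (fun i j => M y i j : Fin n → Fin n → ℂ)) x :=
  analyticAt_pi_iff.2 fun i => analyticAt_pi_iff.2 fun j => hM i j

theorem AnalyticEntriesAt.continuousAt (hM : AnalyticEntriesAt M x) : ContinuousAt M x :=
  hM.analyticAt.continuousAt

theorem AnalyticEntriesAt.of (x : Fin n → Fin n → ℂ) :
    AnalyticEntriesAt (fun y : Fin n → Fin n → ℂ => Matrix.of y) x := fun i j =>
  ((ContinuousLinearMap.proj (R := ℂ) j).comp
    (ContinuousLinearMap.proj (R := ℂ) (φ := fun _ : Fin n => Fin n → ℂ) i)).analyticAt x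

end AnalyticMatrix

/-! ### The topology of the Siegel upper half space -/

section Siegel
variable {n : ℕ}

/-- The complex matrices with positive definite imaginary part, without the symmetry condition. -/
def posIm (n : ℕ) : Set (Matrix (Fin n) (Fin n) ℂ) :=
  {Z | ∀ x : Fin n → ℝ, x ≠ 0 → 0 < x ⬝ᵥ (Z.map Complex.im) *ᵥ x}

theorem mem_siegel_iff {Z : Matrix (Fin n) (Fin n) ℂ} :
    (Zᵀ = Z ∧ (Z.map Complex.im).PosDef) ↔ Zᵀ = Z ∧ Z ∈ posIm n := by
  refine and_congr_right fun hZ => ⟨fun h x hx => ?_, fun h => ?_⟩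
  · simpa using h.dotProduct_mulVec_pos hx
  · refine Matrix.PosDef.of_dotProduct_mulVec_pos ?_ fun x hx => by simpa using h x hx
    rw [Matrix.IsHermitian, Matrix.conjTranspose_eq_transpose_of_trivial,
      ← Matrix.transpose_map, hZ]

theorem mem_posIm_iff {Z : Matrix (Fin n) (Fin n) ℂ} :
    Z ∈ posIm n ↔ ∀ x ∈ sphere (0 : Fin n → ℝ) 1, 0 < x ⬝ᵥ (Z.map Complex.im) *ᵥ x := by
  refine ⟨fun h x hx => h x (ne_of_mem_sphere hx one_ne_zero), fun h x hx => ?_⟩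
  have hn : ‖x‖ ≠ 0 := norm_ne_zero_iff.2 hx
  have := h (‖x‖⁻¹ • x) (by simp [norm_smul, hn])
  rw [Matrix.mulVec_smul, smul_dotProduct, dotProduct_smul, smul_eq_mul, smul_eq_mul] at this
  have hp : 0 < ‖x‖⁻¹ := by positivity
  exact (mul_pos_iff_of_pos_left hp).1 ((mul_pos_iff_of_pos_left hp).1 this)

/-- By homogeneity positivity needs testing on the unit sphere only, and that is compact. -/
theorem isOpen_posIm : IsOpen (posIm n) := by
  rw [isOpen_iff_mem_nhds]
  intro Z hZ
  have h := (isCompact_sphere (0 : Fin n → ℝ) 1).eventually_forall_of_forall_eventually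
    (x₀ := Z) (P := fun Z x => 0 < x ⬝ᵥ (Z.map Complex.im) *ᵥ x) fun x hx => by
      have hc : Continuous fun p : Matrix (Fin n) (Fin n) ℂ × (Fin n → ℝ) =>
          p.2 ⬝ᵥ (p.1.map Complex.im) *ᵥ p.2 := by
        simp only [dotProduct, Matrix.mulVec, Matrix.map_apply]
        fun_prop
      exact hc.continuousAt.eventually (lt_mem_nhds (mem_posIm_iff.1 hZ x hx))
  filter_upwards [h] with W hW
  exact mem_posIm_iff.2 hW

theorem isLocallyClosed_siegel :
    IsLocallyClosed {Z : Matrix (Fin n) (Fin n) ℂ | Zᵀ = Z ∧ (Z.map Complex.im).PosDef} := by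
  simp only [mem_siegel_iff]
  exact ((isClosed_eq (by fun_prop) continuous_id).isLocallyClosed).inter
    isOpen_posIm.isLocallyClosed

instance : LocallyCompactSpace (SiegelSpace n) := by
  have : LocallyCompactSpace (Matrix (Fin n) (Fin n) ℂ) :=
    inferInstanceAs (LocallyCompactSpace (Fin n → Fin n → ℂ))
  exact isLocallyClosed_siegel.locallyCompactSpace

instance : SecondCountableTopology (SiegelSpace n) := by
  have : SecondCountableTopology (Matrix (Fin n) (Fin n) ℂ) :=
    inferInstanceAs (SecondCountableTopology (Fin n → Fin n → ℂ))
  exact TopologicalSpace.Subtype.secondCountableTopology _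

/-- The complex conjugate of a matrix. -/
def conjMat (Z : Matrix (Fin n) (Fin n) ℂ) : Matrix (Fin n) (Fin n) ℂ := Z.map (starRingEnd ℂ)

theorem conjMat_mul (Z W : Matrix (Fin n) (Fin n) ℂ) :
    conjMat (Z * W) = conjMat Z * conjMat W := Matrix.map_mul

theorem conjMat_add (Z W : Matrix (Fin n) (Fin n) ℂ) :
    conjMat (Z + W) = conjMat Z + conjMat W := by
  ext; simp [conjMat]

theorem transpose_conjMat (Z : Matrix (Fin n) (Fin n) ℂ) : (conjMat Z)ᵀ = conjMat Zᵀ := rfl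

theorem conjMat_intCast (P : Matrix (Fin n) (Fin n) ℤ) :
    conjMat (P.map (Int.cast : ℤ → ℂ)) = P.map (Int.cast : ℤ → ℂ) := by
  ext; simp [conjMat]

theorem conjMat_num (M : Sp n) (Z : Matrix (Fin n) (Fin n) ℂ) :
    conjMat (M.num Z) = M.num (conjMat Z) := by
  rw [Sp.num, conjMat_add, conjMat_mul, Sp.A, Sp.B, conjMat_intCast, conjMat_intCast]; rfl

theorem conjMat_den (M : Sp n) (Z : Matrix (Fin n) (Fin n) ℂ) :
    conjMat (M.den Z) = M.den (conjMat Z) := by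
  rw [Sp.den, conjMat_add, conjMat_mul, Sp.C, Sp.D, conjMat_intCast, conjMat_intCast]; rfl

/-- The matrix `Z` is the denominator of the modular transformation given by `J`. -/
theorem SiegelSpace.isUnit (Z : SiegelSpace n) : IsUnit Z.1 := by
  let M : Sp n := ⟨Matrix.J (Fin n) ℤ, SymplecticGroup.J_mem _ _⟩
  have h := M.isUnit_den Z
  have hC : M.C = 1 := by
    ext i j; simp [Sp.C, M, Matrix.J, Matrix.one_apply]
  have hD : M.D = 0 := by
    ext i j; simp [Sp.D, M, Matrix.J]
  rwa [Sp.den, hC, hD, one_mul, add_zero] at h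

/-- The imaginary part of the difference is the sum of the two imaginary parts. Hence the difference
is again a point of the Siegel space, and in particular invertible. -/
theorem sub_conjMat_mem (W Z : SiegelSpace n) :
    (W.1 - conjMat Z.1)ᵀ = W.1 - conjMat Z.1 ∧ ((W.1 - conjMat Z.1).map Complex.im).PosDef := by
  refine ⟨by rw [Matrix.transpose_sub, transpose_conjMat, W.2.1, Z.2.1], ?_⟩
  have : (W.1 - conjMat Z.1).map Complex.im = W.1.map Complex.im + Z.1.map Complex.im := by
    ext; simp [conjMat]
  rw [this]
  exact W.2.2.add Z.2.2

theorem isUnit_sub_conjMat (W Z : SiegelSpace n) : IsUnit (W.1 - conjMat Z.1) :=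
  SiegelSpace.isUnit ⟨_, sub_conjMat_mem W Z⟩

theorem num_eq (M : Sp n) (Z : SiegelSpace n) : M.num Z.1 = (M • Z).1 * M.den Z.1 := by
  rw [smul_val, Matrix.mul_assoc,
    Matrix.nonsing_inv_mul _ ((Matrix.isUnit_iff_isUnit_det _).1 (M.isUnit_den Z)), Matrix.mul_one]

theorem num_conjMat_eq (M : Sp n) (Z : SiegelSpace n) :
    M.num (conjMat Z.1) = conjMat (M • Z).1 * M.den (conjMat Z.1) := by
  rw [← conjMat_num, num_eq, conjMat_mul, conjMat_den]

theorem analyticEntriesAt_num (M : Sp n) (x : Fin n → Fin n → ℂ) :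
    AnalyticEntriesAt (fun y => M.num (Matrix.of y)) x :=
  ((AnalyticEntriesAt.const _).mul (AnalyticEntriesAt.of x)).add (AnalyticEntriesAt.const _)

theorem analyticEntriesAt_den (M : Sp n) (x : Fin n → Fin n → ℂ) :
    AnalyticEntriesAt (fun y => M.den (Matrix.of y)) x :=
  ((AnalyticEntriesAt.const _).mul (AnalyticEntriesAt.of x)).add (AnalyticEntriesAt.const _)

theorem analyticEntriesAt_smul (M : Sp n) (Z : SiegelSpace n) :
    AnalyticEntriesAt (fun y => M.num (Matrix.of y) * (M.den (Matrix.of y))⁻¹) Z.1 :=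
  (analyticEntriesAt_num M _).mul ((analyticEntriesAt_den M _).inv (M.isUnit_den Z))

theorem SiegelSpace.continuous_val :
    Continuous fun Z : SiegelSpace n => (Z.1 : Fin n → Fin n → ℂ) := continuous_subtype_val

/-- A map of Siegel spaces that extends analytically to the matrix spaces is continuous. -/
theorem SiegelSpace.continuousAt_of_analytic {g h : ℕ} {φ : SiegelSpace g → SiegelSpace h}
    {Φ : (Fin g → Fin g → ℂ) → Matrix (Fin h) (Fin h) ℂ} {W : SiegelSpace g}
    (hΦ : AnalyticEntriesAt Φ W.1) (heq : ∀ V, (φ V).1 = Φ V.1) : ContinuousAt φ W := by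
  have h1 : ContinuousAt (fun V : SiegelSpace g => Φ V.1) W :=
    ContinuousAt.comp (g := Φ) hΦ.continuousAt SiegelSpace.continuous_val.continuousAt
  have h2 : ContinuousAt (fun V : SiegelSpace g => (φ V).1) W :=
    h1.congr (Eventually.of_forall fun V => (heq V).symm)
  exact IsInducing.subtypeVal.continuousAt_iff.2 h2

/-- Holomorphic functions pull back along maps that extend analytically to the matrix spaces. -/
theorem SiegelSpace.holAt_comp {g h : ℕ} {φ : SiegelSpace g → SiegelSpace h}
    {Φ : (Fin g → Fin g → ℂ) → Matrix (Fin h) (Fin h) ℂ} {W : SiegelSpace g}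
    (hΦ : AnalyticEntriesAt Φ W.1) (heq : ∀ V, (φ V).1 = Φ V.1) {f : SiegelSpace h → ℂ}
    (hf : (SiegelSpace.hol h).HolAt f (φ W)) : (SiegelSpace.hol g).HolAt (f ∘ φ) W := by
  obtain ⟨F, hF, hfF⟩ := hf
  refine ⟨fun y => F fun i j => Φ y i j, ?_, ?_⟩
  · refine AnalyticAt.comp (g := F) ?_ hΦ.analyticAt
    have : (fun i j => Φ (fun i j => W.1 i j) i j) = fun i j => (φ W).1 i j := by
      rw [heq]
    rw [this]
    exact hF
  · filter_upwards [(SiegelSpace.continuousAt_of_analytic hΦ heq).eventually hfF] with V hV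
    rw [Function.comp_apply, hV, Function.comp_apply, heq]
    rfl

theorem actsOn_siegel : ActsOn (Sp n) (SiegelSpace.hol n) := fun M _ Z hf =>
  SiegelSpace.holAt_comp (analyticEntriesAt_smul M Z) (fun _ => rfl) hf

instance : ContinuousConstSMul (Sp n) (SiegelSpace n) where
  continuous_const_smul M := continuous_iff_continuousAt.2 fun Z =>
    SiegelSpace.continuousAt_of_analytic (analyticEntriesAt_smul M Z) fun _ => rfl

end Siegel

end UniversalModuli
end

noncomputable section
namespace UniversalModuli
open Filter Metric MulAction

/-! ### Proper discontinuity of the modular action -/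

section Proper
variable {n : ℕ}

theorem continuous_conjMat : Continuous (conjMat (n := n)) :=
  continuous_matrix fun i j => Complex.continuous_conj.comp (by fun_prop)

theorem continuous_inv_sub_conjMat :
    Continuous fun W : SiegelSpace n => (W.1 - conjMat W.1)⁻¹ := by
  rw [continuous_iff_continuousAt]
  intro W
  have h := (AnalyticEntriesAt.of (W.1 - conjMat W.1)).inv (isUnit_sub_conjMat W W)
  exact ContinuousAt.comp (g := fun y : Fin n → Fin n → ℂ => (Matrix.of y)⁻¹)
    (f := fun W : SiegelSpace n => W.1 - conjMat W.1) h.continuousAt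
    (continuous_subtype_val.sub (continuous_conjMat.comp continuous_subtype_val)).continuousAt

/-- Real `P` and `Q` are continuous functions of `W` and `P * W + Q`: subtracting the conjugate
leaves `P * (W - conjMat W)`, whose second factor is invertible. These functions are bounded on the
compact set `K ×ˢ S`. -/
theorem exists_bound_coeff {K : Set (SiegelSpace n)} (hK : IsCompact K)
    {S : Set (Matrix (Fin n) (Fin n) ℂ)} (hS : IsCompact S) :
    ∃ R : ℝ, ∀ W ∈ K, ∀ P Q : Matrix (Fin n) (Fin n) ℂ, conjMat P = P → conjMat Q = Q →
      P * W.1 + Q ∈ S → ∀ i j, ‖P i j‖ ≤ R ∧ ‖Q i j‖ ≤ R := by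
  let f : SiegelSpace n × Matrix (Fin n) (Fin n) ℂ → Matrix (Fin n) (Fin n) ℂ := fun p =>
    (p.2 - conjMat p.2) * (p.1.1 - conjMat p.1.1)⁻¹
  have hf : Continuous f := (continuous_snd.sub (continuous_conjMat.comp continuous_snd)).matrix_mul
    (continuous_inv_sub_conjMat.comp continuous_fst)
  have hbd : ∀ F : SiegelSpace n × Matrix (Fin n) (Fin n) ℂ → Matrix (Fin n) (Fin n) ℂ,
      Continuous F → ∃ R : ℝ, ∀ p ∈ K ×ˢ S, ∀ i j, ‖F p i j‖ ≤ R := by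
    intro F hF
    have hF' : Continuous fun p => (fun i j => F p i j : Fin n → Fin n → ℂ) := hF
    obtain ⟨R, hR⟩ := ((hK.prod hS).image hF').isBounded.exists_norm_le
    refine ⟨R, fun p hp i j => le_trans ?_ (hR _ ⟨p, hp, rfl⟩)⟩
    exact (norm_le_pi_norm (fun j => F p i j) j).trans
      (norm_le_pi_norm (fun i j => F p i j) i)
  obtain ⟨R₁, hR₁⟩ := hbd f hf
  obtain ⟨R₂, hR₂⟩ := hbd (fun p => p.2 - f p * p.1.1)
    (continuous_snd.sub (hf.matrix_mul (continuous_subtype_val.comp continuous_fst)))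
  refine ⟨max R₁ R₂, fun W hW P Q hP hQ hPQ i j => ?_⟩
  have hu := (Matrix.isUnit_iff_isUnit_det _).1 (isUnit_sub_conjMat W W)
  have h1 : f (W, P * W.1 + Q) = P := by
    have : P * W.1 + Q - conjMat (P * W.1 + Q) = P * (W.1 - conjMat W.1) := by
      rw [conjMat_add, conjMat_mul, hP, hQ]; noncomm_ring
    simp only [f]
    rw [this, Matrix.mul_assoc, Matrix.mul_nonsing_inv _ hu, Matrix.mul_one]
  have h2 := hR₁ (W, P * W.1 + Q) ⟨hW, hPQ⟩ i j
  have h3 := hR₂ (W, P * W.1 + Q) ⟨hW, hPQ⟩ i j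
  simp only [h1, add_sub_cancel_left] at h2 h3
  exact ⟨h2.trans (le_max_left _ _), h3.trans (le_max_right _ _)⟩

/-- The hermitian form given by the imaginary part of a symmetric matrix. -/
def imForm (Z : Matrix (Fin n) (Fin n) ℂ) (v : Fin n → ℂ) : ℝ :=
  (star v ⬝ᵥ ((Z.map Complex.im).map Complex.ofReal) *ᵥ v).re

theorem imForm_smul (Z : Matrix (Fin n) (Fin n) ℂ) (r : ℝ) (v : Fin n → ℂ) :
    imForm Z ((r : ℂ) • v) = r ^ 2 * imForm Z v := by
  rw [imForm, star_smul, Matrix.mulVec_smul, smul_dotProduct, dotProduct_smul, smul_smul,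
    smul_eq_mul, Complex.star_def, Complex.conj_ofReal, ← Complex.ofReal_mul,
    Complex.re_ofReal_mul, imForm]
  ring

open scoped ComplexOrder in
theorem imForm_pos (Z : SiegelSpace n) {v : Fin n → ℂ} (hv : v ≠ 0) : 0 < imForm Z.1 v :=
  (Complex.pos_iff.1 ((Sp.posDef_ofReal.2 Z.2.2).dotProduct_mulVec_pos hv)).1

theorem continuous_imForm :
    Continuous fun p : Matrix (Fin n) (Fin n) ℂ × (Fin n → ℂ) => imForm p.1 p.2 := by
  simp only [imForm, dotProduct, Matrix.mulVec, Matrix.map_apply, Pi.star_apply]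
  fun_prop

/-- The form attains a positive minimum on `K` times the unit sphere; homogeneity does the rest. -/
theorem exists_imForm_ge {K : Set (SiegelSpace n)} (hK : IsCompact K) :
    ∃ c > 0, ∀ W ∈ K, ∀ v : Fin n → ℂ, c * ‖v‖ ^ 2 ≤ imForm W.1 v := by
  have hc : Continuous fun p : SiegelSpace n × (Fin n → ℂ) => imForm p.1.1 p.2 :=
    continuous_imForm.comp ((continuous_subtype_val.comp continuous_fst).prodMk continuous_snd)
  obtain ⟨c, hc0, hcK⟩ : ∃ c > 0, ∀ p ∈ K ×ˢ sphere (0 : Fin n → ℂ) 1, c ≤ imForm p.1.1 p.2 := by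
    rcases (K ×ˢ sphere (0 : Fin n → ℂ) 1).eq_empty_or_nonempty with h | h
    · exact ⟨1, one_pos, by simp [h]⟩
    · obtain ⟨p, hp, hmin⟩ := (hK.prod (isCompact_sphere _ _)).exists_isMinOn h hc.continuousOn
      exact ⟨_, imForm_pos p.1 (ne_of_mem_sphere hp.2 one_ne_zero), fun q hq => hmin hq⟩
  refine ⟨c, hc0, fun W hW v => ?_⟩
  by_cases hv : v = 0
  · simp [hv, imForm]
  · have hn : ‖v‖ ≠ 0 := norm_ne_zero_iff.2 hv
    have h := hcK (W, ((‖v‖⁻¹ : ℝ) : ℂ) • v) ⟨hW, by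
      simp [norm_smul, hn]⟩
    simp only [imForm_smul] at h
    have h2 : 0 < ‖v‖ ^ 2 := by positivity
    calc c * ‖v‖ ^ 2 ≤ (‖v‖⁻¹ ^ 2 * imForm W.1 v) * ‖v‖ ^ 2 := by gcongr
      _ = imForm W.1 v := by field_simp

/-- The imaginary parts of `W` and `M • W` are congruent as hermitian forms through the denominator,
by the identity `den_conj_mul_num`. -/
theorem imForm_den (M : Sp n) (W : SiegelSpace n) (v : Fin n → ℂ) :
    imForm (M • W).1 (M.den W.1 *ᵥ v) = imForm W.1 v := by
  have h := M.den_conj_mul_num W.1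
  have h1 : (M.num W.1)ᴴ = (M.den W.1)ᴴ * ((M • W).1)ᴴ := by
    rw [num_eq, Matrix.conjTranspose_mul]
  rw [h1, num_eq, ← Matrix.mul_assoc, ← Matrix.sub_mul, ← Matrix.mul_sub,
    Sp.sub_conjTranspose W.2.1, Sp.sub_conjTranspose (M • W).2.1, Matrix.mul_smul,
    Matrix.smul_mul] at h
  have h2 := smul_right_injective _ (by simp : (2 * Complex.I) ≠ 0) h
  rw [imForm, imForm, ← h2, Matrix.star_mulVec, ← Matrix.dotProduct_mulVec, Matrix.mulVec_mulVec,
    Matrix.mulVec_mulVec, Matrix.mul_assoc]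

theorem exists_bound_den {K L : Set (SiegelSpace n)} (hK : IsCompact K) (hL : IsCompact L) :
    ∃ R : ℝ, ∀ M : Sp n, ∀ W ∈ K, M • W ∈ L → ∀ i j, ‖M.den W.1 i j‖ ≤ R := by
  obtain ⟨c, hc, hcL⟩ := exists_imForm_ge hL
  have hcont : Continuous fun W : SiegelSpace n => ∑ j, imForm W.1 (Pi.single j 1) :=
    continuous_finsetSum _ fun j _ =>
      continuous_imForm.comp (continuous_subtype_val.prodMk continuous_const)
  obtain ⟨R, hR⟩ := (hK.image hcont).isBounded.exists_norm_le
  -- From `c * ‖v‖ ^ 2 ≤ R` it follows that `‖v‖ ≤ R / c` unless `‖v‖ ≤ 1`.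
  refine ⟨max 1 (R / c), fun M W hW hMW i j => ?_⟩
  set v := M.den W.1 *ᵥ Pi.single j 1
  have h1 : c * ‖v‖ ^ 2 ≤ R := by
    calc c * ‖v‖ ^ 2 ≤ imForm W.1 (Pi.single j 1) := by
          rw [← imForm_den M]; exact hcL _ hMW _
      _ ≤ ∑ j, imForm W.1 (Pi.single j 1) :=
          Finset.single_le_sum (f := fun j => imForm W.1 (Pi.single j 1))
            (fun k _ => (imForm_pos W (by simp)).le) (Finset.mem_univ j)
      _ ≤ R := (le_abs_self _).trans (hR _ ⟨W, hW, rfl⟩)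
  have h2 : ‖M.den W.1 i j‖ ≤ ‖v‖ := by
    have := norm_le_pi_norm v i
    simpa [v] using this
  refine h2.trans ?_
  by_contra! hlt
  have h3 := (le_max_left _ _).trans_lt hlt
  have h4 := (le_max_right _ _).trans_lt hlt
  rw [div_lt_iff₀ hc] at h4
  nlinarith [mul_pos hc (sub_pos.2 h3)]

theorem finite_bounded_sp (R : ℝ) :
    {M : Sp n | ∀ i j, ‖((M.1 i j : ℤ) : ℂ)‖ ≤ R}.Finite := by
  have h1 : {a : ℤ | ‖(a : ℂ)‖ ≤ R}.Finite := by
    refine (Set.finite_Icc (-⌈R⌉) ⌈R⌉).subset fun a ha => ?_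
    rw [Set.mem_ofPred_eq, Complex.norm_intCast] at ha
    obtain ⟨h1, h2⟩ := abs_le.1 (ha.trans (Int.le_ceil R))
    exact ⟨by exact_mod_cast h1, by exact_mod_cast h2⟩
  have h2 : {A : Matrix (Fin n ⊕ Fin n) (Fin n ⊕ Fin n) ℤ | ∀ i j, A i j ∈
      {a : ℤ | ‖(a : ℂ)‖ ≤ R}}.Finite := by
    have h3 : {r : Fin n ⊕ Fin n → ℤ | ∀ j, r j ∈ {a : ℤ | ‖(a : ℂ)‖ ≤ R}}.Finite :=
      Set.Finite.pi' fun _ => h1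
    exact Set.Finite.pi' (ι := Fin n ⊕ Fin n) (κ := fun _ => Fin n ⊕ Fin n → ℤ) fun _ => h3
  exact h2.preimage Subtype.val_injective.injOn

/-- If `M` moves a point of `K` into `L`, its denominator there is bounded, so `C` and `D` are. The
numerator is `M • W` times the denominator, hence bounded too, and so are `A` and `B`. Finitely many
integral matrices remain. -/
instance : ProperlyDiscontinuousSMul (Sp n) (SiegelSpace n) where
  finite_disjoint_inter_image {K L} hK hL := by
    obtain ⟨R, hR⟩ := exists_bound_den hK hL
    let S : Set (Matrix (Fin n) (Fin n) ℂ) :=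
      Set.univ.pi fun _ : Fin n => Set.univ.pi fun _ : Fin n => closedBall (0 : ℂ) R
    have hS : IsCompact S := isCompact_univ_pi fun _ => isCompact_univ_pi fun _ =>
      isCompact_closedBall (0 : ℂ) R
    obtain ⟨R₁, hR₁⟩ := exists_bound_coeff hK hS
    have hS' := (hL.image continuous_subtype_val).prod hS |>.image
      (f := fun p : Matrix (Fin n) (Fin n) ℂ × Matrix (Fin n) (Fin n) ℂ => p.1 * p.2)
      (continuous_fst.matrix_mul continuous_snd)
    obtain ⟨R₂, hR₂⟩ := exists_bound_coeff hK hS'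
    refine (finite_bounded_sp (max R₁ R₂)).subset ?_
    rintro M ⟨_, ⟨W, hW, rfl⟩, hMW⟩
    have hden : M.den W.1 ∈ S := fun i _ j _ =>
      mem_closedBall_zero_iff.2 (hR M W hW hMW i j)
    have h1 := hR₁ W hW M.C M.D (conjMat_intCast _) (conjMat_intCast _) hden
    have h2 := hR₂ W hW M.A M.B (conjMat_intCast _) (conjMat_intCast _)
      ⟨((M • W).1, M.den W.1), ⟨⟨_, hMW, rfl⟩, hden⟩, (num_eq M W).symm⟩
    rintro (i | i) (j | j)
    · exact ((h2 i j).1).trans (le_max_right _ _)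
    · exact ((h2 i j).2).trans (le_max_right _ _)
    · exact ((h1 i j).1).trans (le_max_left _ _)
    · exact ((h1 i j).2).trans (le_max_left _ _)

instance (Z : SiegelSpace n) : Finite (stabilizer (Sp n) Z) :=
  (ProperlyDiscontinuousSMul.finite_stabilizer Z).to_subtype

instance : T2Space (AV n) := t2Space_of_properlyDiscontinuousSMul_of_t2Space

end Proper

end UniversalModuli
end

noncomputable section
namespace UniversalModuli
open Filter Metric MulAction

/-! ### Linear charts of the Siegel upper half space -/

section Global
variable {Γ X : Type} [Group Γ] [MulAction Γ X] [TopologicalSpace X] {𝒪 : FunctionSheaf X} {z : X}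

/-- Global coordinates with linear stabilizer action are cut down to an invariant convex
neighbourhood of 0 so small that only the stabilizer can map one of its points to another. -/
theorem nonempty_linearChart_of_global [Finite (stabilizer Γ z)] {N : ℕ}
    (e₀ : OpenPartialHomeomorph X (Fin N → ℂ)) (hs : e₀.source = Set.univ)
    (ρ : stabilizer Γ z →* Module.End ℂ (Fin N → ℂ)) (hbase : e₀ z = 0)
    (hequi : ∀ (γ : stabilizer Γ z) (x : X), e₀ (γ • x) = ρ γ (e₀ x))
    (hol : ∀ x f, 𝒪.HolAt f x ↔ ∃ h : (Fin N → ℂ) → ℂ, AnalyticAt ℂ h (e₀ x) ∧ f =ᶠ[𝓝 x] h ∘ e₀)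
    {B : Set X} (hB : B ∈ 𝓝 z)
    (hBst : ∀ γ : Γ, ((γ • ·) '' B ∩ B).Nonempty → γ • z = z) :
    Nonempty (LinearChart Γ 𝒪 z) := by
  have hB' : e₀.symm ⁻¹' B ∩ e₀.target ∈ 𝓝 (0 : Fin N → ℂ) := by
    have h0 : (0 : Fin N → ℂ) ∈ e₀.target := by
      rw [← hbase]
      exact e₀.map_source (hs ▸ Set.mem_univ _)
    refine inter_mem ((e₀.continuousAt_symm h0) ?_) (e₀.open_target.mem_nhds h0)
    rw [← hbase, e₀.left_inv (hs ▸ Set.mem_univ _)]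
    exact hB
  obtain ⟨ε, hε, hball⟩ := Metric.mem_nhds_iff.1 hB'
  -- The intersection over the finite group of the preimages of a ball is open, convex and
  -- invariant.
  let V : Set (Fin N → ℂ) := ⋂ γ : stabilizer Γ z, ρ γ ⁻¹' ball 0 ε
  have hVo : IsOpen V := isOpen_iInter_of_finite fun γ =>
    isOpen_ball.preimage (LinearMap.continuous_of_finiteDimensional (ρ γ))
  have hVb : V ⊆ ball 0 ε := fun v hv => by
    have := Set.mem_iInter.1 hv 1
    rwa [Set.mem_preimage, map_one] at this
  have hVt : V ⊆ e₀.target := fun v hv => (hball (hVb hv)).2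
  let e := (e₀.symm.restrOpen V hVo).symm
  have hes : ∀ W, W ∈ e.source ↔ e₀ W ∈ V := fun W => by
    change W ∈ e₀.source ∩ e₀ ⁻¹' V ↔ _
    rw [hs, Set.univ_inter]; rfl
  have het : e.target = V := Set.inter_eq_right.2 hVt
  refine ⟨⟨N, e, ρ, ?_, hbase, ?_, ?_, ?_, fun γ W _ => hequi γ W, fun W _ f => ?_⟩⟩
  · rw [hes, hbase]
    exact Set.mem_iInter.2 fun γ => by simpa using hε
  · rw [het]
    refine convex_iInter fun γ => ?_
    exact (convex_ball (0 : Fin N → ℂ) ε).linear_preimage ((ρ γ).restrictScalars ℝ)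
  · have hsB : ∀ W, W ∈ e.source → W ∈ B := fun W hW => by
      have := (hball (hVb ((hes W).1 hW))).1
      rwa [Set.mem_preimage, e₀.left_inv (hs ▸ Set.mem_univ _)] at this
    intro γ W hW hγW
    exact hBst γ ⟨γ • W, ⟨W, hsB W hW, rfl⟩, hsB _ hγW⟩
  · intro γ W hW
    rw [hes, hequi]
    refine Set.mem_iInter.2 fun δ => ?_
    have := Set.mem_iInter.1 ((hes W).1 hW) (δ * γ)
    rwa [Set.mem_preimage, map_mul] at this
  · exact hol W f

end Global

section SiegelChart
variable {n : ℕ}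

/-- Linear coordinates on the space of symmetric matrices. -/
structure SymCoord (n : ℕ) where
  N : ℕ
  L : (Fin n → Fin n → ℂ) →L[ℂ] (Fin N → ℂ)
  ι : (Fin N → ℂ) →L[ℂ] (Fin n → Fin n → ℂ)
  left_inv : ∀ u, L (ι u) = u
  transpose : ∀ u, (Matrix.of (ι u))ᵀ = Matrix.of (ι u)
  right_inv : ∀ M : Fin n → Fin n → ℂ, (Matrix.of M)ᵀ = Matrix.of M → ι (L M) = M

theorem nonempty_symCoord (n : ℕ) : Nonempty (SymCoord n) := by
  let K : Submodule ℂ (Fin n → Fin n → ℂ) :=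
    { carrier := {M | ∀ i j, M j i = M i j}
      add_mem' := fun {a b} ha hb i j => by simp [ha i j, hb i j]
      zero_mem' := fun i j => rfl
      smul_mem' := fun c a ha i j => by simp [ha i j] }
  let b : K ≃L[ℂ] (Fin (Module.finrank ℂ K) → ℂ) :=
    (Module.finBasis ℂ K).equivFun.toContinuousLinearEquiv
  let ι : (Fin (Module.finrank ℂ K) → ℂ) →L[ℂ] (Fin n → Fin n → ℂ) :=
    K.subtypeL.comp b.symm.toContinuousLinearMap
  have hι : Function.Injective ι := Subtype.val_injective.comp b.symm.injective
  obtain ⟨L, hL⟩ := LinearMap.exists_leftInverse_of_injective ι.toLinearMap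
    (LinearMap.ker_eq_bot.2 hι)
  have hLι : ∀ u, L (ι u) = u := fun u => LinearMap.congr_fun hL u
  refine ⟨⟨_, L.toContinuousLinearMap, ι, hLι, fun u => ?_, fun M hM => ?_⟩⟩
  · ext i j
    exact (b.symm u).2 i j
  · have hMK : M ∈ K := fun i j => congrFun (congrFun hM i) j
    have : M = ι (b ⟨M, hMK⟩) := by
      change M = ((b.symm (b ⟨M, hMK⟩) : K) : Fin n → Fin n → ℂ)
      rw [b.symm_apply_apply]
    change ι (L M) = M
    conv_lhs => rw [this, hLι]
    exact this.symm

/-! ### The Cayley transform and the action of the stabilizer -/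

variable (Z : SiegelSpace n)

/-- The Cayley type transform that maps `Z` to `0` and linearizes the action of its stabilizer. -/
def cayley (M : Matrix (Fin n) (Fin n) ℂ) : Matrix (Fin n) (Fin n) ℂ :=
  (M - conjMat Z.1)⁻¹ - (Z.1 - conjMat Z.1)⁻¹

/-- The inverse of the Cayley type transform. -/
def cayleyInv (A : Matrix (Fin n) (Fin n) ℂ) : Matrix (Fin n) (Fin n) ℂ :=
  (A + (Z.1 - conjMat Z.1)⁻¹)⁻¹ + conjMat Z.1

theorem cayley_base : cayley Z Z.1 = 0 := sub_self _

theorem cayley_transpose {W : Matrix (Fin n) (Fin n) ℂ} (hW : Wᵀ = W) :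
    (cayley Z W)ᵀ = cayley Z W := by
  rw [cayley, Matrix.transpose_sub, Matrix.transpose_nonsing_inv, Matrix.transpose_nonsing_inv,
    Matrix.transpose_sub, Matrix.transpose_sub, transpose_conjMat, hW, Z.2.1]

theorem cayleyInv_transpose {A : Matrix (Fin n) (Fin n) ℂ} (hA : Aᵀ = A) :
    (cayleyInv Z A)ᵀ = cayleyInv Z A := by
  rw [cayleyInv, Matrix.transpose_add, Matrix.transpose_nonsing_inv, Matrix.transpose_add,
    Matrix.transpose_nonsing_inv, Matrix.transpose_sub, transpose_conjMat, hA, Z.2.1]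

theorem cayley_add_eq (W : Matrix (Fin n) (Fin n) ℂ) :
    cayley Z W + (Z.1 - conjMat Z.1)⁻¹ = (W - conjMat Z.1)⁻¹ := sub_add_cancel _ _

theorem cayleyInv_cayley (W : SiegelSpace n) : cayleyInv Z (cayley Z W.1) = W.1 := by
  rw [cayleyInv, cayley_add_eq, Matrix.nonsing_inv_nonsing_inv _
    ((Matrix.isUnit_iff_isUnit_det _).1 (isUnit_sub_conjMat W Z)), sub_add_cancel]

theorem cayley_cayleyInv {A : Matrix (Fin n) (Fin n) ℂ}
    (hA : IsUnit (A + (Z.1 - conjMat Z.1)⁻¹)) : cayley Z (cayleyInv Z A) = A := by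
  rw [cayley, cayleyInv, add_sub_cancel_right, Matrix.nonsing_inv_nonsing_inv _
    ((Matrix.isUnit_iff_isUnit_det _).1 hA), add_sub_cancel_right]

theorem isUnit_cayley_add (W : SiegelSpace n) :
    IsUnit (cayley Z W.1 + (Z.1 - conjMat Z.1)⁻¹) := by
  rw [cayley_add_eq, Matrix.isUnit_nonsing_inv_iff]
  exact isUnit_sub_conjMat W Z

/-- The automorphy factor of `M` at the conjugate of `Z`. -/
def factor (M : Sp n) : Matrix (Fin n) (Fin n) ℂ := M.den (conjMat Z.1)

variable {Z}

theorem num_conjMat_eq_of_mem {M : Sp n} (hM : M ∈ stabilizer (Sp n) Z) :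
    M.num (conjMat Z.1) = conjMat Z.1 * factor Z M := by
  rw [num_conjMat_eq, mem_stabilizer_iff.1 hM]; rfl

/-- This is the cocycle relation of the denominators at the conjugate of `Z`, a point that `N` fixes
along with `Z`. -/
theorem factor_mul {M N : Sp n} (hN : N ∈ stabilizer (Sp n) Z) :
    factor Z (M * N) = factor Z M * factor Z N := by
  obtain ⟨-, -, h3, h4⟩ := Sp.blocks_mul M N
  have h := num_conjMat_eq_of_mem hN
  have e : M.C * N.num (conjMat Z.1) + M.D * N.den (conjMat Z.1) = factor Z (M * N) := by
    change _ = (M * N).C * conjMat Z.1 + (M * N).D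
    rw [h3, h4, Sp.num, Sp.den]
    noncomm_ring
  rw [← e, h]
  change _ = (M.C * conjMat Z.1 + M.D) * factor Z N
  change _ + M.D * factor Z N = _
  noncomm_ring

theorem factor_one : factor Z 1 = 1 := by
  obtain ⟨-, -, h3, h4⟩ := Sp.blocks_one (g := n)
  rw [factor, Sp.den, h3, h4, zero_mul, zero_add]

/-- With `c` the conjugate of `Z`, which `M` fixes too, the action is affine in `(V - c)⁻¹`. The
constant term drops out on subtracting the value at `V = Z`, and only the linear part `j * ⋯ * jᵀ`
is left. -/
theorem cayley_smul {M : Sp n} (hM : M ∈ stabilizer (Sp n) Z) (W : SiegelSpace n) :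
    cayley Z (M • W).1 = factor Z M * cayley Z W.1 * (factor Z M)ᵀ := by
  obtain ⟨h1, h2, h3⟩ := M.relations
  set c := conjMat Z.1 with hc
  set j := factor Z M with hj
  have hct : cᵀ = c := by rw [hc, transpose_conjMat, Z.2.1]
  have hnum : M.A * c + M.B = c * j := num_conjMat_eq_of_mem hM
  have hjd : j = M.C * c + M.D := rfl
  -- The symplectic relations and `M.A * c + M.B = c * j` identify `M.A - c * M.C` with the inverse
  -- of `jᵀ`.
  have hE : (M.A - c * M.C)ᵀ * j = 1 := by
    rw [Matrix.transpose_sub, Matrix.transpose_mul, hct, Matrix.sub_mul, Matrix.mul_assoc M.Cᵀ,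
      ← hnum, hjd, ← h3]
    have : M.Aᵀ * (M.C * c + M.D) - M.Cᵀ * (M.A * c + M.B) =
      (M.Aᵀ * M.C - M.Cᵀ * M.A) * c + (M.Aᵀ * M.D - M.Cᵀ * M.B) := by noncomm_ring
    rw [this, h1, sub_self, zero_mul, zero_add]
  have hE' : (M.A - c * M.C) * jᵀ = 1 := by
    have := congrArg Matrix.transpose (mul_eq_one_comm.1 hE)
    rwa [Matrix.transpose_mul, Matrix.transpose_transpose, Matrix.transpose_one] at this
  have key : ∀ V : SiegelSpace n, ((M • V).1 - c)⁻¹ = (M.C + j * (V.1 - c)⁻¹) * jᵀ := by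
    intro V
    have hu := (Matrix.isUnit_iff_isUnit_det _).1 (isUnit_sub_conjMat V Z)
    have hd := (Matrix.isUnit_iff_isUnit_det _).1 (M.isUnit_den V)
    have hden : M.den V.1 = M.C * (V.1 - c) + j := by rw [hjd, Sp.den]; noncomm_ring
    have hmul : ((M • V).1 - c) * M.den V.1 = (M.A - c * M.C) * (V.1 - c) := by
      rw [Matrix.sub_mul, ← num_eq, hden, Sp.num]
      have : c * (M.C * (V.1 - c) + j) = c * M.C * (V.1 - c) + (M.A * c + M.B) := by
        rw [hnum]; noncomm_ring
      rw [this]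
      noncomm_ring
    have h4 : M.C + j * (V.1 - c)⁻¹ = M.den V.1 * (V.1 - c)⁻¹ := by
      rw [hden, Matrix.add_mul, Matrix.mul_assoc, Matrix.mul_nonsing_inv _ hu, Matrix.mul_one]
    apply Matrix.inv_eq_right_inv
    rw [h4, ← Matrix.mul_assoc, ← Matrix.mul_assoc, hmul, Matrix.mul_assoc (M.A - c * M.C),
      Matrix.mul_nonsing_inv _ hu, Matrix.mul_one, hE']
  have hW := key W
  have hZ := key Z
  rw [mem_stabilizer_iff.1 hM] at hZ
  rw [cayley, cayley, ← hc, hW]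
  conv_lhs => rw [hZ]
  noncomm_ring

variable (Z)

theorem analyticEntriesAt_cayley (W : SiegelSpace n) :
    AnalyticEntriesAt (fun y => cayley Z (Matrix.of y)) W.1 :=
  (((AnalyticEntriesAt.of _).sub (AnalyticEntriesAt.const _)).inv (isUnit_sub_conjMat W Z)).sub
    (AnalyticEntriesAt.const _)

theorem analyticEntriesAt_cayleyInv {A : Fin n → Fin n → ℂ}
    (hA : IsUnit (Matrix.of A + (Z.1 - conjMat Z.1)⁻¹)) :
    AnalyticEntriesAt (fun y => cayleyInv Z (Matrix.of y)) A :=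
  (((AnalyticEntriesAt.of _).add (AnalyticEntriesAt.const _)).inv hA).add
    (AnalyticEntriesAt.const _)

theorem isOpen_cayley_target : IsOpen {A : Fin n → Fin n → ℂ |
    IsUnit (Matrix.of A + (Z.1 - conjMat Z.1)⁻¹) ∧ cayleyInv Z (Matrix.of A) ∈ posIm n} := by
  rw [isOpen_iff_mem_nhds]
  rintro A ⟨h1, h2⟩
  refine inter_mem ?_ ((analyticEntriesAt_cayleyInv Z h1).continuousAt (isOpen_posIm.mem_nhds h2))
  have h3 : ContinuousAt (fun A : Fin n → Fin n → ℂ =>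
      (Matrix.of A + (Z.1 - conjMat Z.1)⁻¹).det) A :=
    ((AnalyticEntriesAt.of A).add (AnalyticEntriesAt.const _)).det.continuousAt
  rw [Matrix.isUnit_iff_isUnit_det, isUnit_iff_ne_zero] at h1
  filter_upwards [h3.eventually (isOpen_ne.mem_nhds h1)] with B hB
  exact (Matrix.isUnit_iff_isUnit_det _).2 (isUnit_iff_ne_zero.2 hB)

theorem SymCoord.ι_cayley (s : SymCoord n) (W : SiegelSpace n) :
    s.ι (s.L fun i j => cayley Z W.1 i j) = fun i j => cayley Z W.1 i j :=
  s.right_inv (fun i j => cayley Z W.1 i j) (cayley_transpose Z W.2.1)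

open Classical in
/-- The inverse of the Cayley type transform in coordinates. -/
def SymCoord.symm (s : SymCoord n) (u : Fin s.N → ℂ) : SiegelSpace n :=
  if h : cayleyInv Z (Matrix.of (s.ι u)) ∈ posIm n then
    ⟨cayleyInv Z (Matrix.of (s.ι u)), mem_siegel_iff.2 ⟨cayleyInv_transpose Z (s.transpose u), h⟩⟩
  -- This value is taken only outside the target of the chart.
  else Z

theorem SymCoord.symm_val (s : SymCoord n) {u : Fin s.N → ℂ}
    (h : cayleyInv Z (Matrix.of (s.ι u)) ∈ posIm n) :
    (s.symm Z u).1 = cayleyInv Z (Matrix.of (s.ι u)) := by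
  rw [SymCoord.symm, dif_pos h]

theorem SymCoord.cayleyInv_ι (s : SymCoord n) (W : SiegelSpace n) :
    cayleyInv Z (Matrix.of (s.ι (s.L fun i j => cayley Z W.1 i j))) = W.1 := by
  rw [s.ι_cayley]; exact cayleyInv_cayley Z W

/-- The Cayley type transform as a homeomorphism onto an open set. -/
def SymCoord.chart (s : SymCoord n) : OpenPartialHomeomorph (SiegelSpace n) (Fin s.N → ℂ) where
  toFun W := s.L fun i j => cayley Z W.1 i j
  invFun := s.symm Z
  source := Set.univ
  target := s.ι ⁻¹' {A | IsUnit (Matrix.of A + (Z.1 - conjMat Z.1)⁻¹) ∧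
    cayleyInv Z (Matrix.of A) ∈ posIm n}
  map_source' W _ := by
    refine ⟨?_, ?_⟩
    · rw [s.ι_cayley]
      exact isUnit_cayley_add Z W
    · rw [s.cayleyInv_ι]
      exact (mem_siegel_iff.1 W.2).2
  map_target' _ _ := Set.mem_univ _
  left_inv' W _ := Subtype.ext (by
    rw [s.symm_val, s.cayleyInv_ι]
    rw [s.cayleyInv_ι]
    exact (mem_siegel_iff.1 W.2).2)
  right_inv' u hu := by
    rw [s.symm_val Z hu.2, cayley_cayleyInv Z hu.1]
    exact s.left_inv u
  open_source := isOpen_univ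
  open_target := (isOpen_cayley_target Z).preimage s.ι.continuous
  continuousOn_toFun := by
    refine Continuous.continuousOn (s.L.continuous.comp (continuous_iff_continuousAt.2 fun W => ?_))
    exact ContinuousAt.comp (g := fun y : Fin n → Fin n → ℂ => cayley Z (Matrix.of y))
      (analyticEntriesAt_cayley Z W).continuousAt SiegelSpace.continuous_val.continuousAt
  continuousOn_invFun := by
    intro u hu
    refine ContinuousAt.continuousWithinAt (IsInducing.subtypeVal.continuousAt_iff.2 ?_)
    have h1 : ContinuousAt (fun v => cayleyInv Z (Matrix.of (s.ι v))) u :=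
      ContinuousAt.comp (g := fun y : Fin n → Fin n → ℂ => cayleyInv Z (Matrix.of y))
        (analyticEntriesAt_cayleyInv Z hu.1).continuousAt s.ι.continuous.continuousAt
    refine h1.congr ?_
    filter_upwards [((isOpen_cayley_target Z).preimage s.ι.continuous).mem_nhds hu] with v hv
    rw [Function.comp_apply, s.symm_val Z hv.2]

theorem SymCoord.chart_apply (s : SymCoord n) (W : SiegelSpace n) :
    s.chart Z W = s.L fun i j => cayley Z W.1 i j := rfl

theorem SymCoord.chart_base (s : SymCoord n) : s.chart Z Z = 0 := by
  rw [s.chart_apply, cayley_base]; exact map_zero s.L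

theorem SymCoord.holAt_iff (s : SymCoord n) (W : SiegelSpace n) (f : SiegelSpace n → ℂ) :
    (SiegelSpace.hol n).HolAt f W ↔
      ∃ h : (Fin s.N → ℂ) → ℂ, AnalyticAt ℂ h (s.chart Z W) ∧ f =ᶠ[𝓝 W] h ∘ s.chart Z := by
  constructor
  · rintro ⟨F, hF, hfF⟩
    have ht : s.chart Z W ∈ (s.chart Z).target := (s.chart Z).map_source (Set.mem_univ _)
    refine ⟨fun u => F fun i j => cayleyInv Z (Matrix.of (s.ι u)) i j, ?_, ?_⟩
    · have h1 := ((analyticEntriesAt_cayleyInv Z ht.1).analyticAt).comp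
        (s.ι.analyticAt (s.chart Z W))
      refine AnalyticAt.comp (g := F) ?_ h1
      have h2 : ((fun y : Fin n → Fin n → ℂ => fun i j => cayleyInv Z (Matrix.of y) i j) ∘ s.ι)
          (s.chart Z W) = fun i j => W.1 i j := by
        funext i j
        exact congrFun (congrFun (s.cayleyInv_ι Z W) i) j
      have h3 : AnalyticAt ℂ F (fun i j => W.1 i j) := hF
      rw [← h2] at h3
      exact h3
    · filter_upwards [hfF] with X hX
      rw [hX]
      change F (fun i j => X.1 i j) = F fun i j => cayleyInv Z (Matrix.of (s.ι (s.chart Z X))) i j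
      congr 1
      funext i j
      exact (congrFun (congrFun (s.cayleyInv_ι Z X) i) j).symm
  · rintro ⟨h, hh, hfh⟩
    refine ⟨fun y => h (s.L fun i j => cayley Z (Matrix.of y) i j), ?_, hfh⟩
    refine AnalyticAt.comp (g := h) hh ?_
    exact (s.L.analyticAt _).comp (analyticEntriesAt_cayley Z W).analyticAt

/-- The map `A ↦ j A jᵀ` of symmetric matrices in coordinates. -/
def SymCoord.lin (s : SymCoord n) (j : Matrix (Fin n) (Fin n) ℂ) :
    Module.End ℂ (Fin s.N → ℂ) where
  toFun u := s.L fun a b => (j * Matrix.of (s.ι u) * jᵀ) a b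
  map_add' u v := by
    rw [← map_add, map_add]
    congr 1
    funext a b
    change (j * (Matrix.of (s.ι u) + Matrix.of (s.ι v)) * jᵀ) a b = _
    rw [Matrix.mul_add, Matrix.add_mul]; rfl
  map_smul' c u := by
    rw [RingHom.id_apply, ← map_smul, map_smul]
    congr 1
    funext a b
    change (j * (c • Matrix.of (s.ι u)) * jᵀ) a b = _
    rw [Matrix.mul_smul, Matrix.smul_mul]; rfl

theorem SymCoord.lin_apply (s : SymCoord n) (j : Matrix (Fin n) (Fin n) ℂ) (u : Fin s.N → ℂ) :
    s.lin j u = s.L fun a b => (j * Matrix.of (s.ι u) * jᵀ) a b := rfl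

theorem SymCoord.ι_lin (s : SymCoord n) (j : Matrix (Fin n) (Fin n) ℂ) (u : Fin s.N → ℂ) :
    Matrix.of (s.ι (s.lin j u)) = j * Matrix.of (s.ι u) * jᵀ :=
  s.right_inv (fun a b => (j * Matrix.of (s.ι u) * jᵀ) a b) (by
    change (j * Matrix.of (s.ι u) * jᵀ)ᵀ = j * Matrix.of (s.ι u) * jᵀ
    rw [Matrix.transpose_mul, Matrix.transpose_mul, Matrix.transpose_transpose, s.transpose,
      Matrix.mul_assoc])

theorem SymCoord.lin_one (s : SymCoord n) : s.lin 1 = 1 := by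
  refine LinearMap.ext fun u => ?_
  rw [s.lin_apply, Matrix.transpose_one, Matrix.one_mul, Matrix.mul_one]
  exact s.left_inv u

theorem SymCoord.lin_mul (s : SymCoord n) (j k : Matrix (Fin n) (Fin n) ℂ) :
    s.lin (j * k) = s.lin j * s.lin k := by
  refine LinearMap.ext fun u => ?_
  rw [Module.End.mul_apply, s.lin_apply j, s.ι_lin, s.lin_apply, Matrix.transpose_mul]
  simp only [Matrix.mul_assoc]

/-- The linearized action of the stabilizer. -/
def SymCoord.rep (s : SymCoord n) : stabilizer (Sp n) Z →* Module.End ℂ (Fin s.N → ℂ) where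
  toFun γ := s.lin (factor Z γ.1)
  map_one' := by
    rw [OneMemClass.coe_one, factor_one, s.lin_one]
  map_mul' γ δ := by
    rw [Subgroup.coe_mul, factor_mul δ.2, s.lin_mul]

theorem SymCoord.chart_smul (s : SymCoord n) (γ : stabilizer (Sp n) Z) (W : SiegelSpace n) :
    s.chart Z (γ • W) = s.rep Z γ (s.chart Z W) := by
  change s.chart Z (γ.1 • W) = s.lin (factor Z γ.1) (s.chart Z W)
  rw [s.lin_apply, s.chart_apply, s.chart_apply, s.ι_cayley, cayley_smul γ.2]
  rfl

theorem nonempty_linearChart : Nonempty (LinearChart (Sp n) (SiegelSpace.hol n) Z) := by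
  obtain ⟨s⟩ := nonempty_symCoord n
  obtain ⟨B, hB, hBst⟩ := ProperlyDiscontinuousSMul.exists_nhds_image_smul_eq_self (Sp n) Z
  exact nonempty_linearChart_of_global (s.chart Z) rfl (s.rep Z) (s.chart_base Z)
    (s.chart_smul Z) (s.holAt_iff Z) hB hBst

theorem isComplexSpace_AV (n : ℕ) : IsComplexSpace (AV.hol n) :=
  isComplexSpace_orbitSheaf actsOn_siegel nonempty_linearChart

end SiegelChart

end UniversalModuli
end

noncomputable section
namespace UniversalModuli
open Filter Metric MulAction

/-! ### Block decompositions along the last coordinate -/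

section Blocks
variable {g : ℕ}

/-- The index set of `Sp(2(g+1))` split into that of `Sp(2g)` and that of `Sp(2)`. -/
def blkEquiv (g : ℕ) : (Fin g ⊕ Fin g) ⊕ (Fin 1 ⊕ Fin 1) ≃ Fin (g + 1) ⊕ Fin (g + 1) :=
  (Equiv.sumSumSumComm _ _ _ _).trans (Equiv.sumCongr finSumFinEquiv finSumFinEquiv)

/-- A matrix in the block form of `blkEquiv`. -/
def blk {R : Type} (M : Matrix (Fin (g + 1) ⊕ Fin (g + 1)) (Fin (g + 1) ⊕ Fin (g + 1)) R) :
    Matrix ((Fin g ⊕ Fin g) ⊕ (Fin 1 ⊕ Fin 1)) ((Fin g ⊕ Fin g) ⊕ (Fin 1 ⊕ Fin 1)) R :=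
  M.submatrix (blkEquiv g) (blkEquiv g)

theorem blk_mul (M N : Matrix (Fin (g + 1) ⊕ Fin (g + 1)) (Fin (g + 1) ⊕ Fin (g + 1)) ℤ) :
    blk (M * N) = blk M * blk N := (Matrix.submatrix_mul_equiv _ _ _ _ _).symm

theorem blk_injective {R : Type} : Function.Injective (blk (g := g) (R := R)) := fun M N h => by
  ext i j
  have := congrFun (congrFun h ((blkEquiv g).symm i)) ((blkEquiv g).symm j)
  simpa [blk] using this

theorem blk_one : blk (1 : Matrix (Fin (g + 1) ⊕ Fin (g + 1)) (Fin (g + 1) ⊕ Fin (g + 1)) ℤ) = 1 :=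
  Matrix.submatrix_one_equiv _

theorem blk_J : blk (Matrix.J (Fin (g + 1)) ℤ) =
    fromBlocks (Matrix.J (Fin g) ℤ) 0 0 (Matrix.J (Fin 1) ℤ) := by
  ext ((i | i) | (i | i)) ((j | j) | (j | j)) <;>
    simp [blk, blkEquiv, Matrix.J, Matrix.one_apply, Fin.ext_iff] <;> omega

theorem mem_symplectic_iff_blk
    {M : Matrix (Fin (g + 1) ⊕ Fin (g + 1)) (Fin (g + 1) ⊕ Fin (g + 1)) ℤ} :
    M ∈ symplecticGroup (Fin (g + 1)) ℤ ↔
      blk M * fromBlocks (Matrix.J (Fin g) ℤ) 0 0 (Matrix.J (Fin 1) ℤ) * (blk M)ᵀ =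
        fromBlocks (Matrix.J (Fin g) ℤ) 0 0 (Matrix.J (Fin 1) ℤ) := by
  rw [SymplecticGroup.mem_iff, ← blk_J, ← blk_injective.eq_iff, blk_mul, blk_mul]
  rfl

theorem blk_incl (a : Sp g) : blk (Sp.incl g (g + 1) g.le_succ a).1 = fromBlocks a.1 0 0 1 := by
  ext ((i | i) | (i | i)) ((j | j) | (j | j)) <;>
    simp [blk, blkEquiv, Sp.incl, pad, Matrix.one_apply, Matrix.toBlocks₁₁, Matrix.toBlocks₁₂,
      Matrix.toBlocks₂₁, Matrix.toBlocks₂₂, Fin.ext_iff] <;> omega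

theorem exists_incl_eq_of_blk {N : Sp (g + 1)} {x : Matrix (Fin g ⊕ Fin g) (Fin g ⊕ Fin g) ℤ}
    (h : blk N.1 = fromBlocks x 0 0 1) : ∃ a : Sp g, N = Sp.incl g (g + 1) g.le_succ a := by
  have h1 := mem_symplectic_iff_blk.1 N.2
  rw [h, fromBlocks_transpose, fromBlocks_multiply, fromBlocks_multiply] at h1
  have h2 := (fromBlocks_inj.1 h1).1
  simp only [Matrix.transpose_zero, Matrix.mul_zero, Matrix.zero_mul, add_zero] at h2
  refine ⟨⟨x, SymplecticGroup.mem_iff.2 h2⟩, Subtype.ext (blk_injective ?_)⟩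
  rw [h, blk_incl]

/-- The automorphism of order four of the last factor of a product of polarized abelian varieties
whose last factor is the elliptic curve with period `i`. -/
def lastRot (g : ℕ) : Sp (g + 1) :=
  ⟨(fromBlocks 1 0 0 (Matrix.J (Fin 1) ℤ)).submatrix (blkEquiv g).symm (blkEquiv g).symm, by
    rw [mem_symplectic_iff_blk]
    have : blk ((fromBlocks 1 0 0 (Matrix.J (Fin 1) ℤ)).submatrix (blkEquiv g).symm
        (blkEquiv g).symm) = fromBlocks 1 0 0 (Matrix.J (Fin 1) ℤ) := by
      simp [blk]
    rw [this, fromBlocks_transpose, fromBlocks_multiply, fromBlocks_multiply]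
    simp [Matrix.J_transpose, Matrix.J_squared]⟩

theorem blk_lastRot : blk (lastRot g).1 = fromBlocks 1 0 0 (Matrix.J (Fin 1) ℤ) := by
  simp [blk, lastRot]

theorem lastRot_pow : lastRot g ^ 4 = 1 := by
  apply Subtype.ext
  apply blk_injective
  have : (lastRot g ^ 4).1 = ((lastRot g).1 * (lastRot g).1) * ((lastRot g).1 * (lastRot g).1) := by
    rw [pow_succ, pow_succ, pow_succ, pow_one, mul_assoc]; rfl
  rw [this, blk_mul, blk_mul, blk_lastRot, fromBlocks_multiply]
  simp only [Matrix.mul_zero, Matrix.zero_mul, add_zero, zero_add, Matrix.J_squared, mul_one]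
  rw [fromBlocks_multiply]
  simp [blk_one]

theorem commute_lastRot_of_blk {N : Sp (g + 1)} {x : Matrix (Fin g ⊕ Fin g) (Fin g ⊕ Fin g) ℤ}
    {ε : Matrix (Fin 1 ⊕ Fin 1) (Fin 1 ⊕ Fin 1) ℤ} (h : blk N.1 = fromBlocks x 0 0 ε)
    (hε : ε * Matrix.J (Fin 1) ℤ = Matrix.J (Fin 1) ℤ * ε) : N * lastRot g = lastRot g * N := by
  apply Subtype.ext
  apply blk_injective
  change blk (N.1 * (lastRot g).1) = blk ((lastRot g).1 * N.1)
  rw [blk_mul, blk_mul, blk_lastRot, h, fromBlocks_multiply, fromBlocks_multiply]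
  simp [hε]

theorem commute_lastRot_incl (a : Sp g) :
    Sp.incl g (g + 1) g.le_succ a * lastRot g = lastRot g * Sp.incl g (g + 1) g.le_succ a :=
  commute_lastRot_of_blk (blk_incl a) (by simp)

/-- The period matrix `(Z, 1)`. -/
def frame {n : ℕ} (Z : Matrix (Fin n) (Fin n) ℂ) : Matrix (Fin n ⊕ Fin n) (Fin n) ℂ := fromRows Z 1

/-- This homogeneous form of the action needs no inverse and can be split into blocks. -/
theorem frame_mul_eq {n : ℕ} (M : Sp n) (Z : SiegelSpace n) :
    M.1.map (Int.castRingHom ℂ) * frame Z.1 = frame (M • Z).1 * M.den Z.1 := by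
  rw [M.map_eq, frame, frame, fromBlocks_mul_fromRows, fromRows_mul, ← num_eq, Matrix.mul_one,
    Matrix.mul_one, Matrix.one_mul]
  rfl

theorem smul_eq_of_frame {n : ℕ} {M : Sp n} {Z W : SiegelSpace n} {j : Matrix (Fin n) (Fin n) ℂ}
    (h : M.1.map (Int.castRingHom ℂ) * frame Z.1 = frame W.1 * j) : M • Z = W := by
  rw [M.map_eq, frame, frame, fromBlocks_mul_fromRows, fromRows_mul, Matrix.mul_one,
    Matrix.mul_one, Matrix.one_mul, fromRows_ext_iff] at h
  apply Subtype.ext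
  have h1 : M.num Z.1 = W.1 * M.den Z.1 := by rw [Sp.num, h.1, Sp.den, h.2]
  rw [smul_val, h1, Matrix.mul_assoc,
    Matrix.mul_nonsing_inv _ ((Matrix.isUnit_iff_isUnit_det _).1 (M.isUnit_den Z)), Matrix.mul_one]

/-- The embedding of `𝔥_g` in `𝔥_{g+1}`. -/
abbrev inclSucc (Z : SiegelSpace g) : SiegelSpace (g + 1) := SiegelSpace.incl g (g + 1) g.le_succ Z

/-- The matrix `(i)`. -/
def iMat : Matrix (Fin 1) (Fin 1) ℂ := Matrix.of fun _ _ => Complex.I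

theorem frame_incl (Z : SiegelSpace g) :
    (frame (inclSucc Z).1).submatrix (blkEquiv g) finSumFinEquiv =
      fromBlocks (frame Z.1) 0 0 (frame iMat) := by
  rw [show (inclSucc Z).1 = pad (g + 1) Complex.I Z.1 from rfl]
  ext ((i | i) | (i | i)) (j | j) <;>
    simp [frame, blkEquiv, pad, Matrix.one_apply, iMat, Fin.ext_iff] <;> omega

theorem blk_frame (M : Sp (g + 1)) (Z : SiegelSpace g) :
    (M.1.map (Int.castRingHom ℂ) * frame (inclSucc Z).1).submatrix (blkEquiv g) finSumFinEquiv =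
      (blk M.1).map (Int.castRingHom ℂ) * fromBlocks (frame Z.1) 0 0 (frame iMat) := by
  rw [← frame_incl]
  exact (Matrix.submatrix_mul_equiv _ _ (blkEquiv g) (blkEquiv g) finSumFinEquiv).symm

theorem frame_blk (W : SiegelSpace g) (j : Matrix (Fin (g + 1)) (Fin (g + 1)) ℂ) :
    (frame (inclSucc W).1 * j).submatrix (blkEquiv g) finSumFinEquiv =
      fromBlocks (frame W.1) 0 0 (frame iMat) * j.submatrix finSumFinEquiv finSumFinEquiv := by
  rw [← frame_incl]
  exact (Matrix.submatrix_mul_equiv _ _ (blkEquiv g) finSumFinEquiv finSumFinEquiv).symm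

theorem smul_incl_eq_of_blk {M : Sp (g + 1)} {Z W : SiegelSpace g}
    {j : Matrix (Fin g ⊕ Fin 1) (Fin g ⊕ Fin 1) ℂ}
    (h : (blk M.1).map (Int.castRingHom ℂ) * fromBlocks (frame Z.1) 0 0 (frame iMat) =
      fromBlocks (frame W.1) 0 0 (frame iMat) * j) : M • inclSucc Z = inclSucc W := by
  apply smul_eq_of_frame (j := j.submatrix finSumFinEquiv.symm finSumFinEquiv.symm)
  have h1 := blk_frame M Z
  rw [h] at h1
  have h2 := frame_blk W (j.submatrix finSumFinEquiv.symm finSumFinEquiv.symm)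
  rw [Matrix.submatrix_submatrix, Equiv.symm_comp_self, Matrix.submatrix_id_id, ← h1] at h2
  ext a b
  have := congrFun (congrFun h2 ((blkEquiv g).symm a)) (finSumFinEquiv.symm b)
  simpa using this.symm

/-- `J` multiplies the period vector `(i, 1)` of the last factor by `i`, and nothing else is
changed. -/
theorem lastRot_smul_incl (Z : SiegelSpace g) : lastRot g • inclSucc Z = inclSucc Z := by
  apply smul_incl_eq_of_blk (j := fromBlocks 1 0 0 (Matrix.of fun _ _ => Complex.I))
  rw [blk_lastRot, fromBlocks_map, fromBlocks_multiply, fromBlocks_multiply]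
  congr 1
  · simp
  · simp
  · simp
  · ext (i | i) j <;> fin_cases i <;> fin_cases j <;>
      simp [Matrix.J, frame, iMat, Matrix.mul_apply, Fintype.sum_sum_type]

end Blocks

end UniversalModuli
end

noncomputable section
namespace UniversalModuli
open Filter Metric MulAction

/-! ### Products with the elliptic curve with period `i` -/

section Products
variable {g : ℕ}

instance (n : ℕ) : SMul (Sp n) (SiegelSpace n) := SemigroupAction.toSMul

/-- Comparing rows of the period matrix, a fixed point satisfies `W m m ^ 2 = -1` and `W m k * (1 +
i) = 0` for the last index `m` and `k ≠ m`. Positivity selects `W m m = i`, so `W` splits off the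
last factor. -/
theorem exists_inclSucc_eq {W : SiegelSpace (g + 1)} (h : lastRot g • W = W) :
    ∃ Z, inclSucc Z = W := by
  have h0 := frame_mul_eq (lastRot g) W
  rw [h] at h0
  set d := (lastRot g).den W.1
  set m : Fin (g + 1) := Fin.last g with hm
  let F₁ : Matrix (Fin g ⊕ Fin g) (Fin (g + 1)) ℂ := Matrix.of fun x k =>
    frame W.1 (blkEquiv g (Sum.inl x)) k
  let F₂ : Matrix (Fin 1 ⊕ Fin 1) (Fin (g + 1)) ℂ := Matrix.of fun x k =>
    frame W.1 (blkEquiv g (Sum.inr x)) k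
  have hF : (frame W.1).submatrix (blkEquiv g) id = fromRows F₁ F₂ := by
    ext (x | x) k <;> rfl
  have h1 : (blk (lastRot g).1).map (Int.castRingHom ℂ) * fromRows F₁ F₂ = fromRows F₁ F₂ * d := by
    have h2 := congrArg (fun X => X.submatrix (blkEquiv g) id) h0
    rw [← Matrix.submatrix_mul_equiv _ _ (blkEquiv g) (blkEquiv g) id,
      ← Matrix.submatrix_mul_equiv _ _ (blkEquiv g) (Equiv.refl _) id, hF, Equiv.coe_refl, hF,
      Matrix.submatrix_id_id] at h2
    exact h2
  rw [blk_lastRot, fromBlocks_map, fromBlocks_mul_fromRows, fromRows_mul, fromRows_ext_iff] at h1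
  obtain ⟨h2, h3⟩ := h1
  have hm0 : Fin.natAdd g (0 : Fin 1) = m := by ext; simp [hm]
  have hd1 : ∀ (i : Fin g) k, d (Fin.castAdd 1 i) k = (1 : Matrix _ _ ℂ) (Fin.castAdd 1 i) k := by
    intro i k
    have := congrFun (congrFun h2 (Sum.inr i)) k
    simpa [F₁, frame, blkEquiv, Matrix.mul_apply, Matrix.one_apply, eq_comm] using this.symm
  have hd2 : ∀ k, d m k = W.1 m k := by
    intro k
    have := congrFun (congrFun h3 (Sum.inr 0)) k
    simpa [F₂, frame, blkEquiv, Matrix.mul_apply, Matrix.one_apply, Fintype.sum_sum_type, hm0,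
      Matrix.J] using this.symm
  have hd3 : ∀ k, -(1 : Matrix _ _ ℂ) m k = ∑ l, W.1 m l * d l k := by
    intro k
    have := congrFun (congrFun h3 (Sum.inl 0)) k
    rw [← hm0]
    simpa [F₂, frame, blkEquiv, Matrix.mul_apply, Fintype.sum_sum_type, Matrix.J] using this
  have hsum : ∀ k, -(1 : Matrix _ _ ℂ) m k =
      ∑ i : Fin g, W.1 m (Fin.castAdd 1 i) * (1 : Matrix _ _ ℂ) (Fin.castAdd 1 i) k +
        W.1 m m * W.1 m k := by
    intro k
    rw [hd3, Fin.sum_univ_add]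
    simp only [hd1, Finset.univ_unique, Fin.default_eq_zero, Finset.sum_singleton, hm0, hd2]
  have hne : ∀ i : Fin g, Fin.castAdd 1 i ≠ m := fun i hi => by
    have := congrArg Fin.val hi; simp [hm] at this; omega
  have hmm : W.1 m m = Complex.I := by
    have h4 := hsum m
    simp only [Matrix.one_apply_eq, Matrix.one_apply_ne (hne _), mul_zero,
      Finset.sum_const_zero, zero_add] at h4
    have h5 : (W.1 m m - Complex.I) * (W.1 m m + Complex.I) = 0 := by
      ring_nf
      rw [Complex.I_sq, pow_two, ← h4]; ring
    rcases mul_eq_zero.1 h5 with h6 | h6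
    · exact sub_eq_zero.1 h6
    · exfalso
      have h7 := W.2.2.diag_pos (i := m)
      rw [Matrix.map_apply, eq_neg_of_add_eq_zero_left h6] at h7
      simp at h7
      linarith
  have hmk : ∀ i : Fin g, W.1 m (Fin.castAdd 1 i) = 0 := by
    intro k
    have h4 := hsum (Fin.castAdd 1 k)
    rw [Finset.sum_eq_single k (fun i _ hi => by
      rw [Matrix.one_apply_ne, mul_zero]
      exact fun he => hi (Fin.castAdd_injective _ _ he)) (by simp), Matrix.one_apply_eq,
      Matrix.one_apply_ne (hne k).symm, hmm, neg_zero, mul_one] at h4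
    have h5 : W.1 m (Fin.castAdd 1 k) * (1 + Complex.I) = 0 := by rw [h4]; ring
    refine (mul_eq_zero.1 h5).resolve_right fun h6 => ?_
    have := congrArg Complex.re h6
    simp at this
  refine ⟨⟨W.1.submatrix (Fin.castAdd 1) (Fin.castAdd 1), ?_, ?_⟩, Subtype.ext ?_⟩
  · rw [Matrix.transpose_submatrix, W.2.1]
  · exact W.2.2.submatrix (Fin.castAdd_injective g 1)
  · change pad (g + 1) Complex.I _ = W.1
    have hsymm : ∀ a b, W.1 a b = W.1 b a := fun a b => congrFun (congrFun W.2.1 b) a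
    ext a b
    refine Fin.addCases (fun i => ?_) (fun i => ?_) a <;>
      refine Fin.addCases (fun j => ?_) (fun j => ?_) b
    · simp [pad]
    · rw [Subsingleton.elim j 0, hm0, hsymm, hmk]
      simp [pad, hm ▸ hne i, hm]
    · rw [Subsingleton.elim i 0, hm0, hmk]
      simp [pad, hm ▸ (hne j).symm, hm]
    · rw [Subsingleton.elim i 0, Subsingleton.elim j 0, hm0, hmm]
      simp [pad, hm]

theorem imForm_incl (W : SiegelSpace g) (v : Fin (g + 1) → ℂ) :
    imForm (inclSucc W).1 v = imForm W.1 (fun i => v (Fin.castAdd 1 i)) +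
      Complex.normSq (v (Fin.natAdd g 0)) := by
  have hne : ∀ (i : Fin g) (k : Fin 1), Fin.castAdd 1 i ≠ Fin.natAdd g k := fun i k hi => by
    have := congrArg Fin.val hi; simp at this; omega
  rw [show (inclSucc W).1 = pad (g + 1) Complex.I W.1 from rfl]
  simp only [imForm, dotProduct, Matrix.mulVec, Fin.sum_univ_add, Matrix.map_apply, Pi.star_apply]
  simp [pad, hne, (hne _ _).symm, Complex.normSq_apply]

/-- The blocks of an element that maps a product to a product. -/
theorem exists_blocks {γ : Sp (g + 1)} {Z W : SiegelSpace g} (h : γ • inclSucc Z = inclSucc W) :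
    ∃ α β δ ε, ∃ j₁₁ : Matrix (Fin g) (Fin g) ℂ, ∃ j₁₂ : Matrix (Fin g) (Fin 1) ℂ,
      ∃ j₂₁ : Matrix (Fin 1) (Fin g) ℂ, ∃ j₂₂ : Matrix (Fin 1) (Fin 1) ℂ, blk γ.1 = fromBlocks α β δ ε ∧
      α.map (Int.castRingHom ℂ) * frame Z.1 = frame W.1 * j₁₁ ∧
      β.map (Int.castRingHom ℂ) * frame iMat = frame W.1 * j₁₂ ∧
      δ.map (Int.castRingHom ℂ) * frame Z.1 = frame iMat * j₂₁ ∧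
      ε.map (Int.castRingHom ℂ) * frame iMat = frame iMat * j₂₂ ∧
      imForm W.1 (fun i => j₁₂ i 0) + Complex.normSq (j₂₂ 0 0) = 1 := by
  have h0 := frame_mul_eq γ (inclSucc Z)
  rw [h] at h0
  have h1 := congrArg (fun X => X.submatrix (blkEquiv g) finSumFinEquiv) h0
  simp only [blk_frame, frame_blk] at h1
  -- The last basis vector has length one for the form of a product, so the last column of the
  -- denominator has length one for the form of the image.
  have h5 := imForm_den γ (inclSucc Z) (Pi.single (Fin.natAdd g 0) 1)
  rw [h, imForm_incl, imForm_incl] at h5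
  set j := (γ.den (inclSucc Z).1).submatrix (finSumFinEquiv (m := g) (n := 1))
    (finSumFinEquiv (m := g) (n := 1)) with hj
  rw [← fromBlocks_toBlocks (blk γ.1), ← fromBlocks_toBlocks j, fromBlocks_map,
    fromBlocks_multiply, fromBlocks_multiply] at h1
  simp only [Matrix.mul_zero, Matrix.zero_mul, add_zero, zero_add] at h1
  obtain ⟨e1, e2, e3, e4⟩ := fromBlocks_inj.1 h1
  refine ⟨_, _, _, _, _, _, _, _, (fromBlocks_toBlocks _).symm, e1, e2, e3, e4, ?_⟩
  have h6 : (fun i : Fin g => (Pi.single (Fin.natAdd g 0) 1 : Fin (g + 1) → ℂ) (Fin.castAdd 1 i)) = 0 := by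
    funext i
    have : Fin.castAdd 1 i ≠ Fin.natAdd g 0 := fun hi => by
      have := congrArg Fin.val hi; simp at this; omega
    simp [this]
  rw [h6] at h5
  have h7 : imForm Z.1 0 = 0 := by simp [imForm]
  rw [h7, Pi.single_eq_same, map_one, zero_add] at h5
  rw [← h5]
  congr 2
  · funext i
    simp [hj, Matrix.toBlocks₁₂]
  · simp [hj, Matrix.toBlocks₂₂]

/-- An element that maps a product to a product either respects the last factor or maps it into
the complementary one. -/
theorem exists_blocks_dichotomy {γ : Sp (g + 1)} {Z W : SiegelSpace g}
    (h : γ • inclSucc Z = inclSucc W) :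
    ∃ α β δ ε, blk γ.1 = fromBlocks α β δ ε ∧
      (ε = 0 ∨ (β = 0 ∧ δ = 0 ∧ ε * Matrix.J (Fin 1) ℤ = Matrix.J (Fin 1) ℤ * ε)) := by
  obtain ⟨α, β, δ, ε, j₁₁, j₁₂, j₂₁, j₂₂, hb, -, h12, -, h22, hn⟩ := exists_blocks h
  refine ⟨α, β, δ, ε, hb, ?_⟩
  have hr : ∀ a b : ℤ, (a : ℂ) * Complex.I + b = 0 → a = 0 ∧ b = 0 := fun a b hab => by
    have h1 := congrArg Complex.im hab
    have h2 := congrArg Complex.re hab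
    simp at h1 h2
    exact ⟨h1, h2⟩
  have hb1 : (ε (Sum.inr 0) (Sum.inl 0) : ℂ) * Complex.I + ε (Sum.inr 0) (Sum.inr 0) = j₂₂ 0 0 := by
    have := congrFun (congrFun h22 (Sum.inr 0)) 0
    simpa [frame, iMat, Matrix.mul_apply, Fintype.sum_sum_type] using this
  have hb2 : (ε (Sum.inl 0) (Sum.inl 0) : ℂ) * Complex.I + ε (Sum.inl 0) (Sum.inr 0) =
      Complex.I * j₂₂ 0 0 := by
    have := congrFun (congrFun h22 (Sum.inl 0)) 0
    simpa [frame, iMat, Matrix.mul_apply, Fintype.sum_sum_type] using this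
  rw [← hb1] at hb2 hn
  -- The block `ε` maps `(i, 1)` to a multiple of itself, so it is multiplication by a Gaussian
  -- integer.
  have hb3 : ε (Sum.inl 0) (Sum.inl 0) = ε (Sum.inr 0) (Sum.inr 0) := by
    have := congrArg Complex.im hb2
    simp at this
    exact this
  have hb4 : ε (Sum.inl 0) (Sum.inr 0) = -ε (Sum.inr 0) (Sum.inl 0) := by
    have := congrArg Complex.re hb2
    simp at this
    exact_mod_cast this
  have hns : Complex.normSq ((ε (Sum.inr 0) (Sum.inl 0) : ℂ) * Complex.I + ε (Sum.inr 0) (Sum.inr 0))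
      = ((ε (Sum.inr 0) (Sum.inl 0) ^ 2 + ε (Sum.inr 0) (Sum.inr 0) ^ 2 : ℤ) : ℝ) := by
    rw [Complex.normSq_apply]
    simp
    ring
  rw [hns] at hn
  -- The square norm of this Gaussian integer is an integer, at most one. If it is zero then `ε =
  -- 0`; otherwise it uses up the length one and forces `j₁₂ = 0`, hence `β = 0`.
  by_cases h0 : ε (Sum.inr 0) (Sum.inl 0) ^ 2 + ε (Sum.inr 0) (Sum.inr 0) ^ 2 = 0
  · left
    have h1 : ε (Sum.inr 0) (Sum.inl 0) = 0 := by nlinarith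
    have h2 : ε (Sum.inr 0) (Sum.inr 0) = 0 := by nlinarith
    ext (a | a) (b | b) <;> rw [Subsingleton.elim a 0, Subsingleton.elim b 0] <;> simp [*]
  · right
    have h1 : 1 ≤ ε (Sum.inr 0) (Sum.inl 0) ^ 2 + ε (Sum.inr 0) (Sum.inr 0) ^ 2 := by
      have : 0 ≤ ε (Sum.inr 0) (Sum.inl 0) ^ 2 + ε (Sum.inr 0) (Sum.inr 0) ^ 2 := by positivity
      omega
    have h2 : (1 : ℝ) ≤ ((ε (Sum.inr 0) (Sum.inl 0) ^ 2 + ε (Sum.inr 0) (Sum.inr 0) ^ 2 : ℤ) : ℝ) := by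
      exact_mod_cast h1
    have h3 : j₁₂ = 0 := by
      by_contra hne
      have : (fun i => j₁₂ i 0) ≠ 0 := fun h => hne (by
        ext i k
        rw [Subsingleton.elim k 0]
        exact congrFun h i)
      have := imForm_pos W this
      linarith
    have hβ : β = 0 := by
      rw [h3, Matrix.mul_zero] at h12
      ext x k
      have h4 : (β x (Sum.inl 0) : ℂ) * Complex.I + β x (Sum.inr 0) = 0 := by
        have := congrFun (congrFun h12 x) 0
        simpa [frame, iMat, Matrix.mul_apply, Fintype.sum_sum_type] using this
      obtain ⟨h5, h6⟩ := hr _ _ h4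
      rcases k with k | k <;> rw [Subsingleton.elim k 0] <;> simp [h5, h6]
    refine ⟨hβ, ?_, ?_⟩
    · have h4 := mem_symplectic_iff_blk.1 γ.2
      rw [hb, hβ, fromBlocks_transpose, fromBlocks_multiply, fromBlocks_multiply] at h4
      obtain ⟨h5, h6, -, -⟩ := fromBlocks_inj.1 h4
      simp only [Matrix.transpose_zero, Matrix.mul_zero, Matrix.zero_mul, add_zero] at h5 h6
      -- With `β = 0` the block `α` is symplectic, hence invertible, so the relation `α * J * δᵀ =
      -- 0` gives `δ = 0`.
      have h7 := SymplecticGroup.mem_iff'.1 (SymplecticGroup.mem_iff.2 h5)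
      have h8 := congrArg (fun X => Matrix.J (Fin g) ℤ * (αᵀ * (Matrix.J (Fin g) ℤ * X))) h6
      simp only [Matrix.mul_zero] at h8
      have h9 : Matrix.J (Fin g) ℤ * (αᵀ * (Matrix.J (Fin g) ℤ * (α * Matrix.J (Fin g) ℤ * δᵀ))) =
          Matrix.J (Fin g) ℤ * (αᵀ * Matrix.J (Fin g) ℤ * α) * Matrix.J (Fin g) ℤ * δᵀ := by
        simp only [Matrix.mul_assoc]
      rw [h9, h7, Matrix.J_squared, Matrix.neg_mul, Matrix.neg_mul, Matrix.one_mul] at h8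
      have h10 := congrArg (fun X => Matrix.J (Fin g) ℤ * X) h8
      simp only [Matrix.mul_neg, Matrix.mul_zero, ← Matrix.mul_assoc, Matrix.J_squared,
        Matrix.neg_mul, neg_neg, Matrix.one_mul] at h10
      simpa using congrArg Matrix.transpose h10
    · ext (a | a) (b | b) <;> rw [Subsingleton.elim a 0, Subsingleton.elim b 0] <;>
        simp [Matrix.mul_apply, Fintype.sum_sum_type, Matrix.J, hb3, hb4]

/-- Two products that are equivalent have equivalent first factors. -/
theorem exists_comp {γ : Sp (g + 1)} {Z W : SiegelSpace g} (h : γ • inclSucc Z = inclSucc W) :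
    ∃ c : Sp g, ∀ Z' W' : SiegelSpace g, γ • inclSucc Z' = inclSucc W' → c • Z' = W' := by
  obtain ⟨α, β, δ, ε, hb, hdich⟩ := exists_blocks_dichotomy h
  have h4 := mem_symplectic_iff_blk.1 γ.2
  rw [hb, fromBlocks_transpose, fromBlocks_multiply, fromBlocks_multiply] at h4
  simp only [Matrix.mul_zero, add_zero, zero_add] at h4
  obtain ⟨h5, h6, h7, h8⟩ := fromBlocks_inj.1 h4
  -- If `γ` sends the last factor into the complement, the required map feeds the component in the
  -- last factor, given by `δ`, back through `β`. If `γ` respects the last factor, the second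
  -- summand is zero.
  have hmem : α + β * δ ∈ symplecticGroup (Fin g) ℤ := by
    rw [SymplecticGroup.mem_iff]
    rcases hdich with rfl | ⟨rfl, rfl, -⟩
    · simp only [Matrix.transpose_zero, Matrix.mul_zero, Matrix.zero_mul, add_zero] at h6 h7 h8
      calc (α + β * δ) * Matrix.J (Fin g) ℤ * (α + β * δ)ᵀ
          = α * Matrix.J (Fin g) ℤ * αᵀ + (α * Matrix.J (Fin g) ℤ * δᵀ) * βᵀ +
            β * (δ * Matrix.J (Fin g) ℤ * αᵀ) +
            β * (δ * Matrix.J (Fin g) ℤ * δᵀ) * βᵀ := by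
              rw [Matrix.transpose_add, Matrix.transpose_mul]
              simp only [Matrix.add_mul, Matrix.mul_add, Matrix.mul_assoc]
              abel
        _ = α * Matrix.J (Fin g) ℤ * αᵀ + β * Matrix.J (Fin 1) ℤ * βᵀ := by
              rw [h6, h7, h8, Matrix.zero_mul, Matrix.mul_zero, add_zero, add_zero]
        _ = Matrix.J (Fin g) ℤ := h5
    · simpa using h5
  refine ⟨⟨α + β * δ, hmem⟩, fun Z' W' h' => ?_⟩
  obtain ⟨α', β', δ', ε', j₁₁, j₁₂, j₂₁, j₂₂, hb', h11, h12, h21, -, -⟩ := exists_blocks h'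
  rw [hb] at hb'
  obtain ⟨rfl, rfl, rfl, rfl⟩ := fromBlocks_inj.1 hb'
  apply smul_eq_of_frame (j := j₁₁ + j₁₂ * j₂₁)
  have e : (α + β * δ).map (Int.castRingHom ℂ) = α.map (Int.castRingHom ℂ) +
      β.map (Int.castRingHom ℂ) * δ.map (Int.castRingHom ℂ) := by
    rw [Matrix.map_add _ (map_add _), Matrix.map_mul]
  rw [show ((⟨α + β * δ, hmem⟩ : Sp g).1).map (Int.castRingHom ℂ) = _ from e, Matrix.add_mul,
    Matrix.mul_assoc, h21, ← Matrix.mul_assoc, h12, h11, Matrix.mul_add,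
    Matrix.mul_assoc]

theorem AV.incl_injective (g : ℕ) : Function.Injective (AV.incl g) := by
  intro p q h
  obtain ⟨Z, rfl⟩ := orbitMk_surjective p
  obtain ⟨W, rfl⟩ := orbitMk_surjective q
  obtain ⟨γ, hγ⟩ := orbitMk_eq_iff.1 (show orbitMk (Sp (g + 1)) (inclSucc Z) =
    orbitMk (Sp (g + 1)) (inclSucc W) from h)
  obtain ⟨c, hc⟩ := exists_comp hγ
  exact orbitMk_eq_iff.2 ⟨c, hc W Z hγ⟩

/-- The conjugates of the rotation of the last factor by elements that map products to products. -/
theorem conj_lastRot {γ : Sp (g + 1)} {Z W : SiegelSpace g} (h : γ • inclSucc Z = inclSucc W) :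
    γ * lastRot g * γ⁻¹ = lastRot g ∨
      ∃ a : Sp g, γ * lastRot g * γ⁻¹ = Sp.incl g (g + 1) g.le_succ a := by
  obtain ⟨α, β, δ, ε, hb, hdich⟩ := exists_blocks_dichotomy h
  obtain ⟨α', β', δ', ε', hb', hdich'⟩ :=
    exists_blocks_dichotomy (eq_inv_smul_iff.2 h).symm
  have hcomm : ∀ {N : Sp (g + 1)}, N * lastRot g = lastRot g * N → N * lastRot g * N⁻¹ = lastRot g :=
    fun h => by rw [h, mul_inv_cancel_right]
  rcases hdich with rfl | ⟨rfl, rfl, hε⟩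
  · rcases hdich' with rfl | ⟨rfl, rfl, hε⟩
    · right
      -- With `ε = ε' = 0` the relation `γ * γ⁻¹ = 1` makes the conjugate block diagonal with last
      -- block 1, and `α * α' = 1 - β * δ'` gives the first block.
      refine exists_incl_eq_of_blk (x := 1 + β * (Matrix.J (Fin 1) ℤ - 1) * δ') ?_
      have h1 : blk γ.1 * blk (γ⁻¹).1 = 1 := by
        rw [← blk_mul, ← blk_one]
        congr 1
        exact congrArg Subtype.val (mul_inv_cancel γ)
      rw [hb, hb', fromBlocks_multiply, ← fromBlocks_one] at h1
      obtain ⟨h2, h3, h4, h5⟩ := fromBlocks_inj.1 h1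
      change blk (γ.1 * (lastRot g).1 * (γ⁻¹).1) = _
      rw [blk_mul, blk_mul, blk_lastRot, hb, hb', fromBlocks_multiply, fromBlocks_multiply]
      simp only [Matrix.mul_zero, Matrix.zero_mul, Matrix.mul_one, add_zero, zero_add] at *
      rw [h3, h4, h5, ← h2]
      congr 1
      rw [Matrix.mul_sub, Matrix.sub_mul, Matrix.mul_one]
      abel
    · left
      have h1 := hcomm (commute_lastRot_of_blk hb' hε)
      rw [inv_inv] at h1
      have h2 := congrArg (fun x => γ * x * γ⁻¹) h1
      rw [← h2]
      group
  · exact Or.inl (hcomm (commute_lastRot_of_blk hb hε))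

theorem lastRot_commute_conj {γ : Sp (g + 1)} {Z W : SiegelSpace g}
    (h : γ • inclSucc Z = inclSucc W) :
    (γ * lastRot g * γ⁻¹) * lastRot g = lastRot g * (γ * lastRot g * γ⁻¹) := by
  rcases conj_lastRot h with h1 | ⟨a, h1⟩
  · rw [h1]
  · rw [h1, commute_lastRot_incl]

/-- Isotropy groups of products grow with those of the first factors. -/
theorem stabilizer_incl_le {Z W : SiegelSpace g} (h : stabilizer (Sp g) Z ≤ stabilizer (Sp g) W) :
    stabilizer (Sp (g + 1)) (inclSucc Z) ≤ stabilizer (Sp (g + 1)) (inclSucc W) := by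
  intro γ hγ
  rw [mem_stabilizer_iff] at hγ ⊢
  -- The conjugate is either the rotation itself or comes from an element that fixes `Z`, hence `W`.
  -- So the rotation fixes the translate of `inclSucc W` by `γ⁻¹`, which is therefore again a
  -- product.
  have h1 : (γ * lastRot g * γ⁻¹) • inclSucc W = inclSucc W := by
    rcases conj_lastRot hγ with h1 | ⟨a, h1⟩
    · rw [h1, lastRot_smul_incl]
    · have h2 : Sp.incl g (g + 1) g.le_succ a • inclSucc Z = inclSucc Z := by
        rw [← h1, mul_smul, mul_smul, inv_smul_eq_iff.2 hγ.symm, lastRot_smul_incl, hγ]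
      rw [← incl_smul] at h2
      have h3 : a ∈ stabilizer (Sp g) W :=
        h (mem_stabilizer_iff.2 ((SiegelSpace.incl g (g + 1) g.le_succ).injective h2))
      rw [h1, ← incl_smul, mem_stabilizer_iff.1 h3]
  obtain ⟨W', hW'⟩ := exists_inclSucc_eq (W := γ⁻¹ • inclSucc W) (by
    rw [eq_inv_smul_iff, ← mul_smul, ← mul_smul, h1])
  have h2 : γ • inclSucc W' = inclSucc W := by rw [hW', smul_inv_smul]
  -- The element `c` that `γ` induces on first factors fixes `Z`, hence `W`; since it also maps `W'`
  -- to `W`, the two agree.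
  obtain ⟨c, hc⟩ := exists_comp hγ
  have h3 : c • W = W := mem_stabilizer_iff.1 (h (mem_stabilizer_iff.2 (hc Z Z hγ)))
  have h4 : W' = W := smul_left_cancel c ((hc W' W h2).trans h3.symm)
  rwa [h4] at h2

/-- Membership in `𝒜_g` becomes a condition on the conjugacy class of the isotropy group. -/
theorem orbitMk_mem_range_incl {W : SiegelSpace (g + 1)} :
    orbitMk (Sp (g + 1)) W ∈ Set.range (AV.incl g) ↔
      ∃ γ : Sp (g + 1), γ * lastRot g * γ⁻¹ ∈ stabilizer (Sp (g + 1)) W := by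
  constructor
  · rintro ⟨p, hp⟩
    obtain ⟨Z, rfl⟩ := orbitMk_surjective p
    obtain ⟨γ, hγ⟩ := orbitMk_eq_iff.1 (show orbitMk (Sp (g + 1)) W =
      orbitMk (Sp (g + 1)) (inclSucc Z) from hp.symm)
    refine ⟨γ, mem_stabilizer_iff.2 ?_⟩
    rw [← hγ, mul_smul, mul_smul, inv_smul_smul, lastRot_smul_incl]
  · rintro ⟨γ, hγ⟩
    rw [mem_stabilizer_iff, mul_smul, mul_smul] at hγ
    obtain ⟨Z, hZ⟩ := exists_inclSucc_eq (eq_inv_smul_iff.2 hγ)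
    refine ⟨orbitMk (Sp g) Z, ?_⟩
    change orbitMk (Sp (g + 1)) (inclSucc Z) = _
    rw [hZ, orbitMk_smul]

end Products

end UniversalModuli
end

noncomputable section
namespace UniversalModuli
open Filter Metric MulAction

/-! ### Extension of holomorphic functions from a union of linear subspaces -/

section Extension
variable {V : Type} [NormedAddCommGroup V] [NormedSpace ℂ V]

/-- The projection to the fixed space of an endomorphism of order dividing four. -/
def proj4 (A : Module.End ℂ V) : Module.End ℂ V := (4 : ℂ)⁻¹ • (1 + A + A ^ 2 + A ^ 3)

theorem proj4_of_fixed {A : Module.End ℂ V} {v : V} (h : A v = v) : proj4 A v = v := by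
  have h4 : (1 + A + A ^ 2 + A ^ 3 : Module.End ℂ V) v = (4 : ℂ) • v := by
    simp only [LinearMap.add_apply, Module.End.one_apply, pow_succ, pow_zero,
      Module.End.mul_apply, h]
    module
  rw [proj4, LinearMap.smul_apply, h4, smul_smul, inv_mul_cancel₀ (by norm_num), one_smul]

theorem apply_proj4 {A : Module.End ℂ V} (hA : A ^ 4 = 1) (v : V) : A (proj4 A v) = proj4 A v := by
  have h : A * (1 + A + A ^ 2 + A ^ 3) = 1 + A + A ^ 2 + A ^ 3 := by
    have : A * (1 + A + A ^ 2 + A ^ 3) = A + A ^ 2 + A ^ 3 + A ^ 4 := by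
      noncomm_ring
    rw [this, hA]
    abel
  rw [proj4, LinearMap.smul_apply, map_smul, ← Module.End.mul_apply, h]

theorem proj4_commute {A B : Module.End ℂ V} (h : Commute A B) : Commute (proj4 A) (proj4 B) := by
  have h1 : ∀ {C D : Module.End ℂ V}, Commute C D → Commute (proj4 C) D := fun hC =>
    ((((Commute.one_left _).add_left hC).add_left (hC.pow_left 2)).add_left (hC.pow_left 3)).smul_left _
  exact h1 (h1 h.symm).symm

/-- Inclusion-exclusion: `H` is corrected by `(k - H) ∘ P i`. Since `P i` preserves the fixed space
of each `P j`, the correction vanishes near 0 on the earlier fixed spaces, where both functions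
equal `φ`. -/
theorem exists_extension_of_commute [FiniteDimensional ℂ V] {ι : Type} (P : ι → Module.End ℂ V)
    (hP : ∀ i v, P i (P i v) = P i v) (hc : ∀ i j, Commute (P i) (P j)) (φ : V → ℂ)
    (h : ∀ i, ∃ h : V → ℂ, AnalyticAt ℂ h 0 ∧ ∀ᶠ v in 𝓝 0, P i v = v → h v = φ v)
    (s : Finset ι) :
    ∃ H : V → ℂ, AnalyticAt ℂ H 0 ∧ ∀ᶠ v in 𝓝 0, ∀ i ∈ s, P i v = v → H v = φ v := by
  classical
  induction s using Finset.induction_on with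
  | empty => exact ⟨0, analyticAt_const, by simp⟩
  | insert i s _ ih =>
    obtain ⟨H, hH, hHφ⟩ := ih
    obtain ⟨k, hk, hkφ⟩ := h i
    have hlin : AnalyticAt ℂ (P i) 0 := (LinearMap.toContinuousLinearMap (P i)).analyticAt 0
    have hcont : Tendsto (P i) (𝓝 0) (𝓝 0) := by
      have := hlin.continuousAt
      rwa [ContinuousAt, map_zero] at this
    refine ⟨fun v => H v + (k (P i v) - H (P i v)), ?_, ?_⟩
    · refine hH.add (AnalyticAt.sub ?_ ?_) <;>
      · refine AnalyticAt.comp ?_ hlin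
        rwa [map_zero]
    · filter_upwards [hHφ, hkφ, hcont.eventually hHφ, hcont.eventually hkφ] with v h1 h2 h3 h4
      intro j hj hjv
      rcases Finset.mem_insert.1 hj with rfl | hj
      · rw [hjv, h2 hjv]; ring
      · have h5 : P j (P i v) = P i v := by
          have := LinearMap.congr_fun (hc j i) v
          simp only [Module.End.mul_apply] at this
          rw [this, hjv]
        rw [h3 j hj h5, h4 (hP i v), h1 j hj hjv]
        ring

end Extension

/-! ### The embeddings of the moduli spaces -/

section ClosedEmbedding
variable {g : ℕ}

theorem AV.incl_mk (Z : SiegelSpace g) :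
    AV.incl g (orbitMk (Sp g) Z) = orbitMk (Sp (g + 1)) (inclSucc Z) := rfl

theorem analyticEntriesAt_pad (x : Fin g → Fin g → ℂ) :
    AnalyticEntriesAt (fun y => pad (g + 1) Complex.I (Matrix.of y)) x := by
  intro i j
  simp only [pad, Matrix.of_apply]
  by_cases h : (i : ℕ) < g ∧ (j : ℕ) < g
  · simp only [h]
    exact AnalyticEntriesAt.of x _ _
  · simp only [h, dite_false]
    exact analyticAt_const

theorem continuous_inclSucc : Continuous (inclSucc (g := g)) :=
  continuous_iff_continuousAt.2 fun Z =>
    SiegelSpace.continuousAt_of_analytic (analyticEntriesAt_pad Z.1) fun _ => rfl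

/-- The upper left block of a period matrix. -/
def topBlock (W : SiegelSpace (g + 1)) : SiegelSpace g :=
  ⟨W.1.submatrix (Fin.castAdd 1) (Fin.castAdd 1), by rw [Matrix.transpose_submatrix, W.2.1],
    W.2.2.submatrix (Fin.castAdd_injective g 1)⟩

theorem topBlock_inclSucc (Z : SiegelSpace g) : topBlock (inclSucc Z) = Z := by
  apply Subtype.ext
  ext i j
  change pad (g + 1) Complex.I Z.1 (Fin.castAdd 1 i) (Fin.castAdd 1 j) = Z.1 i j
  simp [pad]

theorem analyticEntriesAt_topBlock (x : Fin (g + 1) → Fin (g + 1) → ℂ) :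
    AnalyticEntriesAt (fun y => (Matrix.of y).submatrix (Fin.castAdd 1 : Fin g → Fin (g + 1))
      (Fin.castAdd 1)) x := fun _ _ => AnalyticEntriesAt.of x _ _

theorem continuous_topBlock : Continuous (topBlock (g := g)) :=
  continuous_iff_continuousAt.2 fun Z =>
    SiegelSpace.continuousAt_of_analytic (analyticEntriesAt_topBlock Z.1) fun _ => rfl

theorem isClosedEmbedding_inclSucc : IsClosedEmbedding (inclSucc (g := g)) := by
  refine ⟨IsEmbedding.of_leftInverse topBlock_inclSucc continuous_topBlock continuous_inclSucc, ?_⟩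
  have : Set.range (inclSucc (g := g)) = {W | lastRot g • W = W} := by
    ext W
    exact ⟨by rintro ⟨Z, rfl⟩; exact lastRot_smul_incl Z, fun h => exists_inclSucc_eq h⟩
  rw [this]
  exact isClosed_eq (continuous_const_smul _) continuous_id

theorem AV.continuous_incl (g : ℕ) : Continuous (AV.incl g) :=
  (continuous_orbitMk.comp continuous_inclSucc).quotient_lift _

/-- The preimage of the image of `C` is a union of closed translates `F γ`. Near `W` finitely many
suffice: a translate matters only through the conjugate of `lastRot` by `γ`, which lies in the
finite stabilizer of `W`. -/
theorem AV.isClosedMap_incl (g : ℕ) : IsClosedMap (AV.incl g) := by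
  intro C hC
  rw [← isOpenQuotientMap_orbitMk.isQuotientMap.isClosed_preimage]
  refine isClosed_of_closure_subset fun W hW => ?_
  obtain ⟨c⟩ := nonempty_linearChart W
  let F : Sp (g + 1) → Set (SiegelSpace (g + 1)) := fun γ =>
    (γ • ·) '' (inclSucc '' (orbitMk (Sp g) ⁻¹' C))
  have hFS : ∀ γ, F γ ⊆ orbitMk (Sp (g + 1)) ⁻¹' (AV.incl g '' C) := by
    rintro γ _ ⟨_, ⟨Z, hZ, rfl⟩, rfl⟩
    exact ⟨_, hZ, (orbitMk_smul γ (inclSucc Z)).symm⟩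
  have hFc : ∀ γ, IsClosed (F γ) := fun γ =>
    (Homeomorph.smul γ).isClosedMap _
      (isClosedEmbedding_inclSucc.isClosedMap _ (hC.preimage continuous_orbitMk))
  let K : Set (Sp (g + 1)) := {k | k ∈ stabilizer (Sp (g + 1)) W ∧ ∃ γ, γ * lastRot g * γ⁻¹ = k}
  have hK : K.Finite := (ProperlyDiscontinuousSMul.finite_stabilizer W).subset
    fun k hk => hk.1
  choose! r hr using fun (k : Sp (g + 1)) (hk : k ∈ K) => hk.2
  have hsub : orbitMk (Sp (g + 1)) ⁻¹' (AV.incl g '' C) ∩ c.e.source ⊆ ⋃ k ∈ K, F (r k) := by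
    rintro y ⟨⟨p, hp, hpy⟩, hy⟩
    obtain ⟨Z, rfl⟩ := orbitMk_surjective p
    rw [AV.incl_mk] at hpy
    obtain ⟨γ, hγ⟩ := orbitMk_eq_iff.1 hpy.symm
    have hfix : (γ * lastRot g * γ⁻¹) • y = y := by
      rw [← hγ, mul_smul, mul_smul, inv_smul_smul, lastRot_smul_incl]
    have hmem : γ * lastRot g * γ⁻¹ ∈ K := ⟨c.stabilizer_le hy hfix, γ, rfl⟩
    refine Set.mem_biUnion hmem ?_
    have h1 := hr _ hmem
    set ρ := r (γ * lastRot g * γ⁻¹)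
    obtain ⟨Z', hZ'⟩ := exists_inclSucc_eq (W := ρ⁻¹ • y) (by
      rw [eq_inv_smul_iff, ← mul_smul, ← mul_smul, h1, hfix])
    refine ⟨inclSucc Z', ⟨Z', ?_, rfl⟩, ?_⟩
    -- Replacing `γ` by the chosen `ρ` with the same conjugate changes the first factor only within
    -- its orbit, by injectivity of `AV.incl`.
    · have : orbitMk (Sp g) Z' = orbitMk (Sp g) Z := by
        apply AV.incl_injective
        rw [AV.incl_mk, AV.incl_mk, hZ', orbitMk_smul, hpy]
      rw [Set.mem_preimage, this]
      exact hp
    · change ρ • inclSucc Z' = y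
      rw [hZ', smul_inv_smul]
  have hcl : IsClosed (⋃ k ∈ K, F (r k)) := hK.isClosed_biUnion fun k _ => hFc _
  have h2 : W ∈ ⋃ k ∈ K, F (r k) := by
    refine hcl.closure_subset_iff.2 hsub ?_
    rw [Set.inter_comm]
    exact (c.e.open_source.inter_closure) ⟨c.mem_source, hW⟩
  obtain ⟨k, -, hk⟩ := Set.mem_iUnion₂.1 h2
  exact hFS _ hk

theorem AV.isClosedEmbedding_incl (g : ℕ) : IsClosedEmbedding (AV.incl g) :=
  .of_continuous_injective_isClosedMap (AV.continuous_incl g) (AV.incl_injective g)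
    (AV.isClosedMap_incl g)

theorem AV.holAt_iff {f : AV g → ℂ} {Z : SiegelSpace g} :
    (AV.hol g).HolAt f (orbitMk (Sp g) Z) ↔
      (SiegelSpace.hol g).HolAt (fun W => f (orbitMk (Sp g) W)) Z :=
  orbitSheaf_holAt_iff actsOn_siegel f Z

theorem AV.holAt_comp_incl {F : AV (g + 1) → ℂ} {p : AV g}
    (hF : (AV.hol (g + 1)).HolAt F (AV.incl g p)) : (AV.hol g).HolAt (F ∘ AV.incl g) p := by
  obtain ⟨Z, rfl⟩ := orbitMk_surjective p
  rw [AV.incl_mk, AV.holAt_iff] at hF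
  rw [AV.holAt_iff]
  exact SiegelSpace.holAt_comp (φ := inclSucc) (analyticEntriesAt_pad Z.1) (fun _ => rfl) hF

/-- In a linear chart at `inclSucc Z` the image of `𝔥_g` and its translates by the stabilizer are
fixed spaces of commuting maps of order dividing four. On each of them `f` has an analytic
extension, obtained by restricting to the upper left block. These are combined by
`exists_extension_of_commute` and averaged over the stabilizer. -/
theorem AV.exists_extension {f : AV g → ℂ} {p : AV g} (hf : (AV.hol g).HolAt f p) :
    ∃ F, (AV.hol (g + 1)).HolAt F (AV.incl g p) ∧ f =ᶠ[𝓝 p] F ∘ AV.incl g := by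
  obtain ⟨Z, rfl⟩ := orbitMk_surjective p
  rw [AV.holAt_iff] at hf
  have : Nonempty (AV g) := ⟨orbitMk (Sp g) Z⟩
  obtain ⟨c⟩ := nonempty_linearChart (inclSucc Z)
  have := Fintype.ofFinite (stabilizer (Sp (g + 1)) (inclSucc Z))
  set G := stabilizer (Sp (g + 1)) (inclSucc Z)
  have hf' : (SiegelSpace.hol (g + 1)).HolAt
      (fun W => f (orbitMk (Sp g) (topBlock W))) (inclSucc Z) :=
    SiegelSpace.holAt_comp (φ := topBlock) (f := fun W => f (orbitMk (Sp g) W))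
      (analyticEntriesAt_topBlock _) (fun _ => rfl) (by rw [topBlock_inclSucc]; exact hf)
  obtain ⟨h, hh, hfh⟩ := (c.holAt_iff _ c.mem_source _).1 hf'
  rw [c.map_base] at hh
  have hsymm0 : c.e.symm 0 = inclSucc Z := by rw [← c.map_base, c.e.left_inv c.mem_source]
  have htend : Tendsto c.e.symm (𝓝 0) (𝓝 (inclSucc Z)) := by
    have := c.e.continuousAt_symm c.zero_mem
    rwa [ContinuousAt, hsymm0] at this
  let κ : G := ⟨lastRot g, lastRot_smul_incl Z⟩
  let A : G → Module.End ℂ (Fin c.dim → ℂ) := fun γ => c.ρ (γ * κ * γ⁻¹)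
  have hA4 : ∀ γ, A γ ^ 4 = 1 := fun γ => by
    have h1 : κ ^ 4 = 1 := Subtype.ext lastRot_pow
    change c.ρ _ ^ 4 = 1
    rw [← map_pow, conj_pow, h1, mul_one, mul_inv_cancel, map_one]
  have hAc : ∀ γ δ, Commute (A γ) (A δ) := fun γ δ => by
    have h1 : Commute (γ * κ * γ⁻¹) (δ * κ * δ⁻¹) := by
      have h2 : ((γ⁻¹ * δ : G) : Sp (g + 1)) • inclSucc Z = inclSucc Z := (γ⁻¹ * δ).2
      have h3 : Commute ((γ⁻¹ * δ) * κ * (γ⁻¹ * δ)⁻¹) κ := Subtype.ext (lastRot_commute_conj h2)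
      have h4 := (h3.map (MulAut.conj γ).toMonoidHom).symm
      simpa [mul_assoc] using h4
    exact h1.map c.ρ
  -- This is `f` transported to the chart. It is meaningful only over the image of `𝒜_g`; elsewhere
  -- `Function.invFun` returns an arbitrary point.
  let φ : (Fin c.dim → ℂ) → ℂ := fun v =>
    f (Function.invFun (AV.incl g) (orbitMk (Sp (g + 1)) (c.e.symm v)))
  have hφ : ∀ v Z', orbitMk (Sp (g + 1)) (c.e.symm v) = orbitMk (Sp (g + 1)) (inclSucc Z') →
      φ v = f (orbitMk (Sp g) Z') := fun v Z' hv => by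
    simp only [φ]
    rw [hv, ← AV.incl_mk, Function.leftInverse_invFun (AV.incl_injective g)]
  have hκ : ∀ u ∈ c.e.target, c.ρ κ u = u → ∃ Z', inclSucc Z' = c.e.symm u := fun u hu h1 =>
    exists_inclSucc_eq (by
      have := c.symm_rep κ hu
      rw [h1] at this
      exact this.symm)
  have hlin : ∀ γ, Tendsto (c.ρ γ) (𝓝 0) (𝓝 0) := fun γ => by
    have := (LinearMap.continuous_of_finiteDimensional (c.ρ γ)).tendsto 0
    rwa [map_zero] at this
  have han : ∀ γ v, AnalyticAt ℂ (c.ρ γ) v := fun γ v =>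
    (LinearMap.toContinuousLinearMap (c.ρ γ)).analyticAt v
  have hfh0 : ∀ᶠ v in 𝓝 (0 : Fin c.dim → ℂ), v ∈ c.e.target ∧
      f (orbitMk (Sp g) (topBlock (c.e.symm v))) = h v := by
    filter_upwards [htend.eventually hfh, c.e.open_target.mem_nhds c.zero_mem] with v h1 h2
    refine ⟨h2, ?_⟩
    rw [h1, Function.comp_apply, c.e.right_inv h2]
  obtain ⟨H, hH, hHφ⟩ := exists_extension_of_commute (fun γ => proj4 (A γ))
    (fun γ v => proj4_of_fixed (apply_proj4 (hA4 γ) v)) (fun γ δ => proj4_commute (hAc γ δ)) φ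
    (fun γ => by
      refine ⟨fun v => h (c.ρ γ⁻¹ v), ?_, ?_⟩
      · refine AnalyticAt.comp ?_ (han _ _)
        rwa [map_zero]
      · filter_upwards [(hlin γ⁻¹).eventually hfh0] with v ⟨h1, h2⟩ h3
        have h4 : A γ v = v := by rw [← h3, apply_proj4 (hA4 γ)]
        have h5 : c.ρ κ (c.ρ γ⁻¹ v) = c.ρ γ⁻¹ v := by
          conv_rhs => rw [← h4]
          change (c.ρ κ * c.ρ γ⁻¹) v = (c.ρ γ⁻¹ * c.ρ (γ * κ * γ⁻¹)) v
          rw [← map_mul, ← map_mul]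
          congr 2
          group
        obtain ⟨Z', hZ'⟩ := hκ _ h1 h5
        rw [← h2, ← hZ', topBlock_inclSucc, hφ v Z']
        have h6 : v = c.ρ γ (c.ρ γ⁻¹ v) := by
          change v = (c.ρ γ * c.ρ γ⁻¹) v
          rw [← map_mul, mul_inv_cancel, map_one]; rfl
        rw [h6, c.symm_rep γ h1, ← hZ']
        exact orbitMk_smul γ.1 _) Finset.univ
  have hcard : (Fintype.card G : ℂ) ≠ 0 := by exact_mod_cast Fintype.card_ne_zero
  let H' : (Fin c.dim → ℂ) → ℂ := fun v => (Fintype.card G : ℂ)⁻¹ * ∑ γ, H (c.ρ γ v)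
  have hH' : AnalyticAt ℂ H' 0 := by
    refine analyticAt_const.mul (Finset.analyticAt_fun_sum _ fun γ _ => ?_)
    refine AnalyticAt.comp ?_ (han _ _)
    rwa [map_zero]
  have hinv : ∀ γ v, H' (c.ρ γ v) = H' v := fun γ v => by
    simp only [H']
    congr 1
    refine Fintype.sum_equiv (Equiv.mulRight γ) _ _ fun δ => ?_
    rw [Equiv.coe_mulRight, map_mul]
    rfl
  obtain ⟨F, hF⟩ := c.exists_descend H' hinv
  refine ⟨F, ?_, ?_⟩
  · rw [AV.incl_mk]
    refine c.holAt_of_comp actsOn_siegel (h := H') hF c.mem_source ?_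
    rwa [c.map_base]
  · have h1 : ∀ᶠ v in 𝓝 (0 : Fin c.dim → ℂ), ∀ γ ∈ (Finset.univ : Finset G),
        ∀ δ ∈ (Finset.univ : Finset G), proj4 (A δ) (c.ρ γ v) = c.ρ γ v →
          H (c.ρ γ v) = φ (c.ρ γ v) := by
      rw [eventually_all_finset]
      exact fun γ _ => (hlin γ).eventually hHφ
    have h2 : Tendsto c.e (𝓝 (inclSucc Z)) (𝓝 0) := by
      have := c.e.continuousAt c.mem_source
      rwa [ContinuousAt, c.map_base] at this
    have h3 : ∀ᶠ Z' in 𝓝 Z, f (orbitMk (Sp g) Z') = F (AV.incl g (orbitMk (Sp g) Z')) := by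
      filter_upwards [(continuous_inclSucc.tendsto Z).eventually (h2.eventually h1),
        (continuous_inclSucc.tendsto Z).eventually (c.e.open_source.mem_nhds c.mem_source)]
        with Z' h4 h5
      rw [AV.incl_mk, hF _ h5]
      -- A translate by `γ` of a product is fixed by the rotation conjugated by `γ`, so every term
      -- of the average already equals `f`.
      have h6 : ∀ γ, H (c.ρ γ (c.e (inclSucc Z'))) = f (orbitMk (Sp g) Z') := fun γ => by
        rw [h4 γ (Finset.mem_univ _) γ (Finset.mem_univ _)]
        · apply hφ
          rw [c.symm_rep γ (c.e.map_source h5), c.e.left_inv h5]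
          exact orbitMk_smul γ.1 _
        · apply proj4_of_fixed
          change (c.ρ (γ * κ * γ⁻¹) * c.ρ γ) _ = _
          rw [← map_mul, inv_mul_cancel_right, map_mul, Module.End.mul_apply,
            ← c.equivariant κ _ h5]
          congr 2
          exact lastRot_smul_incl Z'
      simp only [H', h6, Finset.sum_const, Finset.card_univ, nsmul_eq_mul]
      rw [inv_mul_cancel_left₀ hcard]
    rw [← isOpenMap_orbitMk.map_nhds_eq continuous_orbitMk.continuousAt]
    exact h3

theorem AV.isClosedSubspaceEmbedding_incl (g : ℕ) :
    IsClosedSubspaceEmbedding (AV.hol g) (AV.hol (g + 1)) (AV.incl g) := by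
  refine ⟨AV.isClosedEmbedding_incl g, fun f p => ⟨AV.exists_extension, ?_⟩⟩
  rintro ⟨F, hF, hfF⟩
  exact (AV.hol g).congr hfF.symm (AV.holAt_comp_incl hF)

end ClosedEmbedding

end UniversalModuli
end

noncomputable section
namespace UniversalModuli
open Filter Metric MulAction

/-! ### Direct limits of sequences of closed embeddings -/

section Limit
variable {X : ℕ → Type} {Y : Type} {j : ∀ n, X n → X (n + 1)} {ι : ∀ n, X n → Y}

theorem range_subset_range_add (hι : ∀ n x, ι (n + 1) (j n x) = ι n x) (n k : ℕ) :
    Set.range (ι n) ⊆ Set.range (ι (n + k)) := by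
  induction k with
  | zero => exact subset_rfl
  | succ k ih =>
    intro y hy
    obtain ⟨x, rfl⟩ := ih hy
    exact ⟨j _ x, hι _ x⟩

theorem range_mono_of_compat (hι : ∀ n x, ι (n + 1) (j n x) = ι n x) {m n : ℕ} (h : m ≤ n) :
    Set.range (ι m) ⊆ Set.range (ι n) := by
  obtain ⟨k, rfl⟩ := Nat.exists_eq_add_of_le h
  exact range_subset_range_add hι m k

variable [∀ n, TopologicalSpace (X n)]

theorem isOpen_preimage_of_add (hj : ∀ n, Continuous (j n))
    (hι : ∀ n x, ι (n + 1) (j n x) = ι n x) {A : Set Y} {m k : ℕ}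
    (h : IsOpen (ι (m + k) ⁻¹' A)) : IsOpen (ι m ⁻¹' A) := by
  induction k with
  | zero => exact h
  | succ k ih =>
    apply ih
    have : ι (m + k) ⁻¹' A = j (m + k) ⁻¹' (ι (m + (k + 1)) ⁻¹' A) := by
      ext x
      change ι (m + k) x ∈ A ↔ ι (m + k + 1) (j (m + k) x) ∈ A
      rw [hι]
    rw [this]
    exact h.preimage (hj _)

/-- At levels above `n` the set is the image of `C` under closed embeddings; at lower levels it is a
preimage of such a set. -/
theorem isClosed_preimage_image (hj : ∀ n, IsClosedEmbedding (j n))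
    (hι : ∀ n x, ι (n + 1) (j n x) = ι n x) (hinj : ∀ n, Function.Injective (ι n)) {n : ℕ}
    {C : Set (X n)} (hC : IsClosed C) (m : ℕ) : IsClosed (ι m ⁻¹' (ι n '' C)) := by
  have hup : ∀ k, IsClosed (ι (n + k) ⁻¹' (ι n '' C)) := by
    intro k
    induction k with
    | zero => rwa [Nat.add_zero, Set.preimage_image_eq _ (hinj n)]
    | succ k ih =>
      have : ι (n + (k + 1)) ⁻¹' (ι n '' C) = j (n + k) '' (ι (n + k) ⁻¹' (ι n '' C)) := by
        ext x
        constructor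
        · rintro ⟨c, hc, hcx⟩
          obtain ⟨c', hc'⟩ := range_subset_range_add hι n k ⟨c, rfl⟩
          refine ⟨c', ⟨c, hc, hc'.symm⟩, hinj (n + (k + 1)) ?_⟩
          rw [← hcx, ← hc']
          exact hι _ _
        · rintro ⟨c', ⟨c, hc, hcc⟩, rfl⟩
          exact ⟨c, hc, hcc.trans (hι _ _).symm⟩
      rw [this]
      exact (hj _).isClosedMap _ ih
  rw [← isOpen_compl_iff, ← Set.preimage_compl]
  apply isOpen_preimage_of_add (fun n => (hj n).continuous) hι (k := n)
  rw [Nat.add_comm, Set.preimage_compl, isOpen_compl_iff]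
  exact hup m

variable [TopologicalSpace Y]

theorem isClosedEmbedding_of_limit (hj : ∀ n, IsClosedEmbedding (j n))
    (hι : ∀ n x, ι (n + 1) (j n x) = ι n x) (hinj : ∀ n, Function.Injective (ι n))
    (htop : ∀ U : Set Y, IsOpen U ↔ ∀ n, IsOpen (ι n ⁻¹' U)) (n : ℕ) :
    IsClosedEmbedding (ι n) := by
  refine .of_continuous_injective_isClosedMap
    (continuous_def.2 fun U hU => (htop U).1 hU n) (hinj n) fun C hC => ?_
  rw [← isOpen_compl_iff, htop]
  intro m
  rw [Set.preimage_compl, isOpen_compl_iff]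
  exact isClosed_preimage_image hj hι hinj hC m

/-- Two points are separated by a continuous function: Urysohn's lemma at a level containing both,
Tietze extension from each level to the next, and continuity of the glued function from the limit
topology. -/
theorem t2Space_of_limit [∀ n, T4Space (X n)] (hj : ∀ n, IsClosedEmbedding (j n))
    (hι : ∀ n x, ι (n + 1) (j n x) = ι n x) (hinj : ∀ n, Function.Injective (ι n))
    (htop : ∀ U : Set Y, IsOpen U ↔ ∀ n, IsOpen (ι n ⁻¹' U))
    (hcover : ∀ y, ∃ n, y ∈ Set.range (ι n)) : T2Space Y := by
  rw [t2Space_iff]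
  intro y y' hne
  obtain ⟨a, ha⟩ := hcover y
  obtain ⟨b, hb⟩ := hcover y'
  obtain ⟨n, p, q, rfl, rfl⟩ : ∃ n p q, ι n p = y ∧ ι n q = y' := by
    obtain ⟨p, hp⟩ := range_mono_of_compat hι (Nat.le_add_right a b) ha
    obtain ⟨q, hq⟩ := range_mono_of_compat hι (Nat.le_add_left b a) hb
    exact ⟨_, p, q, hp, hq⟩
  have hpq : p ≠ q := fun h => hne (h ▸ rfl)
  obtain ⟨f₀, hf0, hf1, -⟩ := exists_continuous_zero_one_of_isClosed (isClosed_singleton (x := p))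
    (isClosed_singleton (x := q)) (Set.disjoint_singleton.2 hpq)
  choose ext hext using fun k (f : C(X (n + k), ℝ)) => f.exists_extension' (hj (n + k))
  let f : ∀ k, C(X (n + k), ℝ) := fun k => Nat.rec (motive := fun k => C(X (n + k), ℝ)) f₀ ext k
  have hf : ∀ k x, f (k + 1) (j (n + k) x) = f k x := fun k x => congrFun (hext k (f k)) x
  have hlift : ∀ k d x, ∃ x' : X (n + (k + d)), ι _ x' = ι (n + k) x ∧ f (k + d) x' = f k x := by
    intro k d x
    induction d with
    | zero => exact ⟨x, rfl, rfl⟩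
    | succ d ih =>
      obtain ⟨x', h1, h2⟩ := ih
      exact ⟨j _ x', (hι _ _).trans h1, (hf _ _).trans h2⟩
  have hwd : ∀ k l x x', ι (n + k) x = ι (n + l) x' → f k x = f l x' := by
    have key : ∀ k d x x', ι (n + k) x = ι (n + (k + d)) x' → f k x = f (k + d) x' := by
      intro k d x x' h
      obtain ⟨x'', h1, h2⟩ := hlift k d x
      rw [← h2, hinj _ (h1.trans h)]
    intro k l x x' h
    rcases le_total k l with hkl | hkl
    · obtain ⟨d, rfl⟩ := Nat.exists_eq_add_of_le hkl
      exact key k d x x' h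
    · obtain ⟨d, rfl⟩ := Nat.exists_eq_add_of_le hkl
      exact (key l d x' x h.symm).symm
  have hcov : ∀ y, ∃ k x, ι (n + k) x = y := fun y => by
    obtain ⟨m, hm⟩ := hcover y
    exact ⟨m, range_mono_of_compat hι (Nat.le_add_left m n) hm⟩
  choose K x hx using hcov
  let F : Y → ℝ := fun y => f (K y) (x y)
  have hF : ∀ k z, F (ι (n + k) z) = f k z := fun k z => hwd _ _ _ _ (hx _)
  have hFc : Continuous F := continuous_def.2 fun U hU => (htop _).2 fun m => by
    apply isOpen_preimage_of_add (fun n => (hj n).continuous) hι (k := n)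
    rw [Nat.add_comm]
    have : ι (n + m) ⁻¹' (F ⁻¹' U) = f m ⁻¹' U := by
      ext z
      rw [Set.mem_preimage, Set.mem_preimage, hF]
      rfl
    rw [this]
    exact hU.preimage (f m).continuous
  have h0 : F (ι n p) = 0 := (hF 0 p).trans (hf0 rfl)
  have h1 : F (ι n q) = 1 := (hF 0 q).trans (hf1 rfl)
  exact separated_by_continuous hFc (by rw [h0, h1]; exact zero_ne_one)

end Limit

/-! ### The universal moduli space -/

section AVInf

theorem AV.toInf_incl (g : ℕ) (p : AV g) : AV.toInf (g + 1) (AV.incl g p) = AV.toInf g p := by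
  obtain ⟨Z, rfl⟩ := orbitMk_surjective p
  change AVInf.mk _ = AVInf.mk _
  rw [UniversalModuli.toInf_incl]

theorem AVInf.isOpen_iff (U : Set AVInf) : IsOpen U ↔ ∀ g, IsOpen (AV.toInf g ⁻¹' U) := by
  have h1 : IsOpen U ↔ IsOpen (AVInf.mk ⁻¹' U) := isQuotientMap_quotient_mk'.isOpen_preimage.symm
  let π : (Σ g, SiegelSpace g) → SiegelSpaceInf := fun x => Quotient.mk _ x
  have h2 : IsOpen (AVInf.mk ⁻¹' U) ↔ IsOpen (π ⁻¹' (AVInf.mk ⁻¹' U)) :=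
    isQuotientMap_quotient_mk'.isOpen_preimage.symm
  rw [h1, h2, isOpen_sigma_iff]
  exact forall_congr' fun g => (isOpenQuotientMap_orbitMk (Γ := Sp g)
    (X := SiegelSpace g)).isQuotientMap.isOpen_preimage (s := AV.toInf g ⁻¹' U)

theorem incl_succ {g h : ℕ} (hgh : g ≤ h) (Z : SiegelSpace g) :
    SiegelSpace.incl g (h + 1) (hgh.trans h.le_succ) Z = inclSucc (SiegelSpace.incl g h hgh Z) :=
  (DirectedSystem.map_map' (f := SiegelSpace.incl) hgh h.le_succ Z).symm

theorem incl_self (g : ℕ) (Z : SiegelSpace g) : SiegelSpace.incl g g le_rfl Z = Z :=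
  DirectedSystem.map_self' (f := SiegelSpace.incl) Z

theorem orbitMk_eq_of_incl {g h : ℕ} (hgh : g ≤ h) {Z W : SiegelSpace g}
    (he : orbitMk (Sp h) (SiegelSpace.incl g h hgh Z) =
      orbitMk (Sp h) (SiegelSpace.incl g h hgh W)) : orbitMk (Sp g) Z = orbitMk (Sp g) W := by
  induction h, hgh using Nat.le_induction with
  | base => rwa [incl_self, incl_self] at he
  | succ k hk ih =>
    apply ih
    apply AV.incl_injective
    rw [AV.incl_mk, AV.incl_mk, ← incl_succ, ← incl_succ]
    exact he

/-- An equivalence in the limit is realized by an element of some finite level, and the factors `E`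
are then cancelled one at a time. -/
theorem AV.toInf_injective (g : ℕ) : Function.Injective (AV.toInf g) := by
  intro p q h
  obtain ⟨Z, rfl⟩ := orbitMk_surjective p
  obtain ⟨W, rfl⟩ := orbitMk_surjective q
  obtain ⟨M, hM⟩ := orbitMk_eq_iff.1
    (show orbitMk SpInf (Z.toInf g) = orbitMk SpInf (W.toInf g) from h)
  obtain ⟨k, N, rfl⟩ := DirectLimit.exists_eq_mk Sp.incl M
  have h1 : N.toInf k • W.toInf g = Z.toInf g := hM
  have hN : (Sp.incl k (max g k) (le_max_right _ _) N).toInf (max g k) = N.toInf k :=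
    DirectLimit.mk_apply (f := Sp.incl) k (max g k) N (le_max_right _ _)
  rw [← hN, ← UniversalModuli.toInf_incl (le_max_left g k) W, ← UniversalModuli.toInf_incl (le_max_left g k) Z,
    ← toInf_smul] at h1
  have h2 := DirectLimit.mk_injective (f := SiegelSpace.incl)
    (fun i j hij => (SiegelSpace.incl i j hij).injective) _ h1
  refine orbitMk_eq_of_incl (le_max_left g k) ?_
  exact orbitMk_eq_iff.2 ⟨_, h2⟩

theorem AVInf.exists_toInf_eq (x : AVInf) : ∃ n p, AV.toInf (n + 1) p = x := by
  obtain ⟨y, rfl⟩ := Quotient.mk_surjective x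
  obtain ⟨g, Z, rfl⟩ := DirectLimit.exists_eq_mk SiegelSpace.incl y
  exact ⟨g, AV.incl g (orbitMk (Sp g) Z), AV.toInf_incl g _⟩

theorem AVInf.isOpen_iff_succ (U : Set AVInf) :
    IsOpen U ↔ ∀ n, IsOpen (AV.toInf (n + 1) ⁻¹' U) := by
  rw [AVInf.isOpen_iff]
  refine ⟨fun h n => h _, fun h g => ?_⟩
  have : AV.toInf g ⁻¹' U = AV.incl g ⁻¹' (AV.toInf (g + 1) ⁻¹' U) := by
    ext p
    change AV.toInf g p ∈ U ↔ AV.toInf (g + 1) (AV.incl g p) ∈ U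
    rw [AV.toInf_incl]
  rw [this]
  exact (h g).preimage (AV.continuous_incl g)

instance (g : ℕ) : LocallyCompactSpace (AV g) :=
  isOpenQuotientMap_orbitMk.locallyCompactSpace (f := orbitMk (Sp g))

instance (g : ℕ) : SecondCountableTopology (AV g) :=
  ContinuousConstSMul.secondCountableTopology

instance (g : ℕ) : T4Space (AV g) := inferInstance

theorem AV.isClosedEmbedding_toInf (n : ℕ) : IsClosedEmbedding (AV.toInf (n + 1)) :=
  isClosedEmbedding_of_limit (X := fun n => AV (n + 1)) (j := fun n => AV.incl (n + 1))
    (ι := fun n => AV.toInf (n + 1)) (fun n => AV.isClosedEmbedding_incl (n + 1))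
    (fun n => AV.toInf_incl (n + 1)) (fun n => AV.toInf_injective (n + 1))
    AVInf.isOpen_iff_succ n

instance : T2Space AVInf :=
  t2Space_of_limit (X := fun n => AV (n + 1)) (j := fun n => AV.incl (n + 1))
    (ι := fun n => AV.toInf (n + 1)) (fun n => AV.isClosedEmbedding_incl (n + 1))
    (fun n => AV.toInf_incl (n + 1)) (fun n => AV.toInf_injective (n + 1))
    AVInf.isOpen_iff_succ AVInf.exists_toInf_eq

theorem AVInf.sheaf_iff (U : Set AVInf) (f : AVInf → ℂ) (hU : IsOpen U) :
    (∀ x ∈ U, AVInf.hol.HolAt f x) ↔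
      ∀ n, ∀ p ∈ AV.toInf (n + 1) ⁻¹' U, (AV.hol (n + 1)).HolAt (f ∘ AV.toInf (n + 1)) p := by
  constructor
  · intro h n p hp
    obtain ⟨Z, rfl⟩ := orbitMk_surjective p
    rw [AV.holAt_iff]
    exact ((h _ hp).self_of_nhds () (Z.toInf (n + 1)) rfl).self_of_nhds (n + 1) Z rfl
  · intro h x hx
    -- The sheaf on `𝔥_∞` tests all levels including 0, whereas the hypothesis starts at level 1.
    -- Level `g` is reached by restriction from level `g + 1`.
    have h' : ∀ g (Z : SiegelSpace g), AVInf.mk (Z.toInf g) ∈ U →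
        (SiegelSpace.hol g).HolAt (fun W => f (AVInf.mk (W.toInf g))) Z := by
      intro g Z hZ
      have h1 : AV.toInf (g + 1) (orbitMk (Sp (g + 1)) (inclSucc Z)) ∈ U := by
        rw [← AV.incl_mk, AV.toInf_incl]; exact hZ
      have h2 := AV.holAt_comp_incl (p := orbitMk (Sp g) Z) (h g _ h1)
      rw [AV.holAt_iff] at h2
      refine (SiegelSpace.hol g).congr (Eventually.of_forall fun W => ?_) h2
      change f (AV.toInf (g + 1) (AV.incl g (orbitMk (Sp g) W))) = _
      rw [AV.toInf_incl]
      rfl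
    change ∀ᶠ x' in 𝓝 x, _
    filter_upwards [hU.mem_nhds hx] with x' hx' _ y hy
    subst hy
    change ∀ᶠ y' in 𝓝 y, _
    filter_upwards [(hU.preimage AVInf.continuous_mk).mem_nhds hx'] with y' hy' g Z hZ
    subst hZ
    exact h' g Z hy'

theorem isIndComplexSpace_AVInf :
    IsIndComplexSpace AVInf.hol (Y := fun n => AV (n + 1)) (fun n => AV.hol (n + 1))
      (fun n => AV.incl (n + 1)) (fun n => AV.toInf (n + 1)) where
  t2 := inferInstance
  isComplexSpace n := isComplexSpace_AV (n + 1)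
  transition n := AV.isClosedSubspaceEmbedding_incl (n + 1)
  compat n := AV.toInf_incl (n + 1)
  isClosedEmbedding := AV.isClosedEmbedding_toInf
  cover := Set.eq_univ_of_forall fun x => by
    obtain ⟨n, p, hp⟩ := AVInf.exists_toInf_eq x
    exact Set.mem_iUnion.2 ⟨n, p, hp⟩
  topology := AVInf.isOpen_iff_succ
  sheaf := AVInf.sheaf_iff

end AVInf

end UniversalModuli
end

noncomputable section
namespace UniversalModuli
open Filter Metric MulAction

/-! ### The canonical stratifications -/

section Stratification

theorem connectedComponentIn_preimage_val {X : Type} [TopologicalSpace X] {D F : Set X}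
    (hF : F ⊆ D) {x : D} (hx : x.1 ∈ F) :
    connectedComponentIn (Subtype.val ⁻¹' F) x = Subtype.val ⁻¹' connectedComponentIn F x.1 := by
  apply subset_antisymm
  · rw [← Set.image_subset_iff]
    refine (isPreconnected_connectedComponentIn.image _
      continuous_subtype_val.continuousOn).subset_connectedComponentIn
      ⟨x, mem_connectedComponentIn hx, rfl⟩ ?_
    rintro _ ⟨y, hy, rfl⟩
    exact connectedComponentIn_subset (Subtype.val ⁻¹' F) x hy
  · refine IsPreconnected.subset_connectedComponentIn ?_ (mem_connectedComponentIn hx)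
      (Set.preimage_mono (connectedComponentIn_subset _ _))
    rw [← IsInducing.subtypeVal.isPreconnected_image, Subtype.image_preimage_coe,
      Set.inter_eq_right.2 ((connectedComponentIn_subset _ _).trans hF)]
    exact isPreconnected_connectedComponentIn

/-- By `orbitMk_mem_range_incl`, lying in `𝒜_g` depends only on the orbit type. So orbit type loci
never straddle the difference. -/
theorem orbitTypeLocus_subset_diff {n : ℕ} {Z : SiegelSpace (n + 1)}
    (hZ : orbitMk (Sp (n + 1)) Z ∈ AV.diff n) : orbitTypeLocus (Sp (n + 1)) Z ⊆ AV.diff n := by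
  cases n with
  | zero => exact fun _ _ => Set.mem_univ _
  | succ n =>
    rintro _ ⟨W, rfl, δ, hδ⟩ hW
    obtain ⟨γ, hγ⟩ := orbitMk_mem_range_incl.1 hW
    refine hZ (orbitMk_mem_range_incl.2 ⟨δ⁻¹ * γ, ?_⟩)
    rw [hδ] at hγ
    obtain ⟨k, hk, hk'⟩ := hγ
    have : δ⁻¹ * γ * lastRot (n + 1) * (δ⁻¹ * γ)⁻¹ = k := by
      have h1 : γ * lastRot (n + 1) * γ⁻¹ = δ * k * δ⁻¹ := hk'.symm
      calc δ⁻¹ * γ * lastRot (n + 1) * (δ⁻¹ * γ)⁻¹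
          = δ⁻¹ * (γ * lastRot (n + 1) * γ⁻¹) * δ := by group
        _ = k := by rw [h1]; group
    rw [this]
    exact hk

theorem stratum_subset_diff {n : ℕ} {Z : SiegelSpace (n + 1)}
    (hZ : orbitMk (Sp (n + 1)) Z ∈ AV.diff n) : stratum (Sp (n + 1)) Z ⊆ AV.diff n :=
  (stratum_subset Z).trans (orbitTypeLocus_subset_diff hZ)

theorem mem_strata_iff {n : ℕ} {S : Set (AV.diff n)} :
    S ∈ AV.strata n ↔ ∃ Z : SiegelSpace (n + 1), orbitMk (Sp (n + 1)) Z ∈ AV.diff n ∧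
      S = Subtype.val ⁻¹' stratum (Sp (n + 1)) Z := by
  have h : ∀ (Z : SiegelSpace (n + 1)) (hZ : orbitMk (Sp (n + 1)) Z ∈ AV.diff n),
      connectedComponentIn (Subtype.val ⁻¹' orbitTypeLocus (Sp (n + 1)) Z)
        (⟨orbitMk (Sp (n + 1)) Z, hZ⟩ : AV.diff n) = Subtype.val ⁻¹' stratum (Sp (n + 1)) Z :=
    fun Z hZ => connectedComponentIn_preimage_val (orbitTypeLocus_subset_diff hZ)
      (orbitMk_mem_orbitTypeLocus.2 (SameOrbitType.refl Z))
  constructor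
  · rintro ⟨Z, hZ, rfl⟩
    exact ⟨Z, hZ, h Z hZ⟩
  · rintro ⟨Z, hZ, rfl⟩
    exact ⟨Z, hZ, (h Z hZ).symm⟩

theorem image_val_preimage_stratum {n : ℕ} {Z : SiegelSpace (n + 1)}
    (hZ : orbitMk (Sp (n + 1)) Z ∈ AV.diff n) :
    (Subtype.val '' (Subtype.val ⁻¹' stratum (Sp (n + 1)) Z : Set (AV.diff n))) =
      stratum (Sp (n + 1)) Z := by
  rw [Subtype.image_preimage_coe, Set.inter_eq_right.2 (stratum_subset_diff hZ)]

theorem mem_infStrata_iff {S : Set AVInf} :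
    S ∈ AVInf.strata ↔ ∃ (n : ℕ) (Z : SiegelSpace (n + 1)), orbitMk (Sp (n + 1)) Z ∈ AV.diff n ∧
      S = AV.toInf (n + 1) '' stratum (Sp (n + 1)) Z := by
  have h : ∀ n (T : Set (AV.diff n)), (fun q : AV.diff n => AV.toInf (n + 1) q.1) '' T =
      AV.toInf (n + 1) '' (Subtype.val '' T) := fun n T => (Set.image_image _ _ _).symm
  constructor
  · rintro ⟨n, T, hT, rfl⟩
    obtain ⟨Z, hZ, rfl⟩ := mem_strata_iff.1 hT
    refine ⟨n, Z, hZ, ?_⟩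
    rw [h, image_val_preimage_stratum hZ]
  · rintro ⟨n, Z, hZ, rfl⟩
    refine ⟨n, _, mem_strata_iff.2 ⟨Z, hZ, rfl⟩, ?_⟩
    rw [h, image_val_preimage_stratum hZ]

/-! ### The frontier condition -/

/-- Near each of its points a stratum consists of images of points with the same isotropy group, so
`hloc` makes `A` open in the stratum. It is also closed, and the stratum is connected. -/
theorem stratum_subset_of_isClosed {a : ℕ} {z : SiegelSpace a} {A : Set (AV a)} (hA : IsClosed A)
    (hloc : ∀ y, orbitMk (Sp a) y ∈ A → ∃ O ∈ 𝓝 y, ∀ y' ∈ O,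
      stabilizer (Sp a) y ≤ stabilizer (Sp a) y' → orbitMk (Sp a) y' ∈ A)
    (hne : (stratum (Sp a) z ∩ A).Nonempty) : stratum (Sp a) z ⊆ A := by
  have h1 : stratum (Sp a) z ∩ A ⊆ interior (A ∪ (stratum (Sp a) z)ᶜ) := by
    rintro q ⟨hq, hqA⟩
    obtain ⟨y, rfl⟩ := orbitMk_surjective q
    obtain ⟨O, hO, hOA⟩ := hloc y hqA
    obtain ⟨V, hV, hVO⟩ := exists_nhds_stratum_inter nonempty_linearChart y hO
    rw [mem_interior_iff_mem_nhds]
    filter_upwards [hV] with q hqV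
    by_cases h : q ∈ stratum (Sp a) z
    · left
      rw [← stratum_eq hq] at h
      obtain ⟨y', hy', rfl, hs⟩ := hVO q ⟨h, hqV⟩
      exact hOA y' hy' hs.ge
    · exact Or.inr h
  have h2 := isPreconnected_iff_subset_of_disjoint.1 (isConnected_stratum z).isPreconnected
    (interior (A ∪ (stratum (Sp a) z)ᶜ)) Aᶜ isOpen_interior hA.isOpen_compl ?_ ?_
  · rcases h2 with h | h
    · intro q hq
      exact (interior_subset (h hq)).resolve_right fun h' => h' hq
    · obtain ⟨q, hq, hqA⟩ := hne
      exact absurd hqA (h hq)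
  · intro q hq
    by_cases hqA : q ∈ A
    · exact Or.inl (h1 ⟨hq, hqA⟩)
    · exact Or.inr hqA
  · rw [Set.eq_empty_iff_forall_notMem]
    rintro q ⟨hq, hq1, hq2⟩
    exact hq2 ((interior_subset hq1).resolve_right fun h' => h' hq)

theorem continuous_incl {g h : ℕ} (hgh : g ≤ h) : Continuous (SiegelSpace.incl g h hgh) := by
  induction h, hgh using Nat.le_induction with
  | base =>
    rw [show (SiegelSpace.incl g g le_rfl : SiegelSpace g → SiegelSpace g) = id from
      funext (incl_self g)]
    exact continuous_id
  | succ k hk ih =>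
    rw [show (SiegelSpace.incl g (k + 1) (hk.trans k.le_succ) : SiegelSpace g → SiegelSpace (k + 1))
      = inclSucc ∘ SiegelSpace.incl g k hk from funext (incl_succ hk)]
    exact continuous_inclSucc.comp ih

theorem stabilizer_le_of_incl {g h : ℕ} (hgh : g ≤ h) {Z W : SiegelSpace g}
    (hZW : stabilizer (Sp g) Z ≤ stabilizer (Sp g) W) :
    stabilizer (Sp h) (SiegelSpace.incl g h hgh Z) ≤
      stabilizer (Sp h) (SiegelSpace.incl g h hgh W) := by
  induction h, hgh using Nat.le_induction with
  | base => rwa [incl_self, incl_self]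
  | succ k hk ih =>
    rw [incl_succ hk, incl_succ hk]
    exact stabilizer_incl_le ih

theorem toInf_orbitMk_incl {g h : ℕ} (hgh : g ≤ h) (Z : SiegelSpace g) :
    AV.toInf h (orbitMk (Sp h) (SiegelSpace.incl g h hgh Z)) = AV.toInf g (orbitMk (Sp g) Z) := by
  change AVInf.mk _ = AVInf.mk _
  rw [toInf_incl]

/-- A stratum that meets the closure of a stratum of the same or a higher level is contained in
it. -/
theorem image_stratum_subset {n m : ℕ} (hnm : n ≤ m) {z : SiegelSpace (n + 1)}
    {w : SiegelSpace (m + 1)}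
    (hne : (AV.toInf (n + 1) '' stratum (Sp (n + 1)) z ∩
      AV.toInf (m + 1) '' closure (stratum (Sp (m + 1)) w)).Nonempty) :
    AV.toInf (n + 1) '' stratum (Sp (n + 1)) z ⊆
      AV.toInf (m + 1) '' closure (stratum (Sp (m + 1)) w) := by
  have hnm' : n + 1 ≤ m + 1 := by omega
  rw [Set.image_subset_iff]
  have hA : ∀ y, orbitMk (Sp (n + 1)) y ∈ AV.toInf (n + 1) ⁻¹' (AV.toInf (m + 1) ''
      closure (stratum (Sp (m + 1)) w)) ↔
      orbitMk (Sp (m + 1)) (SiegelSpace.incl _ _ hnm' y) ∈ closure (stratum (Sp (m + 1)) w) := by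
    intro y
    rw [Set.mem_preimage, ← toInf_orbitMk_incl hnm', (AV.toInf_injective _).mem_set_image]
  refine stratum_subset_of_isClosed
    (((AV.isClosedEmbedding_toInf m).isClosedMap _ isClosed_closure).preimage
      (AV.isClosedEmbedding_toInf n).continuous) (fun y hy => ?_) ?_
  · rw [hA] at hy
    obtain ⟨O, hO, hOA⟩ := exists_nhds_mem_closure_stratum nonempty_linearChart hy
    refine ⟨_, (continuous_incl hnm').continuousAt hO, fun y' hy' hs => ?_⟩
    rw [hA]
    -- An inclusion of isotropy groups at the lower level persists at the higher one, where the
    -- closure criterion for the stratum of `w` applies.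
    exact hOA _ hy' (stabilizer_le_of_incl hnm' hs)
  · obtain ⟨_, ⟨p, hp, rfl⟩, hq⟩ := hne
    exact ⟨p, hp, hq⟩

theorem stratum_subset_closure {n : ℕ} {z w : SiegelSpace (n + 1)}
    (hne : (stratum (Sp (n + 1)) z ∩ closure (stratum (Sp (n + 1)) w)).Nonempty) :
    stratum (Sp (n + 1)) z ⊆ closure (stratum (Sp (n + 1)) w) := by
  rw [← Set.image_subset_image_iff (AV.toInf_injective (n + 1))]
  apply image_stratum_subset le_rfl
  rw [← Set.image_inter (AV.toInf_injective (n + 1))]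
  exact hne.image _

theorem isComplexManifold_stratum {n : ℕ} (z : SiegelSpace n) :
    IsComplexManifold ((AV.hol n).induced (Subtype.val : stratum (Sp n) z → AV n)
      continuous_subtype_val) :=
  isComplexManifold_of_range_eq_stratum nonempty_linearChart actsOn_siegel _ Subtype.val
    IsEmbedding.subtypeVal z Subtype.range_coe fun _ _ => Iff.rfl

theorem isComplexStratification_diff (n : ℕ) :
    IsComplexStratification (κ := Unit) (Y := fun _ => AV.diff n)
      (fun _ => (AV.hol (n + 1)).induced Subtype.val continuous_subtype_val)
      (fun _ => id) (AV.strata n) where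
  partition := by
    refine ⟨fun h => ?_, fun q => ?_⟩
    · obtain ⟨Z, hZ, he⟩ := mem_strata_iff.1 h
      have : (⟨_, hZ⟩ : AV.diff n) ∈ (∅ : Set (AV.diff n)) := he ▸ mem_stratum Z
      exact this
    · obtain ⟨Z, hZ⟩ := orbitMk_surjective q.1
      refine ⟨_, ⟨mem_strata_iff.2 ⟨Z, by rw [hZ]; exact q.2, rfl⟩, ?_⟩, ?_⟩
      · rw [Set.mem_preimage, ← hZ]
        exact mem_stratum Z
      · rintro S ⟨hS, hq⟩
        obtain ⟨W, hW, rfl⟩ := mem_strata_iff.1 hS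
        rw [Set.mem_preimage, ← hZ] at hq
        rw [stratum_eq hq]
  isConnected S hS := by
    obtain ⟨Z, hZ, rfl⟩ := mem_strata_iff.1 hS
    refine ⟨⟨⟨_, hZ⟩, mem_stratum Z⟩, ?_⟩
    rw [← IsInducing.subtypeVal.isPreconnected_image, image_val_preimage_stratum hZ]
    exact (isConnected_stratum Z).isPreconnected
  isLocallyClosed S hS := by
    obtain ⟨Z, hZ, rfl⟩ := mem_strata_iff.1 hS
    exact (isLocallyClosed_stratum nonempty_linearChart Z).preimage continuous_subtype_val
  isComplexManifold S hS := by
    obtain ⟨Z, hZ, rfl⟩ := mem_strata_iff.1 hS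
    refine ⟨(), _, Set.image_id _, ?_⟩
    refine isComplexManifold_of_range_eq_stratum nonempty_linearChart actsOn_siegel _
      (fun t => t.1.1) (IsEmbedding.subtypeVal.comp IsEmbedding.subtypeVal) Z ?_ fun f t => ?_
    · rw [← image_val_preimage_stratum hZ]
      ext q
      simp [and_comm]
    · constructor
      · rintro ⟨F₁, ⟨F₂, hF₂, h2⟩, h1⟩
        refine ⟨F₂, hF₂, ?_⟩
        filter_upwards [h1, (continuous_subtype_val (p := fun q : AV.diff n =>
          q ∈ Subtype.val ⁻¹' stratum (Sp (n + 1)) Z)).continuousAt.eventually h2] with s h3 h4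
        rw [h3, Function.comp_apply, h4]
        rfl
      · rintro ⟨F, hF, h⟩
        exact ⟨F ∘ Subtype.val, ⟨F, hF, EventuallyEq.rfl⟩, h⟩
  saturated S _ _ := Or.inl fun q _ => ⟨q, rfl⟩
  locallyFinite _ q := by
    obtain ⟨Z, hZ⟩ := orbitMk_surjective q.1
    obtain ⟨O, hO, hfin⟩ := finite_strata nonempty_linearChart Z
    rw [hZ] at hO
    refine ⟨Subtype.val ⁻¹' O, continuous_subtype_val.continuousAt hO, ?_⟩
    refine Set.Finite.of_finite_image (f := fun S : AV.strata n => Subtype.val '' S.1)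
      (hfin.subset ?_) ?_
    · rintro _ ⟨⟨S, hS⟩, ⟨p, hp, hpO⟩, rfl⟩
      obtain ⟨W, hW, rfl⟩ := mem_strata_iff.1 hS
      change Subtype.val '' _ ∈ _
      rw [image_val_preimage_stratum hW]
      exact ⟨⟨W, rfl⟩, p.1, hp, hpO⟩
    · intro S _ T _ h
      exact Subtype.ext (Subtype.val_injective.image_injective h)
  frontier S hS T hT hST := by
    obtain ⟨Z, hZ, rfl⟩ := mem_strata_iff.1 hS
    obtain ⟨W, hW, rfl⟩ := mem_strata_iff.1 hT
    have hcl : closure (Subtype.val ⁻¹' stratum (Sp (n + 1)) W : Set (AV.diff n)) =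
        Subtype.val ⁻¹' closure (stratum (Sp (n + 1)) W) := by
      rw [IsInducing.subtypeVal.closure_eq_preimage_closure_image, image_val_preimage_stratum hW]
    rw [hcl] at hST ⊢
    obtain ⟨q, hq, hq'⟩ := hST
    exact Set.preimage_mono (stratum_subset_closure ⟨q.1, hq, hq'⟩)

theorem toInf_range_mono {m n : ℕ} (h : m ≤ n) :
    Set.range (AV.toInf (m + 1)) ⊆ Set.range (AV.toInf (n + 1)) :=
  range_mono_of_compat (X := fun n => AV (n + 1)) (j := fun n => AV.incl (n + 1))
    (ι := fun n => AV.toInf (n + 1)) (fun n => AV.toInf_incl (n + 1)) h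

theorem toInf_notMem_range {m n : ℕ} (h : m < n) {p : AV (n + 1)} (hp : p ∈ AV.diff n) :
    AV.toInf (n + 1) p ∉ Set.range (AV.toInf (m + 1)) := by
  obtain ⟨k, rfl⟩ : ∃ k, n = k + 1 := ⟨n - 1, by omega⟩
  intro hm
  obtain ⟨q, hq⟩ := toInf_range_mono (Nat.lt_succ_iff.1 h) hm
  refine hp ⟨q, AV.toInf_injective _ ?_⟩
  rw [AV.toInf_incl, hq]

theorem exists_toInf_diff (x : AVInf) : ∃ n, ∃ p ∈ AV.diff n, AV.toInf (n + 1) p = x := by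
  classical
  have hx : ∃ n, x ∈ Set.range (AV.toInf (n + 1)) := AVInf.exists_toInf_eq x
  obtain ⟨p, hp⟩ := Nat.find_spec hx
  refine ⟨Nat.find hx, p, ?_, hp⟩
  have hmin := fun m (hm : m < Nat.find hx) => Nat.find_min hx hm
  generalize Nat.find hx = n at p hp hmin
  cases n with
  | zero => exact Set.mem_univ _
  | succ k =>
    rintro ⟨q, rfl⟩
    exact hmin k (Nat.lt_succ_self k) ⟨q, by rw [← hp, AV.toInf_incl]⟩

theorem level_le {m n : ℕ} {p : AV (n + 1)} (hp : p ∈ AV.diff n)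
    (h : AV.toInf (n + 1) p ∈ Set.range (AV.toInf (m + 1))) : n ≤ m := by
  by_contra! hlt
  exact toInf_notMem_range hlt hp h

/-- At a point of `𝒜_{n+1}` this is local finiteness there; at any other point the complement of
this closed subspace is a neighbourhood that meets none of the sets. -/
theorem exists_nhds_finite_level (x : AVInf) (n : ℕ) : ∃ O ∈ 𝓝 x,
    {S : Set AVInf | (∃ Z : SiegelSpace (n + 1), S = AV.toInf (n + 1) '' stratum (Sp (n + 1)) Z) ∧
      (S ∩ O).Nonempty}.Finite := by
  by_cases hx : x ∈ Set.range (AV.toInf (n + 1))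
  · obtain ⟨p, rfl⟩ := hx
    obtain ⟨Z, rfl⟩ := orbitMk_surjective p
    obtain ⟨O, hO, hfin⟩ := finite_strata nonempty_linearChart Z
    rw [(AV.isClosedEmbedding_toInf n).isInducing.nhds_eq_comap] at hO
    obtain ⟨O', hO', hsub⟩ := hO
    refine ⟨O', hO', (hfin.image fun T => AV.toInf (n + 1) '' T).subset ?_⟩
    rintro _ ⟨⟨W, rfl⟩, _, ⟨q, hq, rfl⟩, hqO⟩
    exact ⟨_, ⟨⟨W, rfl⟩, q, hq, hsub hqO⟩, rfl⟩
  · refine ⟨_, (AV.isClosedEmbedding_toInf n).isClosed_range.isOpen_compl.mem_nhds hx, ?_⟩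
    refine Set.finite_empty.subset ?_
    rintro _ ⟨⟨W, rfl⟩, _, ⟨q, hq, rfl⟩, hqO⟩
    exact hqO ⟨q, rfl⟩

theorem isComplexStratification_AVInf :
    IsComplexStratification (Y := fun n => AV (n + 1)) (fun n => AV.hol (n + 1))
      (fun n => AV.toInf (n + 1)) AVInf.strata where
  partition := by
    refine ⟨fun h => ?_, fun x => ?_⟩
    · obtain ⟨n, Z, -, he⟩ := mem_infStrata_iff.1 h
      have : AV.toInf (n + 1) (orbitMk _ Z) ∈ (∅ : Set AVInf) :=
        he ▸ Set.mem_image_of_mem _ (mem_stratum Z)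
      exact this
    · obtain ⟨n, p, hp, rfl⟩ := exists_toInf_diff x
      obtain ⟨Z, rfl⟩ := orbitMk_surjective p
      refine ⟨_, ⟨mem_infStrata_iff.2 ⟨n, Z, hp, rfl⟩, ⟨_, mem_stratum Z, rfl⟩⟩, ?_⟩
      rintro S ⟨hS, hx⟩
      obtain ⟨m, W, hW, rfl⟩ := mem_infStrata_iff.1 hS
      obtain ⟨q, hq, hqp⟩ := hx
      have h1 : n ≤ m := level_le hp ⟨q, hqp⟩
      have h2 : m ≤ n := level_le (stratum_subset_diff hW hq) ⟨_, hqp.symm⟩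
      obtain rfl := le_antisymm h1 h2
      rw [AV.toInf_injective _ hqp] at hq
      rw [stratum_eq hq]
  isConnected S hS := by
    obtain ⟨n, Z, -, rfl⟩ := mem_infStrata_iff.1 hS
    exact (isConnected_stratum Z).image _ (AV.isClosedEmbedding_toInf n).continuous.continuousOn
  isLocallyClosed S hS := by
    obtain ⟨n, Z, -, rfl⟩ := mem_infStrata_iff.1 hS
    exact (isLocallyClosed_stratum nonempty_linearChart Z).image
      (AV.isClosedEmbedding_toInf n).isInducing
      (AV.isClosedEmbedding_toInf n).isClosed_range.isLocallyClosed
  isComplexManifold S hS := by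
    obtain ⟨n, Z, -, rfl⟩ := mem_infStrata_iff.1 hS
    exact ⟨n, _, rfl, isComplexManifold_stratum Z⟩
  saturated S hS k := by
    obtain ⟨n, Z, hZ, rfl⟩ := mem_infStrata_iff.1 hS
    rcases le_or_gt n k with h | h
    · exact Or.inl ((Set.image_subset_range _ _).trans (toInf_range_mono h))
    · refine Or.inr (Set.disjoint_left.2 ?_)
      rintro _ ⟨p, hp, rfl⟩
      exact toInf_notMem_range h (stratum_subset_diff hZ hp)
  locallyFinite k p := by
    -- Strata that meet `𝒜_{k+1}` have level at most `k`, so finitely many of these neighbourhoods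
    -- need to be intersected.
    choose O hO hfin using exists_nhds_finite_level (AV.toInf (k + 1) p)
    refine ⟨AV.toInf (k + 1) ⁻¹' ⋂ n ∈ Set.Iic k, O n,
      (AV.isClosedEmbedding_toInf k).continuous.continuousAt
        ((biInter_mem (Set.finite_Iic k)).2 fun n _ => hO n), ?_⟩
    refine Set.Finite.of_finite_image (f := Subtype.val)
      (((Set.finite_Iic k).biUnion fun n _ => hfin n).subset ?_) Subtype.val_injective.injOn
    rintro _ ⟨⟨S, hS⟩, ⟨q, hq, hqO⟩, rfl⟩
    obtain ⟨n, Z, hZ, rfl⟩ := mem_infStrata_iff.1 hS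
    obtain ⟨r, hr, hrq⟩ := id hq
    have hn : n ≤ k := level_le (stratum_subset_diff hZ hr) ⟨q, hrq.symm⟩
    exact Set.mem_biUnion hn ⟨⟨Z, rfl⟩, _, hq, Set.mem_iInter₂.1 hqO n hn⟩
  frontier S hS T hT hST := by
    obtain ⟨n, Z, hZ, rfl⟩ := mem_infStrata_iff.1 hS
    obtain ⟨m, W, hW, rfl⟩ := mem_infStrata_iff.1 hT
    rw [(AV.isClosedEmbedding_toInf m).closure_image_eq] at hST ⊢
    refine image_stratum_subset ?_ hST
    -- The closure of a stratum of level `m` stays in the closed subspace `𝒜_{m+1}`, so a stratum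
    -- meeting it has level at most `m`.
    obtain ⟨_, ⟨p, hp, rfl⟩, q, -, hq⟩ := hST
    exact level_le (stratum_subset_diff hZ hp) ⟨q, hq⟩

end Stratification

end UniversalModuli
end

theorem mainTheorem10 :
    IsIndComplexSpace AVInf.hol (Y := fun n => AV (n + 1)) (fun n => AV.hol (n + 1))
      (fun n => AV.incl (n + 1)) (fun n => AV.toInf (n + 1)) ∧
    (∀ n : ℕ, IsComplexStratification (κ := Unit) (Y := fun _ => AV.diff n)
      (fun _ => (AV.hol (n + 1)).induced Subtype.val continuous_subtype_val)
      (fun _ => id) (AV.strata n)) ∧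
    IsComplexStratification (Y := fun n => AV (n + 1)) (fun n => AV.hol (n + 1))
      (fun n => AV.toInf (n + 1)) AVInf.strata :=
  ⟨isIndComplexSpace_AVInf, isComplexStratification_diff, isComplexStratification_AVInf⟩
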